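/- Let $C$ be a compact connected Riemann surface of genus $g>1$, and let $\mathcal S$ be a super Riemann surface with reduced space $C$: a complex supermanifold of dimension $(1|1)$ whose tangent sheaf has a subsheaf $\mathfrak D$, locally generated by an odd vector field $D$ such that $D$ and $D^2=\tfrac12[D,D]$ form a local basis of the tangent sheaf (so that $\mathfrak D$ has rank $(0|1)$ and the supercommutator induces $\mathfrak D^{\otimes 2}\cong \mathcal T_{\mathcal S}/\mathfrak D$). Let $\mathcal X\to\mathbb C^{0|2}$ be an odd, second-order deformation of $\mathcal S$. That is, $\mathcal X$ is a complex supermanifold of dimension $(1|3)$ with reduced space $C$, modelled on a holomorphic vector bundle $E$ of rank $3$ on $C$ (it is locally isomorphic to $(C,\wedge^\bullet\mathcal E)$, with $\mathcal J/\mathcal J^2\cong\mathcal E$ for the ideal $\mathcal J$ generated by the odd functions), and it has an atlas with local coordinates $(x,\theta,\xi_1,\xi_2)$ such that: the odd coordinates $\xi_1,\xi_2$ agree on all overlaps; the transition maps are superconformal families parametrised by $\xi=(\xi_1,\xi_2)$, i.e. they preserve the distribution generated by $\partial_\theta+\theta\,\partial_x$; and at $\xi=0$ they are the transition maps of an atlas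 of $\mathcal S$, over the same covering of $C$ and with the same reduced even coordinates, by coordinates $(x,\theta)$ in which $\partial_\theta+\theta\,\partial_x$ is a section of $\mathfrak D$. For any atlas of $\mathcal X$, with coordinates $(x,\theta_1,\theta_2,\theta_3)$ on $U$ and $(y,\eta_1,\eta_2,\eta_3)$ on $V$ and $y=f_{UV}(x)+\sum_{i<j} f_{UV}^{ij}(x)\,\theta_i\theta_j$ on $U\cap V$, the sections $\omega_{UV}=\sum_{i<j} f_{UV}^{ij}\,\theta_i\wedge\theta_j\otimes\frac{\partial}{\partial y}$ of $\wedge^2\mathcal E\otimes\mathcal T_C$ form a Čech $1$-cocycle, and its class $\omega_{\mathcal X}\in H^1(C,\wedge^2\mathcal E\otimes\mathcal T_C)$, the primary obstruction class of $\mathcal X$, does not depend on the atlas. Then $\mathcal X$ is split, i.e. isomorphic as a complex supermanifold to $(C,\wedge^\bullet\mathcal E)$, if and only if $\omega_{\mathcal X}=0$. -/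

import Mathlib

universe u v

open scoped Manifold ContDiff TensorProduct

noncomputable section

namespace SuperGeom

open TopologicalSpace CategoryTheory Opposite

/-! ### Sheaves of (not necessarily commutative) `ℂ`-algebras and superspaces -/

/-- A sheaf of associative unital `ℂ`-algebras on the topological space `M`. -/
abbrev AlgSheaf (M : Type u) [TopologicalSpace M] : Type (u + 1) :=
  TopCat.Sheaf (AlgCat.{u} ℂ) (TopCat.of M)

namespace AlgSheaf

variable {M : Type u} [TopologicalSpace M]

/-- The algebra of sections over an open set. -/
abbrev sections (A : AlgSheaf M) (U : Opens M) : Type u :=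
  A.1.obj (op U)

/-- Restriction of sections. -/
def res (A : AlgSheaf M) {U V : Opens M} (h : V ≤ U) : A.sections U →ₐ[ℂ] A.sections V :=
  (A.1.map (homOfLE h).op).hom

end AlgSheaf

/-- A complex superspace: a topological space with a sheaf of `ℤ/2`-graded complex algebras, in
which every section has a value in `ℂ` at each point. The grading is recorded by its parity
involution `s ↦ (-1)^|s| s`, so that even sections are those fixed by `parity` and odd sections
are those changed in sign. The homomorphism `body` sends a section to the function of its values
(its class modulo nilpotents, for supermanifolds). -/
structure SuperSpace (M : Type u) [TopologicalSpace M] where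
  sheaf : AlgSheaf M
  parity : ∀ U : Opens M, sheaf.sections U →ₐ[ℂ] sheaf.sections U
  parity_parity : ∀ (U : Opens M) (s : sheaf.sections U), parity U (parity U s) = s
  parity_res : ∀ {U V : Opens M} (h : V ≤ U) (s : sheaf.sections U),
    parity V (sheaf.res h s) = sheaf.res h (parity U s)
  body : ∀ U : Opens M, sheaf.sections U →ₐ[ℂ] (U → ℂ)
  body_res : ∀ {U V : Opens M} (h : V ≤ U) (s : sheaf.sections U) (x : V),
    body V (sheaf.res h s) x = body U s ⟨x.1, h x.2⟩

namespace SuperSpace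

variable {M : Type u} [TopologicalSpace M] {N : Type v} [TopologicalSpace N]

/-- The superalgebra of sections over an open set. -/
abbrev sections (A : SuperSpace M) (U : Opens M) : Type u := A.sheaf.sections U

/-- Restriction of sections. -/
abbrev res (A : SuperSpace M) {U V : Opens M} (h : V ≤ U) : A.sections U →ₐ[ℂ] A.sections V :=
  A.sheaf.res h

end SuperSpace

section PartialIso

variable {M : Type u} [TopologicalSpace M] {N : Type v} [TopologicalSpace N]

/-- The open set `e.source ∩ e⁻¹(V)`. -/
def preimOpens (e : OpenPartialHomeomorph M N) (V : Opens N) : Opens M :=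
  ⟨e.source ∩ e ⁻¹' V, e.isOpen_inter_preimage V.isOpen⟩

/-- The open set `e(e.source ∩ W)`, written as a preimage under the inverse. -/
def imageOpens (e : OpenPartialHomeomorph M N) (W : Opens M) : Opens N :=
  ⟨e.target ∩ e.symm ⁻¹' W, e.isOpen_inter_preimage_symm W.isOpen⟩

theorem preimOpens_mono (e : OpenPartialHomeomorph M N) {V V' : Opens N} (h : V' ≤ V) :
    preimOpens e V' ≤ preimOpens e V := fun _ hx => ⟨hx.1, h hx.2⟩

theorem image_subset_target (e : OpenPartialHomeomorph M N) (W : Opens M) :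
    (imageOpens e W : Set N) ⊆ e.target := fun _ hx => hx.1

theorem le_preim_image (e : OpenPartialHomeomorph M N) (W : Opens M)
    (hW : (W : Set M) ⊆ e.source) : W ≤ preimOpens e (imageOpens e W) := fun x hx =>
  ⟨hW hx, e.map_source (hW hx), by
    have h : e.symm (e x) = x := e.left_inv (hW hx)
    simpa [h] using hx⟩

theorem preim_image_le (e : OpenPartialHomeomorph M N) (W : Opens M) :
    preimOpens e (imageOpens e W) ≤ W := fun x hx => by
  have h : e.symm (e x) = x := e.left_inv hx.1
  have h2 : e.symm (e x) ∈ W := hx.2.2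
  rwa [h] at h2

theorem mem_image (e : OpenPartialHomeomorph M N) {W : Opens M} {x : M} (hx : x ∈ W)
    (hs : x ∈ e.source) : e x ∈ imageOpens e W :=
  ⟨e.map_source hs, by
    have h : e.symm (e x) = x := e.left_inv hs
    simpa [h] using hx⟩

/-- An isomorphism of superspaces from the open part `e.source` of `A` to the open part `e.target`
of `B`, over the homeomorphism `e` of the underlying open sets: isomorphisms
`B(V) ≃ A(e⁻¹ V)` of superalgebras for the open sets `V ⊆ e.target`, compatible with restriction
and with the evaluation of sections at points. -/
structure PartialIso (A : SuperSpace M) (B : SuperSpace N) (e : OpenPartialHomeomorph M N) where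
  pull : ∀ V : Opens N, (V : Set N) ⊆ e.target → B.sections V ≃ₐ[ℂ] A.sections (preimOpens e V)
  pull_res : ∀ {V V' : Opens N} (hV : (V : Set N) ⊆ e.target) (hV' : (V' : Set N) ⊆ e.target)
    (h : V' ≤ V) (s : B.sections V),
    pull V' hV' (B.res h s) = A.res (preimOpens_mono e h) (pull V hV s)
  pull_parity : ∀ (V : Opens N) (hV : (V : Set N) ⊆ e.target) (s : B.sections V),
    pull V hV (B.parity V s) = A.parity _ (pull V hV s)
  body_pull : ∀ (V : Opens N) (hV : (V : Set N) ⊆ e.target) (s : B.sections V) (x : preimOpens e V),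
    A.body _ (pull V hV s) x = B.body V s ⟨e x.1, x.2.2⟩

/-- Two superspaces are isomorphic. -/
def SuperSpace.IsIsomorphic (A : SuperSpace M) (B : SuperSpace N) : Prop :=
  ∃ φ : M ≃ₜ N, Nonempty (PartialIso A B φ.toOpenPartialHomeomorph)

end PartialIso

/-! ### Vector fields on superspaces -/

/-- A homogeneous vector field on the open part `U` of a superspace, odd if `odd = true` and even
otherwise: a `ℂ`-linear superderivation of the structure sheaf over `U`, that is, a section over
`U` of the tangent sheaf. -/
structure VectorField {M : Type u} [TopologicalSpace M] (A : SuperSpace M) (U : Opens M)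
    (odd : Bool) where
  op : ∀ V : Opens M, V ≤ U → A.sections V →ₗ[ℂ] A.sections V
  op_res : ∀ {V V' : Opens M} (hV : V ≤ U) (h : V' ≤ V) (s : A.sections V),
    op V' (h.trans hV) (A.res h s) = A.res h (op V hV s)
  op_parity : ∀ (V : Opens M) (hV : V ≤ U) (s : A.sections V),
    A.parity V (op V hV s) = (if odd then (-1 : ℂ) else 1) • op V hV (A.parity V s)
  op_mul : ∀ (V : Opens M) (hV : V ≤ U) (s t : A.sections V),
    op V hV (s * t) = op V hV s * t + (if odd then A.parity V s else s) * op V hV t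

/-- Restriction of vector fields to a smaller open set. -/
def VectorField.restrict {M : Type u} [TopologicalSpace M] {A : SuperSpace M} {U : Opens M}
    {odd : Bool} (Y : VectorField A U odd) {U' : Opens M} (h : U' ≤ U) :
    VectorField A U' odd where
  op V hV := Y.op V (hV.trans h)
  op_res hV h' s := Y.op_res (hV.trans h) h' s
  op_parity V hV s := Y.op_parity V (hV.trans h) s
  op_mul V hV s t := Y.op_mul V (hV.trans h) s t

/-- A superconformal structure: a subsheaf `𝔇` of the tangent sheaf (given by its homogeneous
sections) that is locally spanned by one odd vector field `D` such that `D` and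
`D² = ½[D, D]` form a basis of the tangent sheaf. The latter says that `𝔇` is a locally direct
summand of rank `(0|1)` and that the supercommutator induces an isomorphism of `𝔇 ⊗ 𝔇` with the
quotient of the tangent sheaf by `𝔇`. -/
structure SuperconformalStructure {M : Type u} [TopologicalSpace M] (A : SuperSpace M) where
  carrier : ∀ (U : Opens M) (odd : Bool), Set (VectorField A U odd)
  mem_iff_local : ∀ (U : Opens M) (odd : Bool) (Y : VectorField A U odd),
    Y ∈ carrier U odd ↔ ∀ x ∈ U, ∃ (V : Opens M) (h : V ≤ U), x ∈ V ∧ Y.restrict h ∈ carrier V odd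
  exists_generator : ∀ x : M, ∃ (U : Opens M) (D : VectorField A U true), x ∈ U ∧
    (∀ (V : Opens M) (hV : V ≤ U) (odd : Bool) (Y : VectorField A V odd),
      Y ∈ carrier V odd ↔ ∃ a : A.sections V, ∀ (W : Opens M) (hW : W ≤ V) (s : A.sections W),
        Y.op W hW s = A.res hW a * D.op W (hW.trans hV) s) ∧
    (∀ (V : Opens M) (hV : V ≤ U) (odd : Bool) (Y : VectorField A V odd),
      ∃! ab : A.sections V × A.sections V, ∀ (W : Opens M) (hW : W ≤ V) (s : A.sections W),
        Y.op W hW s =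
          A.res hW ab.1 * D.op W (hW.trans hV) (D.op W (hW.trans hV) s)
            + A.res hW ab.2 * D.op W (hW.trans hV) s)

/-! ### Holomorphic sections of bundles associated with vector bundles -/

section Holomorphic

variable {M : Type u} [TopologicalSpace M] [ChartedSpace ℂ M]

/-- Let `G x` be a family of vector spaces over a Riemann surface, trivialised near `x₀` by linear
maps `τ x : G x → W`. The section `s` of the family over `U` is holomorphic near `x₀ ∈ U` if
all components `ℓ (τ x (s x))`, for linear functionals `ℓ` on `W`, are holomorphic near `x₀`. -/
def IsHolomorphicAt {G : M → Type*} [∀ x, AddCommMonoid (G x)] [∀ x, Module ℂ (G x)]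
    {W : Type*} [AddCommMonoid W] [Module ℂ W] (τ : ∀ x, G x →ₗ[ℂ] W)
    {U : Opens M} (s : ∀ x : U, G x) (x₀ : M) : Prop :=
  open scoped Classical in
  ∀ ℓ : Module.Dual ℂ W, ContMDiffAt 𝓘(ℂ) 𝓘(ℂ) ω
    (fun x : M => if h : x ∈ U then ℓ (τ x (s ⟨x, h⟩)) else 0) x₀

section

variable {G : M → Type*} [∀ x, AddCommMonoid (G x)] [∀ x, Module ℂ (G x)]
  {W : Type*} [AddCommMonoid W] [Module ℂ W] {τ : ∀ x, G x →ₗ[ℂ] W} {U : Opens M}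

theorem IsHolomorphicAt.congr_res {s : ∀ x : U, G x} {V : Opens M} {t : ∀ x : V, G x} {x₀ : M}
    {V' : Opens M} (hU : V' ≤ U) (hV : V' ≤ V) (hx : x₀ ∈ V')
    (hst : ∀ x : V', s ⟨x.1, hU x.2⟩ = t ⟨x.1, hV x.2⟩)
    (hs : IsHolomorphicAt τ s x₀) : IsHolomorphicAt τ t x₀ := by
  intro ℓ
  refine (hs ℓ).congr_of_eventuallyEq ?_
  filter_upwards [V'.isOpen.mem_nhds hx] with x hx'
  have h := hst ⟨x, hx'⟩
  simp only at h
  rw [dif_pos (hV hx'), dif_pos (hU hx'), h]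

theorem IsHolomorphicAt.add {s t : ∀ x : U, G x} {x₀ : M} (hs : IsHolomorphicAt τ s x₀)
    (ht : IsHolomorphicAt τ t x₀) : IsHolomorphicAt τ (s + t) x₀ := by
  intro ℓ
  have h := (hs ℓ).add (ht ℓ)
  refine h.congr_of_eventuallyEq (Filter.Eventually.of_forall fun x => ?_)
  by_cases hx : x ∈ U <;> simp [hx]

theorem IsHolomorphicAt.smul {s : ∀ x : U, G x} {x₀ : M} (c : ℂ)
    (hs : IsHolomorphicAt τ s x₀) : IsHolomorphicAt τ (c • s) x₀ := by
  intro ℓ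
  have h := (contMDiffAt_const (c := c)).mul (hs ℓ)
  refine h.congr_of_eventuallyEq (Filter.Eventually.of_forall fun x => ?_)
  by_cases hx : x ∈ U <;> simp [hx]

theorem IsHolomorphicAt.zero {x₀ : M} : IsHolomorphicAt τ (0 : ∀ x : U, G x) x₀ := by
  intro ℓ
  refine (contMDiffAt_const (c := (0 : ℂ))).congr_of_eventuallyEq
    (Filter.Eventually.of_forall fun x => ?_)
  by_cases hx : x ∈ U <;> simp [hx]

end

end Holomorphic

/-! ### The split model `(C, ⋀ E)` -/

theorem exteriorAlgebra_finite (V : Type*) [AddCommGroup V] [Module ℂ V] [FiniteDimensional ℂ V] :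
    Module.Finite ℂ (ExteriorAlgebra ℂ V) := by
  have key : (⊤ : Submodule ℂ (ExteriorAlgebra ℂ V)) =
      ⨆ n : Fin (Module.finrank ℂ V + 1), ⋀[ℂ]^(n : ℕ) V := by
    refine le_antisymm ?_ le_top
    rw [← ExteriorAlgebra.ιMulti_span, Submodule.span_le]
    rintro _ ⟨⟨n, x⟩, rfl⟩
    by_cases hn : n < Module.finrank ℂ V + 1
    · refine Submodule.mem_iSup_of_mem (⟨n, hn⟩ : Fin _) ?_
      exact ExteriorAlgebra.ιMulti_range ℂ n ⟨x, rfl⟩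
    · have : ¬ LinearIndependent ℂ x := fun h => hn (by
        have := h.fintype_card_le_finrank
        simpa [Nat.lt_succ_iff] using this)
      have h0 : ExteriorAlgebra.ιMulti ℂ n x = 0 := AlternatingMap.map_linearDependent _ x this
      simp only [SetLike.mem_coe]
      rw [h0]
      exact Submodule.zero_mem _
  rw [Module.finite_def, key]
  exact Submodule.fg_iSup _ fun n => (Module.Finite.iff_fg).1 inferInstance

section SplitModel

variable {C : Type u} [TopologicalSpace C] [ChartedSpace ℂ C] (q : ℕ) (E : C → Type u)
  [∀ x, AddCommGroup (E x)] [∀ x, Module ℂ (E x)] [∀ x, TopologicalSpace (E x)]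
  [TopologicalSpace (Bundle.TotalSpace (Fin q → ℂ) E)] [FiberBundle (Fin q → ℂ) E]
  [VectorBundle ℂ (Fin q → ℂ) E]

/-- The fibrewise linear map of the preferred trivialisation of `E` at `x₀`. -/
def triv (x₀ x : C) : E x →ₗ[ℂ] (Fin q → ℂ) :=
  (trivializationAt (Fin q → ℂ) E x₀).linearMapAt ℂ x

/-- The trivialisation of the bundle of exterior algebras induced by one of `E`. -/
def extTriv (x₀ x : C) : ExteriorAlgebra ℂ (E x) →ₗ[ℂ] ExteriorAlgebra ℂ (Fin q → ℂ) :=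
  (ExteriorAlgebra.map (triv q E x₀ x)).toLinearMap

set_option linter.unusedSectionVars false in
theorem extTriv_mul (x₀ x : C) (a b : ExteriorAlgebra ℂ (E x)) :
    extTriv q E x₀ x (a * b) = extTriv q E x₀ x a * extTriv q E x₀ x b :=
  map_mul (ExteriorAlgebra.map (triv q E x₀ x)) a b

theorem isHolomorphicAt_mul {U : Opens C} {s t : ∀ x : U, ExteriorAlgebra ℂ (E x)} {x₀ : C}
    (hs : IsHolomorphicAt (extTriv q E x₀) s x₀) (ht : IsHolomorphicAt (extTriv q E x₀) t x₀) :
    IsHolomorphicAt (extTriv q E x₀) (s * t) x₀ := by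
  classical
  have := exteriorAlgebra_finite (Fin q → ℂ)
  intro ℓ
  let b := Module.finBasis ℂ (ExteriorAlgebra ℂ (Fin q → ℂ))
  have h : ContMDiffAt 𝓘(ℂ) 𝓘(ℂ) ω (fun x : C => ∑ i, ∑ j,
      ((if h : x ∈ U then b.coord i (extTriv q E x₀ x (s ⟨x, h⟩)) else 0) *
      (if h : x ∈ U then b.coord j (extTriv q E x₀ x (t ⟨x, h⟩)) else 0)) * ℓ (b i * b j)) x₀ := by
    refine ContMDiffAt.sum fun i _ => ContMDiffAt.sum fun j _ => ?_
    exact ((hs (b.coord i)).mul (ht (b.coord j))).mul contMDiffAt_const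
  refine h.congr_of_eventuallyEq (Filter.Eventually.of_forall fun x => ?_)
  by_cases hx : x ∈ U
  · simp only [hx, dif_pos, Pi.mul_apply, extTriv_mul]
    conv_lhs => rw [← b.sum_repr (extTriv q E x₀ x (s ⟨x, hx⟩)),
      ← b.sum_repr (extTriv q E x₀ x (t ⟨x, hx⟩))]
    simp only [Finset.sum_mul_sum, map_sum, smul_mul_smul_comm, map_smul, smul_eq_mul,
      Module.Basis.coord_apply]
  · simp [hx]

/-- The algebra of holomorphic sections of `⋀ E` over `U`. -/
def extSections (U : Opens C) : Subalgebra ℂ (∀ x : U, ExteriorAlgebra ℂ (E x)) where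
  carrier := {s | ∀ x₀ : U, IsHolomorphicAt (extTriv q E x₀.1) s x₀.1}
  mul_mem' hs ht x₀ := isHolomorphicAt_mul q E (hs x₀) (ht x₀)
  add_mem' hs ht x₀ := (hs x₀).add (ht x₀)
  algebraMap_mem' r x₀ := by
    classical
    intro ℓ
    refine (contMDiffAt_const (c := ℓ (algebraMap ℂ _ r))).congr_of_eventuallyEq ?_
    filter_upwards [U.isOpen.mem_nhds x₀.2] with x hx
    have hx' : x ∈ U := hx
    simp only [hx', dif_pos, extTriv]
    congr 1
    exact (ExteriorAlgebra.map (triv q E x₀ x)).commutes r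

/-- Restriction of holomorphic sections of `⋀ E`. -/
def extRes {U V : Opens C} (h : V ≤ U) : extSections q E U →ₐ[ℂ] extSections q E V where
  toFun s := ⟨fun x => s.1 ⟨x.1, h x.2⟩, fun x₀ =>
    (s.2 ⟨x₀.1, h x₀.2⟩).congr_res h le_rfl x₀.2 fun _ => rfl⟩
  map_one' := rfl
  map_mul' _ _ := rfl
  map_zero' := rfl
  map_add' _ _ := rfl
  commutes' _ := rfl

/-- The presheaf of holomorphic sections of `⋀ E`. -/
def extPresheaf : TopCat.Presheaf (AlgCat.{u} ℂ) (TopCat.of C) where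
  obj U := AlgCat.of ℂ (extSections q E (unop U))
  map i := AlgCat.ofHom (extRes q E (leOfHom i.unop))
  map_id _ := rfl
  map_comp _ _ := rfl

theorem extPresheaf_isSheaf : (extPresheaf q E).IsSheaf := by
  rw [TopCat.Presheaf.isSheaf_iff_isSheaf_comp (forget (AlgCat.{u} ℂ))]
  apply TopCat.Presheaf.isSheaf_of_isSheafUniqueGluing_types
  intro ι U sf hsf
  have hU : ∀ x : (iSup U : Opens C), ∃ i, x.1 ∈ U i := fun x => Opens.mem_iSup.1 x.2
  choose r hr using hU
  let sf' : ∀ i, extSections q E (U i) := sf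
  have hcomp : ∀ i j (x : C) (hi : x ∈ U i) (hj : x ∈ U j),
      (sf' i).1 ⟨x, hi⟩ = (sf' j).1 ⟨x, hj⟩ := fun i j x hi hj => by
    have h := hsf i j
    have h' : extRes q E (inf_le_left : U i ⊓ U j ≤ U i) (sf' i) =
      extRes q E (inf_le_right : U i ⊓ U j ≤ U j) (sf' j) := h
    exact congrFun (congrArg Subtype.val h') ⟨x, hi, hj⟩
  let g : extSections q E (iSup U) := ⟨fun x => (sf' (r x)).1 ⟨x.1, hr x⟩, fun x₀ => by
    have h := (sf' (r x₀)).2 ⟨x₀.1, hr x₀⟩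
    refine h.congr_res le_rfl (le_iSup U (r x₀)) (hr x₀) fun x => ?_
    exact hcomp _ _ _ _ _⟩
  refine ⟨g, fun i => ?_, fun s hs => ?_⟩
  · refine Subtype.ext (funext fun x => ?_)
    exact hcomp _ _ _ _ _
  · refine Subtype.ext (funext fun x => ?_)
    have h : extRes q E (le_iSup U (r x)) s = sf' (r x) := hs (r x)
    exact congrFun (congrArg Subtype.val h) ⟨x.1, hr x⟩

/-- The parity involution on sections of `⋀ E`. -/
def extParity (U : Opens C) : extSections q E U →ₐ[ℂ] extSections q E U where
  toFun s := ⟨fun x => ExteriorAlgebra.map (-LinearMap.id) (s.1 x), fun x₀ ℓ => by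
    classical
    have h := s.2 x₀ (ℓ ∘ₗ (ExteriorAlgebra.map (-LinearMap.id)).toLinearMap)
    refine h.congr_of_eventuallyEq (Filter.Eventually.of_forall fun x => ?_)
    by_cases hx : x ∈ U
    · simp only [hx, dif_pos, extTriv, LinearMap.comp_apply, AlgHom.toLinearMap_apply]
      congr 1
      rw [← AlgHom.comp_apply, ← AlgHom.comp_apply, ExteriorAlgebra.map_comp_map,
        ExteriorAlgebra.map_comp_map]
      congr 2
      ext v : 1
      simp
    · simp [hx]⟩
  map_one' := Subtype.ext (funext fun _ => map_one _)
  map_mul' _ _ := Subtype.ext (funext fun _ => map_mul _ _ _)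
  map_zero' := Subtype.ext (funext fun _ => map_zero _)
  map_add' _ _ := Subtype.ext (funext fun _ => map_add _ _ _)
  commutes' r := Subtype.ext (funext fun _ => AlgHom.commutes _ r)

/-- The split model `ΠE = (C, ⋀ E)`. -/
def splitModel : SuperSpace C where
  sheaf := ⟨extPresheaf q E, extPresheaf_isSheaf q E⟩
  parity U := extParity q E U
  parity_parity U s := Subtype.ext (funext fun x => by
    change ExteriorAlgebra.map (-LinearMap.id)
      (ExteriorAlgebra.map (-LinearMap.id) (Subtype.val s x)) = Subtype.val s x
    rw [← AlgHom.comp_apply, ExteriorAlgebra.map_comp_map]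
    simp)
  parity_res _ _ := rfl
  body U :=
    { toFun := fun s x => ExteriorAlgebra.algebraMapInv (Subtype.val s x)
      map_one' := funext fun _ => map_one _
      map_mul' := fun _ _ => funext fun _ => map_mul _ _ _
      map_zero' := funext fun _ => map_zero _
      map_add' := fun _ _ => funext fun _ => map_add _ _ _
      commutes' := fun r => funext fun _ => AlgHom.commutes _ r }
  body_res _ _ _ := rfl

variable {q E}

/-- The value in `⋀ E x` of a section of the split model. -/
def extEval {U : Opens C} (s : (splitModel q E).sections U) (x : U) : ExteriorAlgebra ℂ (E x.1) :=
  (show extSections q E U from s).1 x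

end SplitModel

/-- The complex superspace `ℂ^{1|q}`. -/
def superAffine (q : ℕ) : SuperSpace ℂ :=
  splitModel q (Bundle.Trivial ℂ (Fin q → ℂ))

namespace superAffine

variable {q : ℕ}

/-- The value in `⋀ ℂ^q` of a superfunction on an open subset of `ℂ`. -/
def eval {V : Opens ℂ} (s : (superAffine q).sections V) (z : V) :
    ExteriorAlgebra ℂ (Fin q → ℂ) :=
  extEval (E := Bundle.Trivial ℂ (Fin q → ℂ)) s z

theorem extTriv_trivial (z₀ z : ℂ) (a : ExteriorAlgebra ℂ (Fin q → ℂ)) :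
    extTriv q (Bundle.Trivial ℂ (Fin q → ℂ)) z₀ z a = a := by
  have h : triv q (Bundle.Trivial ℂ (Fin q → ℂ)) z₀ z = LinearMap.id := by
    ext v : 1
    simp [triv, Bundle.Trivial.linearMapAt_trivialization]
  simp only [extTriv, h]
  have := ExteriorAlgebra.map_id (R := ℂ) (M := Fin q → ℂ)
  rw [AlgHom.toLinearMap_apply]
  exact (DFunLike.congr_fun this a)

/-- The superfunction with the values `f z`, for a holomorphic `f` with values in `⋀ ℂ^q`. -/
def mk (V : Opens ℂ) (f : ℂ → ExteriorAlgebra ℂ (Fin q → ℂ))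
    (hf : ∀ (ℓ : Module.Dual ℂ (ExteriorAlgebra ℂ (Fin q → ℂ))), ∀ z ∈ V,
      ContMDiffAt 𝓘(ℂ) 𝓘(ℂ) ω (fun z => ℓ (f z)) z) : (superAffine q).sections V :=
  show extSections q (Bundle.Trivial ℂ (Fin q → ℂ)) V from
  ⟨fun z => f z.1, fun z₀ ℓ => by
    classical
    refine (hf ℓ z₀.1 z₀.2).congr_of_eventuallyEq ?_
    filter_upwards [V.isOpen.mem_nhds z₀.2] with z hz
    have hz' : z ∈ V := hz
    simp only [hz', dif_pos]
    exact congrArg ℓ (extTriv_trivial z₀.1 z (f z))⟩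

/-- The even coordinate `z` of `ℂ^{1|q}`. -/
def evenCoord (V : Opens ℂ) : (superAffine q).sections V :=
  mk V (fun z => algebraMap ℂ _ z) fun ℓ z _ => by
    have h : (fun z : ℂ => ℓ (algebraMap ℂ _ z)) = fun z => z * ℓ 1 := by
      funext z
      rw [Algebra.algebraMap_eq_smul_one, map_smul, smul_eq_mul]
    rw [h]
    exact contMDiffAt_id.mul contMDiffAt_const

/-- The odd functions of `ℂ^{1|q}` that are linear in the odd coordinates with constant
coefficients: `v ↦ ∑ a, v a • ε a`, where the `ε a` are the odd coordinates. -/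
def oddLinear (V : Opens ℂ) : (Fin q → ℂ) →ₗ[ℂ] (superAffine q).sections V where
  toFun v := mk V (fun _ => ExteriorAlgebra.ι ℂ v) fun _ _ _ => contMDiffAt_const
  map_add' v w := Subtype.ext (funext fun _ => map_add (ExteriorAlgebra.ι ℂ) v w)
  map_smul' c v := Subtype.ext (funext fun _ => map_smul (ExteriorAlgebra.ι ℂ) c v)

end superAffine

/-! ### Supermanifolds modelled on a pair `(C, E)` -/

section Supermanifold

variable {C : Type u} [TopologicalSpace C] [ChartedSpace ℂ C]

/-- A complex supermanifold of dimension `(1|q)` modelled on `(C, E)`, where `E` is a holomorphic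
vector bundle of rank `q` on the Riemann surface `C`: a superspace on `C` that is locally
isomorphic to the sheaf of sections of `⋀ E`. The linear map `symbol` records how `E` is the
modelling bundle: it induces the identification of `𝒥/𝒥²` with the sheaf of sections of `E`,
`𝒥` being the ideal generated by the odd sections. In a local isomorphism with `⋀ E` it
is the projection to the component of degree one. -/
structure Supermanifold (q : ℕ) (E : C → Type u)
    [∀ x, AddCommGroup (E x)] [∀ x, Module ℂ (E x)] [∀ x, TopologicalSpace (E x)]
    [TopologicalSpace (Bundle.TotalSpace (Fin q → ℂ) E)] [FiberBundle (Fin q → ℂ) E]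
    [VectorBundle ℂ (Fin q → ℂ) E] extends SuperSpace C where
  symbol : ∀ U : Opens C, toSuperSpace.sections U →ₗ[ℂ] (∀ x : U, E x.1)
  symbol_res : ∀ {U V : Opens C} (h : V ≤ U) (s : toSuperSpace.sections U) (x : V),
    symbol V (toSuperSpace.res h s) x = symbol U s ⟨x.1, h x.2⟩
  locally_split : ∀ x : C, ∃ (W : Opens C)
    (Φ : PartialIso toSuperSpace (splitModel q E) (OpenPartialHomeomorph.ofSet W W.isOpen)),
    x ∈ W ∧ ∀ (V : Opens C) (hV : (V : Set C) ⊆ W) (s : (splitModel q E).sections V)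
      (y : preimOpens (OpenPartialHomeomorph.ofSet (W : Set C) W.isOpen) V),
      symbol _ (Φ.pull V hV s) y = ExteriorAlgebra.ιInv (extEval s ⟨y.1, y.2.2⟩)

variable {q : ℕ} {E : C → Type u}
    [∀ x, AddCommGroup (E x)] [∀ x, Module ℂ (E x)] [∀ x, TopologicalSpace (E x)]
    [TopologicalSpace (Bundle.TotalSpace (Fin q → ℂ) E)] [FiberBundle (Fin q → ℂ) E]
    [VectorBundle ℂ (Fin q → ℂ) E]

namespace Supermanifold

/-- A supermanifold is split if it is isomorphic to its split model. -/
def IsSplit (X : Supermanifold q E) : Prop :=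
  X.toSuperSpace.IsIsomorphic (splitModel q E)

/-- A chart of a `(1|q)`-dimensional supermanifold: an isomorphism of an open part of it with an
open part of `ℂ^{1|q}`. -/
structure Chart (X : Supermanifold q E) where
  base : OpenPartialHomeomorph C ℂ
  base_mem : base ∈ IsManifold.maximalAtlas 𝓘(ℂ) ω C
  iso : PartialIso X.toSuperSpace (superAffine q) base

namespace Chart

variable {X : Supermanifold q E}

/-- The domain of a chart. -/
def domain (c : X.Chart) : Opens C := ⟨c.base.source, c.base.open_source⟩

/-- The image of a chart in `ℂ`. -/
def target (c : X.Chart) : Opens ℂ := ⟨c.base.target, c.base.open_target⟩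

/-- Pull-back of superfunctions along the chart. -/
def lift (c : X.Chart) : (superAffine q).sections c.target →ₐ[ℂ] X.sections c.domain :=
  (X.res (fun _ hx => ⟨hx, c.base.map_source hx⟩ : c.domain ≤ preimOpens c.base c.target)).comp
    (c.iso.pull c.target subset_rfl).toAlgHom

/-- The even coordinate of a chart. -/
def even (c : X.Chart) : X.sections c.domain := c.lift (superAffine.evenCoord _)

/-- The odd coordinates of a chart. -/
def odd (c : X.Chart) (a : Fin q) : X.sections c.domain :=
  c.lift (superAffine.oddLinear _ (Pi.single a 1))

/-- The expression of a section of the structure sheaf in the coordinates of a chart. -/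
def express (c : X.Chart) {W : Opens C} (s : X.sections W) :
    (superAffine q).sections (imageOpens c.base W) :=
  (c.iso.pull (imageOpens c.base W) (image_subset_target _ _)).symm
    (X.res (preim_image_le c.base W) s)

/-- The even component of the transition map from `c` to `d`: the even coordinate of `d` in terms
of the coordinates of `c`. -/
def evenTransition (c d : X.Chart) :
    (superAffine q).sections (imageOpens c.base (c.domain ⊓ d.domain)) :=
  c.express (X.res inf_le_right d.even)

/-- The odd components of the transition map from `c` to `d`: the odd coordinates of `d` in terms
of the coordinates of `c`. -/
def oddTransition (c d : X.Chart) (a : Fin q) :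
    (superAffine q).sections (imageOpens c.base (c.domain ⊓ d.domain)) :=
  c.express (X.res inf_le_right (d.odd a))

/-- The local frame of the modelling bundle given by the odd coordinates of the chart, as the map
`v ↦ ∑ a, v a • [θ a]` from `ℂ^q` to the fibre at `x`. -/
def frame (c : X.Chart) (x : c.domain) : (Fin q → ℂ) →ₗ[ℂ] E x.1 :=
  LinearMap.proj x ∘ₗ X.symbol c.domain ∘ₗ c.lift.toLinearMap ∘ₗ superAffine.oddLinear c.target

/-- The tangent vector `∂/∂y` at `x`, for the even coordinate `y` of the chart. -/
def partialDeriv (c : X.Chart) (x : C) : TangentSpace 𝓘(ℂ) x :=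
  (mfderiv 𝓘(ℂ) 𝓘(ℂ) c.base x).inverse (1 : ℂ)

/-- The component `∑ f^{ij} θ_i ∧ θ_j ⊗ ∂/∂y` of the primary obstruction cocycle on the overlap of
the charts `c` (with coordinates `x, θ`) and `d` (with coordinates `y, η`), where
`y = f + ∑ f^{ij} θ_i θ_j + ⋯`. -/
def obstruction (c d : X.Chart) (x : (c.domain ⊓ d.domain : Opens C)) :
    (⋀[ℂ]^2 (E x.1)) ⊗[ℂ] (TangentSpace 𝓘(ℂ) x.1) :=
  exteriorPower.map 2 (c.frame ⟨x.1, x.2.1⟩)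
      (DirectSum.decompose (fun i : ℕ => ⋀[ℂ]^i (Fin q → ℂ))
        (superAffine.eval (c.evenTransition d) ⟨c.base x.1, mem_image c.base x.2 x.2.1⟩) 2)
    ⊗ₜ[ℂ] d.partialDeriv x.1

end Chart

/-- An atlas of a supermanifold. The charts are listed (with repetitions allowed) by the points of
the underlying space, the chart listed at `x` being one around `x`. -/
structure Atlas (X : Supermanifold q E) where
  chart : C → X.Chart
  mem_domain : ∀ x, x ∈ (chart x).domain

end Supermanifold

end Supermanifold

/-! ### Čech cohomology in degree one -/

section Cech

variable {M : Type u} [TopologicalSpace M]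

/-- A presheaf of sections of a family `G` of vector spaces over `M`: for each open set a space of
sections, stable under restriction. -/
structure SectionPresheaf (G : M → Type v) [∀ x, AddCommGroup (G x)] [∀ x, Module ℂ (G x)] where
  sec : ∀ U : Opens M, Submodule ℂ (∀ x : U, G x.1)
  res_mem : ∀ {U V : Opens M} (h : V ≤ U) (s : ∀ x : U, G x.1), s ∈ sec U →
    (fun x : V => s ⟨x.1, h x.2⟩) ∈ sec V

/-- An open covering of `M`, listed by the points of `M` in such a way that each point lies in its
own open set. Such coverings are cofinal among all open coverings. -/
structure Cover (M : Type u) [TopologicalSpace M] where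
  set : M → Opens M
  mem : ∀ x, x ∈ set x

/-- `𝔘 ≤ 𝔙` means that `𝔙` refines `𝔘`. -/
instance : Preorder (Cover M) where
  le 𝔘 𝔙 := ∀ x, 𝔙.set x ≤ 𝔘.set x
  le_refl _ _ := le_rfl
  le_trans _ _ _ h h' x := (h' x).trans (h x)

instance : Nonempty (Cover M) := ⟨⟨fun _ => ⊤, fun _ => trivial⟩⟩

instance : IsDirectedOrder (Cover M) where
  directed 𝔘 𝔙 := ⟨⟨fun x => 𝔘.set x ⊓ 𝔙.set x, fun x => ⟨𝔘.mem x, 𝔙.mem x⟩⟩,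
    fun _ => inf_le_left, fun _ => inf_le_right⟩

variable {G : M → Type v} [∀ x, AddCommGroup (G x)] [∀ x, Module ℂ (G x)]

namespace SectionPresheaf

variable (F : SectionPresheaf G)

/-- The `1`-cocycles of a covering: families of sections `c a b` over the overlaps with
`c a d = c a b + c b d`. -/
def cocycles (𝔘 : Cover M) :
    Submodule ℂ (∀ a b : M, ∀ x : (𝔘.set a ⊓ 𝔘.set b : Opens M), G x.1) where
  carrier := {c | (∀ a b, c a b ∈ F.sec (𝔘.set a ⊓ 𝔘.set b)) ∧
    ∀ (a b d x : M) (ha : x ∈ 𝔘.set a) (hb : x ∈ 𝔘.set b) (hd : x ∈ 𝔘.set d),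
      c a d ⟨x, ha, hd⟩ = c a b ⟨x, ha, hb⟩ + c b d ⟨x, hb, hd⟩}
  add_mem' {c c'} hc hc' := ⟨fun a b => add_mem (hc.1 a b) (hc'.1 a b),
    fun a b d x ha hb hd => by
      simp only [Pi.add_apply, hc.2 a b d x ha hb hd, hc'.2 a b d x ha hb hd]
      abel⟩
  zero_mem' := ⟨fun _ _ => zero_mem _, fun _ _ _ _ _ _ _ => by simp⟩
  smul_mem' r c hc := ⟨fun a b => Submodule.smul_mem _ r (hc.1 a b),
    fun a b d x ha hb hd => by
      simp only [Pi.smul_apply, hc.2 a b d x ha hb hd, smul_add]⟩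

/-- The `1`-coboundaries of a covering, `(δσ) a b = σ b - σ a`. -/
def coboundaries (𝔘 : Cover M) : Submodule ℂ (F.cocycles 𝔘) where
  carrier := {c | ∃ σ : ∀ a : M, ∀ x : 𝔘.set a, G x.1, (∀ a, σ a ∈ F.sec (𝔘.set a)) ∧
    ∀ (a b x : M) (ha : x ∈ 𝔘.set a) (hb : x ∈ 𝔘.set b),
      c.1 a b ⟨x, ha, hb⟩ = σ b ⟨x, hb⟩ - σ a ⟨x, ha⟩}
  add_mem' := by
    rintro c c' ⟨σ, hσ, h⟩ ⟨σ', hσ', h'⟩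
    refine ⟨σ + σ', fun a => add_mem (hσ a) (hσ' a), fun a b x ha hb => ?_⟩
    simp only [Submodule.coe_add, Pi.add_apply, h a b x ha hb, h' a b x ha hb]
    abel
  zero_mem' := ⟨0, fun _ => zero_mem _, fun _ _ _ _ _ => by simp⟩
  smul_mem' := by
    rintro r c ⟨σ, hσ, h⟩
    refine ⟨r • σ, fun a => Submodule.smul_mem _ r (hσ a), fun a b x ha hb => ?_⟩
    simp only [Submodule.coe_smul, Pi.smul_apply, h a b x ha hb, smul_sub]

/-- The first cohomology of a covering. -/
abbrev coverH1 (𝔘 : Cover M) : Type (max u v) := F.cocycles 𝔘 ⧸ F.coboundaries 𝔘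

/-- Restriction of cocycles to a refinement. -/
def refineCocycle {𝔘 𝔙 : Cover M} (h : 𝔘 ≤ 𝔙) : F.cocycles 𝔘 →ₗ[ℂ] F.cocycles 𝔙 where
  toFun c := ⟨fun a b x => c.1 a b ⟨x.1, h a x.2.1, h b x.2.2⟩,
    fun a b => F.res_mem (inf_le_inf (h a) (h b)) _ (c.2.1 a b),
    fun a b d x ha hb hd => c.2.2 a b d x (h a ha) (h b hb) (h d hd)⟩
  map_add' _ _ := rfl
  map_smul' _ _ := rfl

/-- The map of first cohomology groups induced by a refinement. -/
def refine (𝔘 𝔙 : Cover M) (h : 𝔘 ≤ 𝔙) : F.coverH1 𝔘 →ₗ[ℂ] F.coverH1 𝔙 :=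
  Submodule.mapQ _ _ (F.refineCocycle h) (by
    rintro c ⟨σ, hσ, hc⟩
    exact ⟨fun a x => σ a ⟨x.1, h a x.2⟩, fun a => F.res_mem (h a) _ (hσ a),
      fun a b x ha hb => hc a b x (h a ha) (h b hb)⟩)

instance : DirectedSystem F.coverH1 (fun 𝔘 𝔙 h => F.refine 𝔘 𝔙 h) where
  map_self _ c := by
    obtain ⟨c, rfl⟩ := Submodule.Quotient.mk_surjective _ c
    rfl
  map_map _ _ _ _ _ c := by
    obtain ⟨c, rfl⟩ := Submodule.Quotient.mk_surjective _ c
    rfl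

open scoped Classical in
/-- The first cohomology group of `M`: the direct limit of the first cohomology groups of the open
coverings. -/
abbrev H1 : Type (max u v) := Module.DirectLimit F.coverH1 F.refine

open scoped Classical in
/-- The cohomology class of a cocycle. -/
def classOf {𝔘 : Cover M} (c : F.cocycles 𝔘) : F.H1 :=
  Module.DirectLimit.of ℂ (Cover M) F.coverH1 F.refine 𝔘 (Submodule.Quotient.mk c)

end SectionPresheaf

end Cech

/-! ### The primary obstruction class -/

section Obstruction

variable {C : Type u} [TopologicalSpace C] [ChartedSpace ℂ C] [IsManifold 𝓘(ℂ) ω C] (q : ℕ)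
  (E : C → Type u)
  [∀ x, AddCommGroup (E x)] [∀ x, Module ℂ (E x)] [∀ x, TopologicalSpace (E x)]
  [TopologicalSpace (Bundle.TotalSpace (Fin q → ℂ) E)] [FiberBundle (Fin q → ℂ) E]
  [VectorBundle ℂ (Fin q → ℂ) E]

/-- The fibrewise linear map of the preferred trivialisation of the tangent bundle at `x₀`. -/
def tangentTriv (x₀ x : C) : TangentSpace 𝓘(ℂ) x →ₗ[ℂ] ℂ :=
  haveI : IsManifold 𝓘(ℂ) 1 C := IsManifold.of_le (n := ω) le_top
  (trivializationAt ℂ (TangentSpace 𝓘(ℂ) : C → Type) x₀).linearMapAt ℂ x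

/-- The trivialisation of `⋀² E ⊗ TC` induced by those of `E` and `TC`. -/
def obstructionTriv (x₀ x : C) :
    (⋀[ℂ]^2 (E x)) ⊗[ℂ] (TangentSpace 𝓘(ℂ) x) →ₗ[ℂ] (⋀[ℂ]^2 (Fin q → ℂ)) ⊗[ℂ] ℂ :=
  TensorProduct.map (exteriorPower.map 2 (triv q E x₀ x)) (tangentTriv x₀ x)

/-- The sheaf of holomorphic sections of `⋀² E ⊗ TC`. -/
def obstructionSheaf :
    SectionPresheaf (fun x : C => (⋀[ℂ]^2 (E x)) ⊗[ℂ] (TangentSpace 𝓘(ℂ) x)) where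
  sec U :=
    { carrier := {s | ∀ x₀ : U, IsHolomorphicAt
        (G := fun x : C => (⋀[ℂ]^2 (E x)) ⊗[ℂ] (TangentSpace 𝓘(ℂ) x))
        (obstructionTriv q E x₀.1) s x₀.1}
      add_mem' := fun hs ht x₀ => (hs x₀).add (ht x₀)
      zero_mem' := fun _ => IsHolomorphicAt.zero
      smul_mem' := fun r _ hs x₀ => (hs x₀).smul r }
  res_mem h _ hs x₀ := (hs ⟨x₀.1, h x₀.2⟩).congr_res h le_rfl x₀.2 fun _ => rfl

variable {q E}

/-- The covering of `C` by the domains of the charts of an atlas. -/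
def Supermanifold.Atlas.cover {X : Supermanifold q E} (𝔄 : X.Atlas) : Cover C :=
  ⟨fun x => (𝔄.chart x).domain, 𝔄.mem_domain⟩

/-- The class `o` in `H¹(C, ⋀² E ⊗ TC)` is the primary obstruction class of `X`: with respect to
every atlas of `X` it is the class of the cocycle `∑ f^{ij} θ_i ∧ θ_j ⊗ ∂/∂y`. -/
def Supermanifold.IsPrimaryObstructionClass (X : Supermanifold q E)
    (o : (obstructionSheaf q E).H1) : Prop :=
  ∀ 𝔄 : X.Atlas, ∃ c : (obstructionSheaf q E).cocycles 𝔄.cover,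
    (∀ a b x, c.1 a b x = (𝔄.chart a).obstruction (𝔄.chart b) x) ∧
    o = (obstructionSheaf q E).classOf c

end Obstruction

/-! ### Super Riemann surfaces and their odd deformations -/

section Deformation

variable {C : Type u} [TopologicalSpace C] [ChartedSpace ℂ C]

/-- The genus of a compact Riemann surface: the dimension of its space of holomorphic
`1`-forms. -/
def genus (C : Type u) [TopologicalSpace C] [ChartedSpace ℂ C] [IsManifold 𝓘(ℂ) ω C] : ℕ :=
  haveI : IsManifold 𝓘(ℂ) 1 C := IsManifold.of_le (n := ω) le_top
  Module.finrank ℂ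
    (ContMDiffSection 𝓘(ℂ) (ℂ →L[ℂ] ℂ) ω (fun x : C => TangentSpace 𝓘(ℂ) x →L[ℂ] Bundle.Trivial C ℂ x))

/-- A super Riemann surface with reduced space the Riemann surface `C` and modelling bundle `L`: a
`(1|1)`-dimensional supermanifold with a superconformal structure. -/
structure SuperRiemannSurface (L : C → Type u)
    [∀ x, AddCommGroup (L x)] [∀ x, Module ℂ (L x)] [∀ x, TopologicalSpace (L x)]
    [TopologicalSpace (Bundle.TotalSpace (Fin 1 → ℂ) L)] [FiberBundle (Fin 1 → ℂ) L]
    [VectorBundle ℂ (Fin 1 → ℂ) L] extends Supermanifold 1 L where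
  conf : SuperconformalStructure toSuperSpace

section

variable {q : ℕ} [NeZero q] {E : C → Type u}
  [∀ x, AddCommGroup (E x)] [∀ x, Module ℂ (E x)] [∀ x, TopologicalSpace (E x)]
  [TopologicalSpace (Bundle.TotalSpace (Fin q → ℂ) E)] [FiberBundle (Fin q → ℂ) E]
  [VectorBundle ℂ (Fin q → ℂ) E] {X : Supermanifold q E}

/-- Write `x, θ, ξ₁, …` for the coordinates of a chart. The vector field `D` is
`∂/∂θ + θ ∂/∂x`. -/
def Supermanifold.Chart.IsSuperconformalField (c : X.Chart)
    (D : VectorField X.toSuperSpace c.domain true) : Prop :=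
  D.op c.domain le_rfl c.even = c.odd 0 ∧
  D.op c.domain le_rfl (c.odd 0) = 1 ∧
  ∀ a : Fin q, a ≠ 0 → D.op c.domain le_rfl (c.odd a) = 0

end

variable {n : ℕ} {E : C → Type u}
  [∀ x, AddCommGroup (E x)] [∀ x, Module ℂ (E x)] [∀ x, TopologicalSpace (E x)]
  [TopologicalSpace (Bundle.TotalSpace (Fin (n + 1) → ℂ) E)] [FiberBundle (Fin (n + 1) → ℂ) E]
  [VectorBundle ℂ (Fin (n + 1) → ℂ) E]

/-- A superconformal atlas of order `n` on a supermanifold of dimension `(1|n+1)`: an atlas with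
coordinates `x, θ, ξ₁, …, ξₙ` (the odd coordinate of index `0` is `θ`) such that the coordinates
`ξ₁, …, ξₙ` of any two charts agree, and such that the transition maps, viewed as families of maps
of the variables `x, θ` parametrised by `ξ`, are superconformal: they preserve the
distribution spanned by `∂/∂θ + θ ∂/∂x`. -/
structure SuperconformalAtlas (X : Supermanifold (n + 1) E) extends X.Atlas where
  param_eq : ∀ (a b : C) (k : Fin n),
    X.res (inf_le_left : (chart a).domain ⊓ (chart b).domain ≤ _) ((chart a).odd k.succ) =
      X.res inf_le_right ((chart b).odd k.succ)
  field : ∀ a : C, VectorField X.toSuperSpace (chart a).domain true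
  isSuperconformalField : ∀ a, (chart a).IsSuperconformalField (field a)
  superconformal : ∀ a b : C, ∃ u : X.sections ((chart a).domain ⊓ (chart b).domain),
    ∀ (W : Opens C) (h : W ≤ (chart a).domain ⊓ (chart b).domain) (s : X.sections W),
      (field a).op W (h.trans inf_le_left) s =
        X.res h u * (field b).op W (h.trans inf_le_right) s

/-- Setting `ξ = 0`: the homomorphism `⋀[θ, ξ₁, …, ξₙ] → ⋀[θ]` with `θ ↦ θ` and `ξ ↦ 0`. -/
def atZero (n : ℕ) : ExteriorAlgebra ℂ (Fin (n + 1) → ℂ) →ₐ[ℂ] ExteriorAlgebra ℂ (Fin 1 → ℂ) :=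
  ExteriorAlgebra.map (LinearMap.pi fun _ => LinearMap.proj 0)

variable {L : C → Type u}
  [∀ x, AddCommGroup (L x)] [∀ x, Module ℂ (L x)] [∀ x, TopologicalSpace (L x)]
  [TopologicalSpace (Bundle.TotalSpace (Fin 1 → ℂ) L)] [FiberBundle (Fin 1 → ℂ) L]
  [VectorBundle ℂ (Fin 1 → ℂ) L]

/-- `X` is an odd deformation of order `n` of the super Riemann surface `S`: it has a superconformal
atlas of order `n` whose transition maps at `ξ = 0` are the transition maps of an atlas of
`S` by superconformal coordinates on the same covering, that is, coordinates `x, θ` in which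
`∂/∂θ + θ ∂/∂x` belongs to the superconformal structure of `S`. -/
def IsOddDeformation (S : SuperRiemannSurface L) (X : Supermanifold (n + 1) E) : Prop :=
  ∃ (𝔄 : SuperconformalAtlas X) (chartS : C → S.toSupermanifold.Chart)
    (hbase : ∀ a, (chartS a).base = (𝔄.chart a).base),
    (∀ a, ∃ D ∈ S.conf.carrier (chartS a).domain true, (chartS a).IsSuperconformalField D) ∧
    ∀ (a b : C) (x : ((𝔄.chart a).domain ⊓ (𝔄.chart b).domain : Opens C)),
      let z : imageOpens (𝔄.chart a).base ((𝔄.chart a).domain ⊓ (𝔄.chart b).domain) :=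
        ⟨(𝔄.chart a).base x.1, mem_image _ x.2 x.2.1⟩
      let zS : imageOpens (chartS a).base ((chartS a).domain ⊓ (chartS b).domain) :=
        ⟨(chartS a).base x.1, mem_image _ (by
          have h := x.2
          simpa only [Supermanifold.Chart.domain, hbase] using h) (by
          rw [hbase]; exact x.2.1)⟩
      atZero n (superAffine.eval ((𝔄.chart a).evenTransition (𝔄.chart b)) z) =
        superAffine.eval ((chartS a).evenTransition (chartS b)) zS ∧
      atZero n (superAffine.eval ((𝔄.chart a).oddTransition (𝔄.chart b) 0) z) =
        superAffine.eval ((chartS a).oddTransition (chartS b) 0) zS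

end Deformation

end SuperGeom

end

open SuperGeom

noncomputable section

namespace SuperGeom

set_option linter.unusedSimpArgs false
set_option linter.unusedSectionVars false
open TopologicalSpace CategoryTheory Opposite

/-! With three odd variables, parity leaves little room in a transition map: the even coordinate is
a function of `x` plus quadratic terms, and each odd coordinate is linear plus cubic. The quadratic
terms, read in `⋀² E ⊗ TC`, form a cocycle (`obs_add`), and another atlas changes it by a coboundary
(`Atlas.classOf_cocycle`). If the supermanifold is split, charts pulled back from `⋀ E` have no
quadratic terms, so the class is zero (`IsSplit.classOf_cocycle_eq_zero`).

Conversely, if the class is zero, changes of the even coordinates remove the quadratic terms. In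
general the cubic terms of the odd coordinates would be a further obstruction; superconformality
removes it. Write the transition map as y = g + p₁θξ₁ + p₂θξ₂ + rξ₁ξ₂, η = ζθ + ψ₁ξ₁ + ψ₂ξ₂ +
hθξ₁ξ₂, with the ξᵢ fixed. For D = ∂_θ + θ∂_x the condition is Dy = (Dη)η, that is, g' = ζ², pᵢ =
ζψᵢ and r' = 2ζh + ψ₁'ψ₂ − ψ₂'ψ₁ (`coeffs`). As ζ has no zeros, h is determined by the other
coefficients. If the quadratic cocycle is the coboundary of local terms s₁θξ₁ + s₂θξ₂ + tξ₁ξ₂, then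
the new coordinates x − (s₁θξ₁ + s₂θξ₂ + tξ₁ξ₂) and θ + kθξ₁ξ₂ with k = −(t' + s₁s₂' − s₂s₁')/2
remove the quadratic and the cubic terms at once (`cubic_identity`, `isLinearTransition`). An atlas
whose transition maps are linear in the odd coordinates and reduced in the even one identifies the
structure sheaf with the sections of `⋀ E` (`Atlas.isSplit`).

Sections are handled through their values `fn` in a chart, functions from `ℂ` to `Gr`. Two charts
are compared by a first-order Taylor formula (`Chart.taylor`), which is exact because the nilpotent
part of an even coordinate has square zero. -/

/-! ### The exterior algebra on three generators -/

/-- The exterior algebra on three generators. -/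
abbrev Gr : Type := ExteriorAlgebra ℂ (Fin 3 → ℂ)

namespace Gr

/-- The `i`-th generator. -/
def gen (i : Fin 3) : Gr := ExteriorAlgebra.ι ℂ (Pi.single i 1)

theorem gen_mul_self (i : Fin 3) : gen i * gen i = 0 := ExteriorAlgebra.ι_sq_zero _

theorem gen_mul_self_mul (i : Fin 3) (x : Gr) : gen i * (gen i * x) = 0 := by
  rw [← mul_assoc, gen_mul_self, zero_mul]

theorem gen_swap (i j : Fin 3) : gen j * gen i = -(gen i * gen j) :=
  eq_neg_of_add_eq_zero_left (ExteriorAlgebra.ι_add_mul_swap _ _)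

theorem gen_swap_mul (i j : Fin 3) (x : Gr) : gen j * (gen i * x) = -(gen i * (gen j * x)) := by
  rw [← mul_assoc, gen_swap, neg_mul, mul_assoc]

/-- The element with the given coefficients. -/
def mk (c a₀ a₁ a₂ p q r h : ℂ) : Gr :=
  c • 1 + a₀ • gen 0 + a₁ • gen 1 + a₂ • gen 2 + p • (gen 0 * gen 1) + q • (gen 0 * gen 2) +
    r • (gen 1 * gen 2) + h • (gen 0 * (gen 1 * gen 2))

theorem mk_add (c a₀ a₁ a₂ p q r h c' a₀' a₁' a₂' p' q' r' h' : ℂ) :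
    mk c a₀ a₁ a₂ p q r h + mk c' a₀' a₁' a₂' p' q' r' h' =
      mk (c + c') (a₀ + a₀') (a₁ + a₁') (a₂ + a₂') (p + p') (q + q') (r + r') (h + h') := by
  simp only [mk]; module

theorem mk_mul (c a₀ a₁ a₂ p q r h c' a₀' a₁' a₂' p' q' r' h' : ℂ) :
    mk c a₀ a₁ a₂ p q r h * mk c' a₀' a₁' a₂' p' q' r' h' =
      mk (c * c') (c * a₀' + a₀ * c') (c * a₁' + a₁ * c') (c * a₂' + a₂ * c')
        (c * p' + p * c' + a₀ * a₁' - a₁ * a₀') (c * q' + q * c' + a₀ * a₂' - a₂ * a₀')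
        (c * r' + r * c' + a₁ * a₂' - a₂ * a₁')
        (c * h' + h * c' + a₀ * r' - a₁ * q' + a₂ * p' + r * a₀' - q * a₁' + p * a₂') := by
  -- Only the swaps with `i < j` serve as rewriting rules; they sort the generators, so the
  -- rewriting terminates.
  simp only [mk, add_mul, mul_add, smul_mul_smul_comm, mul_one, one_mul, mul_assoc,
    gen_mul_self, gen_mul_self_mul, gen_swap 0 1, gen_swap 0 2, gen_swap 1 2, gen_swap_mul 0 1,
    gen_swap_mul 0 2, gen_swap_mul 1 2, mul_neg, neg_mul, mul_zero, smul_zero, neg_neg, neg_zero,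
    smul_neg]
  module

theorem ι_eq_mk (v : Fin 3 → ℂ) : ExteriorAlgebra.ι ℂ v = mk 0 (v 0) (v 1) (v 2) 0 0 0 0 := by
  have h : v = v 0 • Pi.single 0 1 + v 1 • Pi.single 1 1 + v 2 • Pi.single 2 1 := by
    ext i; fin_cases i <;> simp
  conv_lhs => rw [h]
  simp [mk, gen]

theorem algebraMap_eq_mk (c : ℂ) : algebraMap ℂ Gr c = mk c 0 0 0 0 0 0 0 := by
  simp [mk, Algebra.algebraMap_eq_smul_one]

theorem exists_eq_mk (x : Gr) : ∃ c a₀ a₁ a₂ p q r h, x = mk c a₀ a₁ a₂ p q r h := by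
  induction x using ExteriorAlgebra.induction with
  | algebraMap c => exact ⟨_, _, _, _, _, _, _, _, algebraMap_eq_mk c⟩
  | ι v => exact ⟨_, _, _, _, _, _, _, _, ι_eq_mk v⟩
  | mul x y hx hy =>
    obtain ⟨_, _, _, _, _, _, _, _, rfl⟩ := hx
    obtain ⟨_, _, _, _, _, _, _, _, rfl⟩ := hy
    exact ⟨_, _, _, _, _, _, _, _, mk_mul _ _ _ _ _ _ _ _ _ _ _ _ _ _ _ _⟩
  | add x y hx hy =>
    obtain ⟨_, _, _, _, _, _, _, _, rfl⟩ := hx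
    obtain ⟨_, _, _, _, _, _, _, _, rfl⟩ := hy
    exact ⟨_, _, _, _, _, _, _, _, mk_add _ _ _ _ _ _ _ _ _ _ _ _ _ _ _ _⟩

/-- The coefficient of the product of all generators. -/
def c012 : Gr →ₗ[ℂ] ℂ :=
  ExteriorAlgebra.liftAlternating (R := ℂ) (M := Fin 3 → ℂ) (N := ℂ)
    fun n => if h : n = 3 then h ▸ Matrix.detRowAlternating else 0

/-- The spanning statement `exists_eq_mk` says nothing about independence of the eight monomials.
The determinant, extended by zero to the other degrees, is a functional that detects the top one;
the others reduce to it. -/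
theorem c012_mk (c a₀ a₁ a₂ p q r h : ℂ) : c012 (mk c a₀ a₁ a₂ p q r h) = h := by
  have h0 : c012 1 = 0 := by simp [c012]
  have h1 : ∀ v, c012 (ExteriorAlgebra.ι ℂ v) = 0 := fun v => by simp [c012]
  have h2 : ∀ v w, c012 (ExteriorAlgebra.ι ℂ v * ExteriorAlgebra.ι ℂ w) = 0 := fun v w => by
    have := ExteriorAlgebra.liftAlternating_apply_ιMulti (R := ℂ) (M := Fin 3 → ℂ) (N := ℂ)
      (fun n => if h : n = 3 then h ▸ Matrix.detRowAlternating else 0) ![v, w]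
    simpa [Matrix.vecTail, c012] using this
  have h3 : ∀ u v w, c012 (ExteriorAlgebra.ι ℂ u * (ExteriorAlgebra.ι ℂ v *
      ExteriorAlgebra.ι ℂ w)) = Matrix.detRowAlternating ![u, v, w] := fun u v w => by
    have := ExteriorAlgebra.liftAlternating_apply_ιMulti (R := ℂ) (M := Fin 3 → ℂ) (N := ℂ)
      (fun n => if h : n = 3 then h ▸ Matrix.detRowAlternating else 0) ![u, v, w]
    simpa [Matrix.vecTail, c012, Function.comp_def] using this
  simp only [mk, gen, map_add, map_smul, h0, h1, h2, h3]
  have hd : (Matrix.detRowAlternating : (Fin 3 → ℂ) [⋀^Fin 3]→ₗ[ℂ] ℂ)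
      ![Pi.single 0 1, Pi.single 1 1, Pi.single 2 1] = 1 :=
    (Matrix.det_fin_three (Matrix.of ![Pi.single 0 1, Pi.single 1 1, Pi.single 2 1])).trans
      (by simp)
  rw [hd]
  simp

/-- The coefficient of `1`. -/
def cC : Gr →ₗ[ℂ] ℂ := c012 ∘ₗ LinearMap.mulRight ℂ (mk 0 0 0 0 0 0 0 1)
/-- The coefficient of `gen 0`. -/
def c0 : Gr →ₗ[ℂ] ℂ := c012 ∘ₗ LinearMap.mulRight ℂ (mk 0 0 0 0 0 0 1 0)
/-- The coefficient of `gen 1`. -/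
def c1 : Gr →ₗ[ℂ] ℂ := c012 ∘ₗ LinearMap.mulRight ℂ (mk 0 0 0 0 0 (-1) 0 0)
/-- The coefficient of `gen 2`. -/
def c2 : Gr →ₗ[ℂ] ℂ := c012 ∘ₗ LinearMap.mulRight ℂ (mk 0 0 0 0 1 0 0 0)
/-- The coefficient of `gen 0 * gen 1`. -/
def c01 : Gr →ₗ[ℂ] ℂ := c012 ∘ₗ LinearMap.mulRight ℂ (mk 0 0 0 1 0 0 0 0)
/-- The coefficient of `gen 0 * gen 2`. -/
def c02 : Gr →ₗ[ℂ] ℂ := c012 ∘ₗ LinearMap.mulRight ℂ (mk 0 0 (-1) 0 0 0 0 0)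
/-- The coefficient of `gen 1 * gen 2`. -/
def c12 : Gr →ₗ[ℂ] ℂ := c012 ∘ₗ LinearMap.mulRight ℂ (mk 0 1 0 0 0 0 0 0)

section

variable (c a₀ a₁ a₂ p q r h : ℂ)

/-- Multiplication by the complementary monomial moves a coefficient to the top degree. The signs in
`c1` and `c02` undo the transposition needed to sort that product. -/
theorem cC_mk : cC (mk c a₀ a₁ a₂ p q r h) = c := by simp [cC, mk_mul, c012_mk]
theorem c0_mk : c0 (mk c a₀ a₁ a₂ p q r h) = a₀ := by simp [c0, mk_mul, c012_mk]
theorem c1_mk : c1 (mk c a₀ a₁ a₂ p q r h) = a₁ := by simp [c1, mk_mul, c012_mk]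
theorem c2_mk : c2 (mk c a₀ a₁ a₂ p q r h) = a₂ := by simp [c2, mk_mul, c012_mk]
theorem c01_mk : c01 (mk c a₀ a₁ a₂ p q r h) = p := by simp [c01, mk_mul, c012_mk]
theorem c02_mk : c02 (mk c a₀ a₁ a₂ p q r h) = q := by simp [c02, mk_mul, c012_mk]
theorem c12_mk : c12 (mk c a₀ a₁ a₂ p q r h) = r := by simp [c12, mk_mul, c012_mk]

end

theorem eq_mk (x : Gr) : x = mk (cC x) (c0 x) (c1 x) (c2 x) (c01 x) (c02 x) (c12 x) (c012 x) := by
  obtain ⟨_, _, _, _, _, _, _, _, rfl⟩ := exists_eq_mk x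
  simp only [cC_mk, c0_mk, c1_mk, c2_mk, c01_mk, c02_mk, c12_mk, c012_mk]

theorem ext {x y : Gr} (hC : cC x = cC y) (h0 : c0 x = c0 y) (h1 : c1 x = c1 y) (h2 : c2 x = c2 y)
    (h01 : c01 x = c01 y) (h02 : c02 x = c02 y) (h12 : c12 x = c12 y) (h012 : c012 x = c012 y) :
    x = y := by
  rw [eq_mk x, eq_mk y, hC, h0, h1, h2, h01, h02, h12, h012]

section

variable (x y : Gr)

theorem mul_eq_mk : x * y =
      mk (cC x * cC y) (cC x * c0 y + c0 x * cC y) (cC x * c1 y + c1 x * cC y)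
        (cC x * c2 y + c2 x * cC y)
        (cC x * c01 y + c01 x * cC y + c0 x * c1 y - c1 x * c0 y)
        (cC x * c02 y + c02 x * cC y + c0 x * c2 y - c2 x * c0 y)
        (cC x * c12 y + c12 x * cC y + c1 x * c2 y - c2 x * c1 y)
        (cC x * c012 y + c012 x * cC y + c0 x * c12 y - c1 x * c02 y + c2 x * c01 y
          + c12 x * c0 y - c02 x * c1 y + c01 x * c2 y) := by
  conv_lhs => rw [eq_mk x, eq_mk y, mk_mul]

theorem cC_mul : cC (x * y) = cC x * cC y := by rw [mul_eq_mk, cC_mk]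
theorem c0_mul : c0 (x * y) = cC x * c0 y + c0 x * cC y := by rw [mul_eq_mk, c0_mk]
theorem c1_mul : c1 (x * y) = cC x * c1 y + c1 x * cC y := by rw [mul_eq_mk, c1_mk]
theorem c2_mul : c2 (x * y) = cC x * c2 y + c2 x * cC y := by rw [mul_eq_mk, c2_mk]
theorem c01_mul : c01 (x * y) = cC x * c01 y + c01 x * cC y + c0 x * c1 y - c1 x * c0 y := by
  rw [mul_eq_mk, c01_mk]
theorem c02_mul : c02 (x * y) = cC x * c02 y + c02 x * cC y + c0 x * c2 y - c2 x * c0 y := by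
  rw [mul_eq_mk, c02_mk]
theorem c12_mul : c12 (x * y) = cC x * c12 y + c12 x * cC y + c1 x * c2 y - c2 x * c1 y := by
  rw [mul_eq_mk, c12_mk]
theorem c012_mul : c012 (x * y) = cC x * c012 y + c012 x * cC y + c0 x * c12 y - c1 x * c02 y +
    c2 x * c01 y + c12 x * c0 y - c02 x * c1 y + c01 x * c2 y := by
  rw [mul_eq_mk, c012_mk]

end

theorem cC_eq (x : Gr) : cC x = ExteriorAlgebra.algebraMapInv x := by
  conv_rhs => rw [eq_mk x]
  have h : ∀ i, ExteriorAlgebra.algebraMapInv (gen i) = 0 := fun i => by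
    simp [ExteriorAlgebra.algebraMapInv, gen]
  simp [mk, h]

/-- `ιInv` is the second component of an algebra homomorphism to a trivial square-zero extension
whose first component is the augmentation, hence a derivation along the augmentation. -/
theorem _root_.ExteriorAlgebra.ιInv_mul {M : Type*} [AddCommGroup M] [Module ℂ M]
    (x y : ExteriorAlgebra ℂ M) : ExteriorAlgebra.ιInv (x * y) =
      ExteriorAlgebra.algebraMapInv x • ExteriorAlgebra.ιInv y +
        ExteriorAlgebra.algebraMapInv y • ExteriorAlgebra.ιInv x := by
  -- The square-zero extension needs a right action as well; the left action is reused.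
  let _ : Module ℂᵐᵒᵖ M := Module.compHom _ ((RingHom.id ℂ).fromOpposite mul_comm)
  have : IsCentralScalar ℂ M := ⟨fun _ _ => rfl⟩
  have key : ∀ x : ExteriorAlgebra ℂ M, (ExteriorAlgebra.toTrivSqZeroExt x).fst =
      ExteriorAlgebra.algebraMapInv x := fun x => by
    have : (TrivSqZeroExt.fstHom ℂ ℂ M).comp ExteriorAlgebra.toTrivSqZeroExt =
        ExteriorAlgebra.algebraMapInv := by
      ext v
      simp [ExteriorAlgebra.algebraMapInv]
    exact DFunLike.congr_fun this x
  have h : ∀ x : ExteriorAlgebra ℂ M,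
    ExteriorAlgebra.ιInv x = (ExteriorAlgebra.toTrivSqZeroExt x).snd := fun x => rfl
  rw [h, h, h, map_mul, TrivSqZeroExt.snd_mul, key, key, op_smul_eq_smul]

theorem ιInv_mul (x y : Gr) : ExteriorAlgebra.ιInv (x * y) =
    cC x • ExteriorAlgebra.ιInv y + cC y • ExteriorAlgebra.ιInv x := by
  rw [ExteriorAlgebra.ιInv_mul, cC_eq, cC_eq]

theorem ιInv_eq (x : Gr) : ExteriorAlgebra.ιInv x = ![c0 x, c1 x, c2 x] := by
  conv_lhs => rw [eq_mk x]
  have h1 : ExteriorAlgebra.ιInv (1 : Gr) = 0 := by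
    have := ιInv_mul 1 1
    have hc : cC 1 = 1 := by rw [cC_eq, map_one]
    simpa [hc] using this
  have hg : ∀ i, cC (gen i) = 0 := fun i => by
    rw [cC_eq]; simp [ExteriorAlgebra.algebraMapInv, gen]
  have h2 : ∀ i, ExteriorAlgebra.ιInv (gen i) = (Pi.single i 1 : Fin 3 → ℂ) := fun i =>
    ExteriorAlgebra.ι_leftInverse _
  simp only [mk, map_add, map_smul, h1, h2, ιInv_mul, hg, cC_mul]
  ext i
  fin_cases i <;> simp

section

variable (v : Fin 3 → ℂ)

theorem c0_ι : c0 (ExteriorAlgebra.ι ℂ v) = v 0 := by rw [ι_eq_mk, c0_mk]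
theorem c012_ι : c012 (ExteriorAlgebra.ι ℂ v) = 0 := by rw [ι_eq_mk, c012_mk]

variable (c : ℂ)

theorem cC_algebraMap : cC (algebraMap ℂ Gr c) = c := by rw [algebraMap_eq_mk, cC_mk]
theorem c0_algebraMap : c0 (algebraMap ℂ Gr c) = 0 := by rw [algebraMap_eq_mk, c0_mk]
theorem c01_algebraMap : c01 (algebraMap ℂ Gr c) = 0 := by rw [algebraMap_eq_mk, c01_mk]
theorem c02_algebraMap : c02 (algebraMap ℂ Gr c) = 0 := by rw [algebraMap_eq_mk, c02_mk]
theorem c12_algebraMap : c12 (algebraMap ℂ Gr c) = 0 := by rw [algebraMap_eq_mk, c12_mk]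

end

/-- The parity involution. -/
abbrev par : Gr →ₐ[ℂ] Gr := ExteriorAlgebra.map (-LinearMap.id)

theorem par_mk (c a₀ a₁ a₂ p q r h : ℂ) :
    par (mk c a₀ a₁ a₂ p q r h) = mk c (-a₀) (-a₁) (-a₂) p q r (-h) := by
  have hg : ∀ i, par (gen i) = -gen i := fun i => by simp [par, gen, map_neg]
  simp only [mk, map_add, map_smul, map_mul, hg, map_one, mul_neg, neg_mul, neg_neg]
  module

/-- `par` changes the sign of degrees one and three only. Together with `odd_iff` this bounds the
shape of transition maps: constant and quadratic terms for even coordinates, linear and cubic terms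
for odd ones. -/
theorem even_iff (x : Gr) : par x = x ↔ c0 x = 0 ∧ c1 x = 0 ∧ c2 x = 0 ∧ c012 x = 0 := by
  obtain ⟨c, a₀, a₁, a₂, p, q, r, h, rfl⟩ := exists_eq_mk x
  rw [par_mk]
  simp only [c0_mk, c1_mk, c2_mk, c012_mk]
  constructor
  · intro hx
    exact ⟨self_eq_neg.1 (by simpa only [c0_mk] using (congrArg c0 hx).symm),
      self_eq_neg.1 (by simpa only [c1_mk] using (congrArg c1 hx).symm),
      self_eq_neg.1 (by simpa only [c2_mk] using (congrArg c2 hx).symm),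
      self_eq_neg.1 (by simpa only [c012_mk] using (congrArg c012 hx).symm)⟩
  · rintro ⟨rfl, rfl, rfl, rfl⟩
    simp

theorem odd_iff (x : Gr) : par x = -x ↔ cC x = 0 ∧ c01 x = 0 ∧ c02 x = 0 ∧ c12 x = 0 := by
  obtain ⟨c, a₀, a₁, a₂, p, q, r, h, rfl⟩ := exists_eq_mk x
  rw [par_mk]
  simp only [cC_mk, c01_mk, c02_mk, c12_mk]
  constructor
  · intro hx
    exact ⟨self_eq_neg.1 (by simpa only [cC_mk, map_neg] using congrArg cC hx),
      self_eq_neg.1 (by simpa only [c01_mk, map_neg] using congrArg c01 hx),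
      self_eq_neg.1 (by simpa only [c02_mk, map_neg] using congrArg c02 hx),
      self_eq_neg.1 (by simpa only [c12_mk, map_neg] using congrArg c12 hx)⟩
  · rintro ⟨rfl, rfl, rfl, rfl⟩
    simp only [mk]
    module

/-- Connects the graded component in the definition of the obstruction with the explicit
coefficients. -/
theorem coe_decompose_two (x : Gr) :
    ((DirectSum.decompose (fun i : ℕ => ⋀[ℂ]^i (Fin 3 → ℂ)) x 2 : ⋀[ℂ]^2 (Fin 3 → ℂ)) : Gr) =
      mk 0 0 0 0 (c01 x) (c02 x) (c12 x) 0 := by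
  obtain ⟨c, a₀, a₁, a₂, p, q, r, h, rfl⟩ := exists_eq_mk x
  simp only [c01_mk, c02_mk, c12_mk]
  have hg : ∀ i, gen i ∈ ⋀[ℂ]^1 (Fin 3 → ℂ) := fun i => by
    simpa only [pow_one, gen] using LinearMap.mem_range_self (ExteriorAlgebra.ι ℂ) (Pi.single i 1 : Fin 3 → ℂ)
  have hgg : ∀ i j, gen i * gen j ∈ ⋀[ℂ]^2 (Fin 3 → ℂ) := fun i j =>
    SetLike.mul_mem_graded (A := fun i : ℕ => ⋀[ℂ]^i (Fin 3 → ℂ)) (hg i) (hg j)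
  have hggg : gen 0 * (gen 1 * gen 2) ∈ ⋀[ℂ]^3 (Fin 3 → ℂ) :=
    SetLike.mul_mem_graded (A := fun i : ℕ => ⋀[ℂ]^i (Fin 3 → ℂ)) (hg 0) (hgg 1 2)
  have h0 : (1 : Gr) ∈ ⋀[ℂ]^0 (Fin 3 → ℂ) :=
    SetLike.one_mem_graded (fun i : ℕ => ⋀[ℂ]^i (Fin 3 → ℂ))
  have hne : ∀ (n : ℕ) (y : Gr), y ∈ ⋀[ℂ]^n (Fin 3 → ℂ) → n ≠ 2 → ∀ k : ℂ,
      ((DirectSum.decompose (fun i : ℕ => ⋀[ℂ]^i (Fin 3 → ℂ)) (k • y) 2 :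
        ⋀[ℂ]^2 (Fin 3 → ℂ)) : Gr) = 0 := fun n y hy hn k =>
    DirectSum.decompose_of_mem_ne _ (Submodule.smul_mem _ k hy) hn
  have heq : ∀ (y : Gr), y ∈ ⋀[ℂ]^2 (Fin 3 → ℂ) → ∀ k : ℂ,
      ((DirectSum.decompose (fun i : ℕ => ⋀[ℂ]^i (Fin 3 → ℂ)) (k • y) 2 :
        ⋀[ℂ]^2 (Fin 3 → ℂ)) : Gr) = k • y := fun y hy k =>
    DirectSum.decompose_of_mem_same _ (Submodule.smul_mem _ k hy)
  simp only [mk, DirectSum.decompose_add, DirectSum.add_apply, Submodule.coe_add,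
    hne 0 1 h0 (by norm_num), hne 1 _ (hg _) (by norm_num), hne 3 _ hggg (by norm_num),
    heq _ (hgg _ _)]
  module

/-- The part of degree two. -/
def deg2 (x : Gr) : Gr := mk 0 0 0 0 (c01 x) (c02 x) (c12 x) 0

/-- In degree `n` the induced map acts by the `n × n` minors of `g`. The columns are separate
variables so that a caller may insert them in explicit form. -/
theorem map_mk (g : (Fin 3 → ℂ) →ₗ[ℂ] (Fin 3 → ℂ)) (c a₀ a₁ a₂ p q r h : ℂ) (v₀ v₁ v₂ : Fin 3 → ℂ)
    (h₀ : g (Pi.single 0 1) = v₀) (h₁ : g (Pi.single 1 1) = v₁) (h₂ : g (Pi.single 2 1) = v₂) :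
    ExteriorAlgebra.map g (mk c a₀ a₁ a₂ p q r h) =
      mk c (a₀ * v₀ 0 + a₁ * v₁ 0 + a₂ * v₂ 0) (a₀ * v₀ 1 + a₁ * v₁ 1 + a₂ * v₂ 1)
        (a₀ * v₀ 2 + a₁ * v₁ 2 + a₂ * v₂ 2)
        (p * (v₀ 0 * v₁ 1 - v₀ 1 * v₁ 0) + q * (v₀ 0 * v₂ 1 - v₀ 1 * v₂ 0)
          + r * (v₁ 0 * v₂ 1 - v₁ 1 * v₂ 0))
        (p * (v₀ 0 * v₁ 2 - v₀ 2 * v₁ 0) + q * (v₀ 0 * v₂ 2 - v₀ 2 * v₂ 0)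
          + r * (v₁ 0 * v₂ 2 - v₁ 2 * v₂ 0))
        (p * (v₀ 1 * v₁ 2 - v₀ 2 * v₁ 1) + q * (v₀ 1 * v₂ 2 - v₀ 2 * v₂ 1)
          + r * (v₁ 1 * v₂ 2 - v₁ 2 * v₂ 1))
        (h * (v₀ 0 * (v₁ 1 * v₂ 2 - v₁ 2 * v₂ 1) - v₀ 1 * (v₁ 0 * v₂ 2 - v₁ 2 * v₂ 0)
          + v₀ 2 * (v₁ 0 * v₂ 1 - v₁ 1 * v₂ 0))) := by
  subst h₀ h₁ h₂
  have hg : ∀ i, ExteriorAlgebra.map g (gen i) = ExteriorAlgebra.ι ℂ (g (Pi.single i 1)) :=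
    fun i => ExteriorAlgebra.map_apply_ι _ _
  have e : ExteriorAlgebra.map g (mk c a₀ a₁ a₂ p q r h) = c • 1 +
    a₀ • ExteriorAlgebra.ι ℂ (g (Pi.single 0 1)) + a₁ • ExteriorAlgebra.ι ℂ (g (Pi.single 1 1)) +
    a₂ • ExteriorAlgebra.ι ℂ (g (Pi.single 2 1)) +
    p • (ExteriorAlgebra.ι ℂ (g (Pi.single 0 1)) * ExteriorAlgebra.ι ℂ (g (Pi.single 1 1))) +
    q • (ExteriorAlgebra.ι ℂ (g (Pi.single 0 1)) * ExteriorAlgebra.ι ℂ (g (Pi.single 2 1))) +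
    r • (ExteriorAlgebra.ι ℂ (g (Pi.single 1 1)) * ExteriorAlgebra.ι ℂ (g (Pi.single 2 1))) +
    h • (ExteriorAlgebra.ι ℂ (g (Pi.single 0 1)) * (ExteriorAlgebra.ι ℂ (g (Pi.single 1 1)) *
      ExteriorAlgebra.ι ℂ (g (Pi.single 2 1)))) := by
    simp only [mk, map_add, map_smul, map_mul, map_one, hg]
  rw [e]
  have h1 : (1 : Gr) = mk 1 0 0 0 0 0 0 0 := by simp [mk]
  simp only [ι_eq_mk, mk_mul, h1]
  simp only [mk]
  module

/-- An odd substitution agrees with its linear part up to the cubic terms it adds. -/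
theorem hom_eq_map_add (σ : Gr →ₐ[ℂ] Gr) (hσ : ∀ v, par (σ (ExteriorAlgebra.ι ℂ v)) =
    -σ (ExteriorAlgebra.ι ℂ v)) (x : Gr) :
    σ x = ExteriorAlgebra.map (ExteriorAlgebra.ιInv ∘ₗ σ.toLinearMap ∘ₗ ExteriorAlgebra.ι ℂ) x +
      c012 (σ (ExteriorAlgebra.ι ℂ (ExteriorAlgebra.ιInv x))) • mk 0 0 0 0 0 0 0 1 := by
  have hι : ∀ v, σ (ExteriorAlgebra.ι ℂ v) = ExteriorAlgebra.ι ℂ (ExteriorAlgebra.ιInv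
      (σ (ExteriorAlgebra.ι ℂ v))) + c012 (σ (ExteriorAlgebra.ι ℂ v)) • mk 0 0 0 0 0 0 0 1 := by
    intro v
    obtain ⟨h1, h2, h3, h4⟩ := (odd_iff _).1 (hσ v)
    rw [ιInv_eq, ι_eq_mk ![_, _, _]]
    refine ext ?_ ?_ ?_ ?_ ?_ ?_ ?_ ?_ <;>
      simp only [map_add, map_smul, cC_mk, c0_mk, c1_mk, c2_mk, c01_mk, c02_mk, c12_mk, c012_mk,
        h1, h2, h3, h4] <;> simp
  set g : (Fin 3 → ℂ) →ₗ[ℂ] (Fin 3 → ℂ) :=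
    ExteriorAlgebra.ιInv ∘ₗ σ.toLinearMap ∘ₗ ExteriorAlgebra.ι ℂ with hg
  have hgv : ∀ v, ExteriorAlgebra.ιInv (σ (ExteriorAlgebra.ι ℂ v)) = g v := fun v => rfl
  have hgen : ∀ i, σ (gen i) = mk 0 (g (Pi.single i 1) 0) (g (Pi.single i 1) 1)
      (g (Pi.single i 1) 2) 0 0 0 (c012 (σ (gen i))) := by
    intro i
    rw [gen, hι, hgv, ι_eq_mk]
    refine ext ?_ ?_ ?_ ?_ ?_ ?_ ?_ ?_ <;>
      simp only [map_add, map_smul, cC_mk, c0_mk, c1_mk, c2_mk, c01_mk, c02_mk, c12_mk, c012_mk]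
        <;> simp
  have hlin : c012 (σ (ExteriorAlgebra.ι ℂ (ExteriorAlgebra.ιInv x))) =
      c0 x * c012 (σ (gen 0)) + c1 x * c012 (σ (gen 1)) + c2 x * c012 (σ (gen 2)) := by
    rw [ιInv_eq, ι_eq_mk]
    simp [mk]
  rw [hlin]
  obtain ⟨c, a₀, a₁, a₂, p, q, r, h, rfl⟩ := exists_eq_mk x
  rw [map_mk g _ _ _ _ _ _ _ _ _ _ _ rfl rfl rfl]
  simp only [c0_mk, c1_mk, c2_mk]
  have e : σ (mk c a₀ a₁ a₂ p q r h) = c • mk 1 0 0 0 0 0 0 0 + a₀ • σ (gen 0) + a₁ • σ (gen 1) +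
      a₂ • σ (gen 2) + p • (σ (gen 0) * σ (gen 1)) + q • (σ (gen 0) * σ (gen 2)) +
      r • (σ (gen 1) * σ (gen 2)) + h • (σ (gen 0) * (σ (gen 1) * σ (gen 2))) := by
    conv_lhs => simp only [mk, map_add, map_smul, map_mul, map_one]
    simp [mk]
  -- Each generator goes to a linear plus a cubic term. In a product of images every term that
  -- involves a cubic part has degree at least four and vanishes, so the cubic parts count only in
  -- degree one.
  rw [e, hgen 0, hgen 1, hgen 2]
  simp only [mk_mul, c012_mk]
  simp only [mk]
  module

end Gr

/-! ### Holomorphic functions with values in vector spaces without topology -/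

section HolAt

variable {M : Type*} [TopologicalSpace M] [ChartedSpace ℂ M]
  {N : Type*} [TopologicalSpace N] [ChartedSpace ℂ N]
  {W : Type*} [AddCommGroup W] [Module ℂ W] {W' : Type*} [AddCommGroup W'] [Module ℂ W']
  {W'' : Type*} [AddCommGroup W''] [Module ℂ W'']

/-- All components of `f` are holomorphic at `x`. -/
def HolAt (f : M → W) (x : M) : Prop :=
  ∀ ℓ : Module.Dual ℂ W, ContMDiffAt 𝓘(ℂ) 𝓘(ℂ) ω (fun y => ℓ (f y)) x

theorem holAt_iff {f : M → ℂ} {x : M} : HolAt f x ↔ ContMDiffAt 𝓘(ℂ) 𝓘(ℂ) ω f x := by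
  refine ⟨fun h => h LinearMap.id, fun h ℓ => ?_⟩
  have : (fun y => ℓ (f y)) = fun y => f y * ℓ 1 := by
    funext y
    conv_lhs => rw [← mul_one (f y), ← smul_eq_mul, map_smul, smul_eq_mul]
  rw [this]
  exact h.mul contMDiffAt_const

theorem holAt_iff_analyticAt {f : ℂ → ℂ} {z : ℂ} : HolAt f z ↔ AnalyticAt ℂ f z := by
  rw [holAt_iff, contMDiffAt_iff_contDiffAt, ← contDiffWithinAt_univ,
    contDiffWithinAt_omega_iff_analyticWithinAt, analyticWithinAt_univ]

namespace HolAt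

variable {f g : M → W} {x : M}

theorem congr (hf : HolAt f x) (h : g =ᶠ[nhds x] f) : HolAt g x := fun ℓ =>
  (hf ℓ).congr_of_eventuallyEq (h.fun_comp ℓ)

theorem const (w : W) : HolAt (fun _ : M => w) x := fun _ => contMDiffAt_const

theorem map (hf : HolAt f x) (L : W →ₗ[ℂ] W') : HolAt (fun y => L (f y)) x := fun ℓ =>
  hf (ℓ ∘ₗ L)

theorem add (hf : HolAt f x) (hg : HolAt g x) : HolAt (fun y => f y + g y) x := fun ℓ =>
  ((hf ℓ).add (hg ℓ)).congr_of_eventuallyEq (.of_forall fun y => map_add ℓ (f y) (g y))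

theorem neg (hf : HolAt f x) : HolAt (fun y => -f y) x := fun ℓ =>
  (hf ℓ).neg.congr_of_eventuallyEq (.of_forall fun y => map_neg ℓ (f y))

theorem sub (hf : HolAt f x) (hg : HolAt g x) : HolAt (fun y => f y - g y) x := fun ℓ =>
  ((hf ℓ).sub (hg ℓ)).congr_of_eventuallyEq (.of_forall fun y => map_sub ℓ (f y) (g y))

theorem smul {k : M → ℂ} (hk : HolAt k x) (hf : HolAt f x) : HolAt (fun y => k y • f y) x :=
  fun ℓ => ((holAt_iff.1 hk).mul (hf ℓ)).congr_of_eventuallyEq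
    (.of_forall fun y => map_smul ℓ (k y) (f y))

theorem sum {ι : Type*} {s : Finset ι} {f : ι → M → W} (hf : ∀ i ∈ s, HolAt (f i) x) :
    HolAt (fun y => ∑ i ∈ s, f i y) x := fun ℓ => by
  simpa using ContMDiffAt.sum fun i hi => hf i hi ℓ

/-- Expanding the first argument in a basis leaves products of a scalar function with a linear image
of `g`; this is why only `W` has to be finite-dimensional. -/
theorem bilin [FiniteDimensional ℂ W] {g : M → W'} (B : W →ₗ[ℂ] W' →ₗ[ℂ] W'') (hf : HolAt f x)
    (hg : HolAt g x) : HolAt (fun y => B (f y) (g y)) x := by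
  let b := Module.finBasis ℂ W
  have h : HolAt (fun y => ∑ i, b.coord i (f y) • B (b i) (g y)) x :=
    HolAt.sum fun i _ => (holAt_iff.2 (hf _)).smul (hg.map _)
  refine h.congr (Filter.Eventually.of_forall fun y => ?_)
  change B (f y) (g y) = _
  conv_lhs => rw [← b.sum_repr (f y)]
  simp only [map_sum, map_smul, LinearMap.sum_apply, LinearMap.smul_apply, Module.Basis.coord_apply]

theorem mul {A : Type*} [Ring A] [Algebra ℂ A] [FiniteDimensional ℂ A] {f g : M → A}
    (hf : HolAt f x) (hg : HolAt g x) : HolAt (fun y => f y * g y) x :=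
  hf.bilin (LinearMap.mul ℂ A) hg

theorem comp {f : N → W} {g : M → N} (hf : HolAt f (g x))
    (hg : ContMDiffAt 𝓘(ℂ) 𝓘(ℂ) ω g x) : HolAt (fun y => f (g y)) x := fun ℓ =>
  ContMDiffAt.comp (g := fun y => ℓ (f y)) x (hf ℓ) hg

theorem differentiableAt {f : ℂ → W} {z : ℂ} (hf : HolAt f z) (ℓ : Module.Dual ℂ W) :
    DifferentiableAt ℂ (fun w => ℓ (f w)) z :=
  (holAt_iff_analyticAt.1 (holAt_iff.2 (hf ℓ))).differentiableAt

end HolAt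

/-- Holomorphy depends on the germ only, so a section of a family may be replaced by any total
function that agrees with it in the trivialisation. This removes the dependent types from the later
arguments. -/
theorem isHolomorphicAt_iff {G : M → Type*} [∀ x, AddCommMonoid (G x)] [∀ x, Module ℂ (G x)]
    {τ : ∀ x, G x →ₗ[ℂ] W} {U : Opens M} {s : ∀ x : U, G x} {x₀ : M} (hx : x₀ ∈ U) {f : M → W}
    (hf : ∀ x : U, τ x (s x) = f x) : IsHolomorphicAt τ s x₀ ↔ HolAt f x₀ := by
  have key : ∀ ℓ : Module.Dual ℂ W, (open scoped Classical in
      fun x : M => if h : x ∈ U then ℓ (τ x (s ⟨x, h⟩)) else 0) =ᶠ[nhds x₀]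
      fun x => ℓ (f x) := fun ℓ => by
    filter_upwards [U.isOpen.mem_nhds hx] with x hx
    have hx' : x ∈ U := hx
    simp only [hx', dif_pos]
    rw [← hf ⟨x, hx'⟩]
  exact forall_congr' fun ℓ => (key ℓ).contMDiffAt_iff

end HolAt

/-! ### Derivatives of functions with values in a finite-dimensional space -/

section hderiv

variable {W : Type*} [AddCommGroup W] [Module ℂ W] [FiniteDimensional ℂ W]
  {W' : Type*} [AddCommGroup W'] [Module ℂ W'] [FiniteDimensional ℂ W']
  {W'' : Type*} [AddCommGroup W''] [Module ℂ W''] [FiniteDimensional ℂ W'']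

/-- The componentwise derivative of a function with values in a finite-dimensional space. -/
def hderiv (f : ℂ → W) (z : ℂ) : W :=
  ∑ i, deriv (fun w => (Module.finBasis ℂ W).coord i (f w)) z • Module.finBasis ℂ W i

theorem hderiv_congr {f g : ℂ → W} {z : ℂ} (h : f =ᶠ[nhds z] g) : hderiv f z = hderiv g z := by
  simp only [hderiv]
  refine Finset.sum_congr rfl fun i _ => ?_
  exact congrArg (· • _) (Filter.EventuallyEq.deriv_eq (h.fun_comp ((Module.finBasis ℂ W).coord i)))

/-- Shows that `hderiv` does not depend on the basis chosen to define it; coefficients of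
derivatives are from here on computed as derivatives of coefficients. -/
theorem map_hderiv {f : ℂ → W} {z : ℂ} (hf : HolAt f z) (ℓ : Module.Dual ℂ W) :
    ℓ (hderiv f z) = deriv (fun w => ℓ (f w)) z := by
  set b := Module.finBasis ℂ W with hb
  have h : (fun w => ℓ (f w)) = fun w => ∑ i, b.coord i (f w) * ℓ (b i) := by
    funext w
    conv_lhs => rw [← b.sum_repr (f w)]
    simp only [map_sum, map_smul, LinearMap.sum_apply, LinearMap.smul_apply,
      Module.Basis.coord_apply, smul_eq_mul, LinearMap.comp_apply]
  rw [h, deriv_fun_sum fun i _ => (hf.differentiableAt _).mul_const _]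
  simp only [hderiv, map_sum, map_smul, smul_eq_mul]
  refine Finset.sum_congr rfl fun i _ => ?_
  rw [deriv_mul_const (hf.differentiableAt _)]

theorem hderiv_eq_of_forall {f : ℂ → W} {z : ℂ} (hf : HolAt f z) {w : W}
    (h : ∀ ℓ : Module.Dual ℂ W, deriv (fun w => ℓ (f w)) z = ℓ w) : hderiv f z = w := by
  rw [← sub_eq_zero, ← Module.forall_dual_apply_eq_zero_iff ℂ]
  intro ℓ
  rw [map_sub, map_hderiv hf, h, sub_self]

theorem HolAt.hderiv {f : ℂ → W} {z : ℂ} (hf : HolAt f z) : HolAt (hderiv f) z :=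
  HolAt.sum fun _ _ => HolAt.smul
    (holAt_iff_analyticAt.2 (holAt_iff_analyticAt.1 (holAt_iff.2 (hf _))).deriv) (HolAt.const _)

theorem hderiv_add {f g : ℂ → W} {z : ℂ} (hf : HolAt f z) (hg : HolAt g z) :
    hderiv (fun w => f w + g w) z = hderiv f z + hderiv g z :=
  hderiv_eq_of_forall (hf.add hg) fun ℓ => by
    simp only [map_add, map_hderiv hf, map_hderiv hg]
    exact deriv_fun_add (hf.differentiableAt ℓ) (hg.differentiableAt ℓ)

theorem hderiv_map {f : ℂ → W} {z : ℂ} (hf : HolAt f z) (L : W →ₗ[ℂ] W') :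
    hderiv (fun w => L (f w)) z = L (hderiv f z) :=
  hderiv_eq_of_forall (hf.map L) fun ℓ => (map_hderiv hf (ℓ ∘ₗ L)).symm

theorem hderiv_const (w : W) (z : ℂ) : hderiv (fun _ => w) z = 0 :=
  hderiv_eq_of_forall (HolAt.const w) fun ℓ => by simp

theorem hderiv_bilin {f : ℂ → W} {g : ℂ → W'} {z : ℂ} (B : W →ₗ[ℂ] W' →ₗ[ℂ] W'') (hf : HolAt f z)
    (hg : HolAt g z) :
    hderiv (fun w => B (f w) (g w)) z = B (hderiv f z) (g z) + B (f z) (hderiv g z) := by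
  let b := Module.finBasis ℂ W
  refine hderiv_eq_of_forall (hf.bilin B hg) fun ℓ => ?_
  have h : (fun w => ℓ (B (f w) (g w))) =
      fun w => ∑ i, b.coord i (f w) * (ℓ ∘ₗ B (b i)) (g w) := by
    funext w
    conv_lhs => rw [← b.sum_repr (f w)]
    simp only [map_sum, map_smul, LinearMap.sum_apply, LinearMap.smul_apply,
      Module.Basis.coord_apply, smul_eq_mul, LinearMap.comp_apply]
  rw [h, deriv_fun_sum fun i _ => (hf.differentiableAt _).fun_mul (hg.differentiableAt _)]
  conv_rhs => rw [← b.sum_repr (hderiv f z), ← b.sum_repr (f z)]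
  simp only [map_sum, map_smul, LinearMap.sum_apply, LinearMap.smul_apply, map_add, smul_eq_mul,
    ← Finset.sum_add_distrib]
  refine Finset.sum_congr rfl fun i _ => ?_
  rw [deriv_fun_mul (hf.differentiableAt _) (hg.differentiableAt _), ← map_hderiv hf,
    ← map_hderiv hg]
  simp

theorem hderiv_mul {A : Type*} [Ring A] [Algebra ℂ A] [FiniteDimensional ℂ A] {f g : ℂ → A} {z : ℂ}
    (hf : HolAt f z) (hg : HolAt g z) :
    hderiv (fun w => f w * g w) z = hderiv f z * g z + f z * hderiv g z :=
  hderiv_bilin (LinearMap.mul ℂ A) hf hg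

end hderiv

instance (q : ℕ) : FiniteDimensional ℂ (ExteriorAlgebra ℂ (Fin q → ℂ)) := exteriorAlgebra_finite _

/-! ### Restriction and composition of partial isomorphisms -/

namespace SuperSpace

variable {M : Type u} [TopologicalSpace M] (A : SuperSpace M)

theorem res_res {U V W : Opens M} (h : V ≤ U) (h' : W ≤ V) (s : A.sections U) :
    A.res h' (A.res h s) = A.res (h'.trans h) s := by
  have := A.sheaf.1.map_comp (homOfLE h).op (homOfLE h').op
  exact (DFunLike.congr_fun (congrArg AlgCat.Hom.hom this) s).symm

theorem res_self {U : Opens M} (h : U ≤ U) (s : A.sections U) : A.res h s = s := by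
  have := A.sheaf.1.map_id (op U)
  exact DFunLike.congr_fun (congrArg AlgCat.Hom.hom this) s

/-- Sections over equal open sets. -/
def resEquiv {U V : Opens M} (h : U = V) : A.sections U ≃ₐ[ℂ] A.sections V :=
  AlgEquiv.ofAlgHom (A.res h.ge) (A.res h.le)
    (by ext s; exact (A.res_res _ _ s).trans (A.res_self _ s))
    (by ext s; exact (A.res_res _ _ s).trans (A.res_self _ s))

theorem resEquiv_apply {U V : Opens M} (h : U = V) (s : A.sections U) :
    A.resEquiv h s = A.res h.ge s := rfl

end SuperSpace

section trans

variable {M : Type u} [TopologicalSpace M] {N : Type v} [TopologicalSpace N]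
  {P : Type*} [TopologicalSpace P]

/-- The two open sets differ by the bracketing of a conjunction and are not definitionally equal, so
compositions of partial isomorphisms pass through `resEquiv`. -/
theorem preimOpens_trans (e : OpenPartialHomeomorph M N) (e' : OpenPartialHomeomorph N P)
    (V : Opens P) : preimOpens e (preimOpens e' V) = preimOpens (e.trans e') V := by
  ext x
  simp only [preimOpens, Opens.coe_mk, OpenPartialHomeomorph.trans_source, Set.mem_inter_iff,
    Set.mem_preimage, OpenPartialHomeomorph.coe_trans, Function.comp_apply, SetLike.mem_coe,
    and_assoc]

theorem preimOpens_subset_target {e : OpenPartialHomeomorph M N} {e' : OpenPartialHomeomorph N P}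
    {V : Opens P} (hV : (V : Set P) ⊆ (e.trans e').target) :
    (preimOpens e' V : Set N) ⊆ e.target := fun y hy => by
  have h := hV hy.2
  rw [OpenPartialHomeomorph.trans_target] at h
  have h2 := h.2
  rwa [Set.mem_preimage, e'.left_inv hy.1] at h2

theorem subset_target_of_trans {e : OpenPartialHomeomorph M N} {e' : OpenPartialHomeomorph N P}
    {V : Opens P} (hV : (V : Set P) ⊆ (e.trans e').target) : (V : Set P) ⊆ e'.target := fun _ hy =>
  (by simpa only [OpenPartialHomeomorph.trans_target] using hV hy :
    _ ∈ e'.target ∩ e'.symm ⁻¹' e.target).1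

/-- Composition of partial isomorphisms of superspaces. -/
def PartialIso.trans {A : SuperSpace M} {B : SuperSpace N} {D : SuperSpace P}
    {e : OpenPartialHomeomorph M N} {e' : OpenPartialHomeomorph N P}
    (Φ : PartialIso A B e) (Ψ : PartialIso B D e') : PartialIso A D (e.trans e') where
  pull V hV := (Ψ.pull V (subset_target_of_trans hV)).trans
    ((Φ.pull (preimOpens e' V) (preimOpens_subset_target hV)).trans
      (A.resEquiv (preimOpens_trans e e' V)))
  pull_res hV hV' h s := by
    simp only [AlgEquiv.trans_apply, SuperSpace.resEquiv_apply]
    rw [Ψ.pull_res (subset_target_of_trans hV) _ h, Φ.pull_res (preimOpens_subset_target hV),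
      A.res_res, A.res_res]
  pull_parity V hV s := by
    simp only [AlgEquiv.trans_apply, SuperSpace.resEquiv_apply]
    rw [Ψ.pull_parity, Φ.pull_parity, A.parity_res]
  body_pull V hV s x := by
    simp only [AlgEquiv.trans_apply, SuperSpace.resEquiv_apply]
    rw [A.body_res, Φ.body_pull, Ψ.body_pull]
    rfl

end trans

/-! ### Values of superfunctions -/

namespace superAffine

variable {q : ℕ}

open scoped Classical in
/-- The values of a superfunction on an open subset of `ℂ`, extended by zero. -/
def ev {V : Opens ℂ} (s : (superAffine q).sections V) (z : ℂ) : ExteriorAlgebra ℂ (Fin q → ℂ) :=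
  if h : z ∈ V then eval s ⟨z, h⟩ else 0

variable {V V' : Opens ℂ} {z : ℂ}

theorem ev_of_mem (hz : z ∈ V) (s : (superAffine q).sections V) : ev s z = eval s ⟨z, hz⟩ :=
  dif_pos hz

theorem ext {s t : (superAffine q).sections V} (h : ∀ z ∈ V, ev s z = ev t z) : s = t :=
  Subtype.ext (funext fun z => by
    have := h z.1 z.2
    rwa [ev_of_mem z.2, ev_of_mem z.2] at this)

theorem ev_res (h : V' ≤ V) (hz : z ∈ V') (s : (superAffine q).sections V) :
    ev ((superAffine q).res h s) z = ev s z := by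
  rw [ev_of_mem hz, ev_of_mem (h hz)]; rfl

/-- Evaluation at a point. -/
def evHom (hz : z ∈ V) : (superAffine q).sections V →ₐ[ℂ] ExteriorAlgebra ℂ (Fin q → ℂ) where
  toFun s := ev s z
  map_one' := by rw [ev_of_mem hz]; rfl
  map_mul' s t := by rw [ev_of_mem hz, ev_of_mem hz, ev_of_mem hz]; rfl
  map_zero' := by rw [ev_of_mem hz]; rfl
  map_add' s t := by rw [ev_of_mem hz, ev_of_mem hz, ev_of_mem hz]; rfl
  commutes' r := by rw [ev_of_mem hz]; rfl

theorem evHom_apply (hz : z ∈ V) (s : (superAffine q).sections V) : evHom hz s = ev s z := rfl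

theorem ev_parity (hz : z ∈ V) (s : (superAffine q).sections V) :
    ev ((superAffine q).parity V s) z = ExteriorAlgebra.map (-LinearMap.id) (ev s z) := by
  rw [ev_of_mem hz, ev_of_mem hz]; rfl

theorem body_eq (hz : z ∈ V) (s : (superAffine q).sections V) :
    (superAffine q).body V s ⟨z, hz⟩ = ExteriorAlgebra.algebraMapInv (ev s z) := by
  rw [ev_of_mem hz]; rfl

theorem holAt_ev (hz : z ∈ V) (s : (superAffine q).sections V) : HolAt (ev s) z := by
  have h := (show extSections q (Bundle.Trivial ℂ (Fin q → ℂ)) V from s).2 ⟨z, hz⟩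
  refine (isHolomorphicAt_iff hz fun x => ?_).1 h
  rw [extTriv_trivial, ev_of_mem x.2]
  rfl

/-- The superfunction with given holomorphic values. -/
def ofFun (V : Opens ℂ) (f : ℂ → ExteriorAlgebra ℂ (Fin q → ℂ)) (hf : ∀ z ∈ V, HolAt f z) :
    (superAffine q).sections V := mk V f fun ℓ z hz => hf z hz ℓ

theorem ev_ofFun {f : ℂ → ExteriorAlgebra ℂ (Fin q → ℂ)} (hf : ∀ z ∈ V, HolAt f z) (hz : z ∈ V) :
    ev (ofFun V f hf) z = f z := by
  rw [ev_of_mem hz]; rfl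

theorem ev_evenCoord (hz : z ∈ V) : ev (evenCoord (q := q) V) z = algebraMap ℂ _ z := by
  rw [ev_of_mem hz]; rfl

theorem ev_oddLinear (hz : z ∈ V) (v : Fin q → ℂ) :
    ev (oddLinear (q := q) V v) z = ExteriorAlgebra.ι ℂ v := by
  rw [ev_of_mem hz]; rfl

theorem parity_evenCoord : (superAffine q).parity V (evenCoord V) = evenCoord V :=
  ext fun z hz => by rw [ev_parity hz, ev_evenCoord hz, AlgHom.commutes]

theorem parity_oddLinear (v : Fin q → ℂ) :
    (superAffine q).parity V (oddLinear V v) = -oddLinear V v :=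
  ext fun z hz => by
    rw [ev_parity hz, ← evHom_apply hz (-_), map_neg, evHom_apply, ev_oddLinear hz]
    simp

end superAffine

namespace Supermanifold.Chart

open superAffine

variable {C : Type u} [TopologicalSpace C] [ChartedSpace ℂ C] {q : ℕ} {E : C → Type u}
    [∀ x, AddCommGroup (E x)] [∀ x, Module ℂ (E x)] [∀ x, TopologicalSpace (E x)]
    [TopologicalSpace (Bundle.TotalSpace (Fin q → ℂ) E)] [FiberBundle (Fin q → ℂ) E]
    [VectorBundle ℂ (Fin q → ℂ) E] {X : Supermanifold q E}

/-- The values of a section in the coordinates of a chart, extended by zero. -/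
def fn (c : X.Chart) {W : Opens C} (s : X.sections W) : ℂ → ExteriorAlgebra ℂ (Fin q → ℂ) :=
  ev (c.express s)

variable (c : X.Chart) {W W' : Opens C} {z : ℂ} {x : C}

theorem fn_pull_of_mem {V : Opens ℂ} (hV : (V : Set ℂ) ⊆ c.base.target) (hz : z ∈ V)
    (F : (superAffine q).sections V) : c.fn (c.iso.pull V hV F) z = ev F z := by
  have hle : imageOpens c.base (preimOpens c.base V) ≤ V := fun w hw => by
    have h2 := hw.2.2
    rwa [Set.mem_preimage, c.base.right_inv hw.1] at h2
  have hz' : z ∈ imageOpens c.base (preimOpens c.base V) :=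
    ⟨hV hz, c.base.map_target (hV hz), by
      change c.base (c.base.symm z) ∈ V
      rwa [c.base.right_inv (hV hz)]⟩
  rw [fn, express, ← c.iso.pull_res hV (image_subset_target _ _) hle, AlgEquiv.symm_apply_apply,
    ev_res hle hz']

theorem fn_res (h : W' ≤ W) (hz : z ∈ imageOpens c.base W') (s : X.sections W) :
    c.fn (X.res h s) z = c.fn s z := by
  have hle : imageOpens c.base W' ≤ imageOpens c.base W := fun w hw => ⟨hw.1, h hw.2⟩
  have key : c.express (X.res h s) = (superAffine q).res hle (c.express s) := by
    rw [express, express, AlgEquiv.symm_apply_eq, c.iso.pull_res (image_subset_target _ _) _ hle,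
      AlgEquiv.apply_symm_apply, X.res_res, X.res_res]
  rw [fn, key, ev_res hle hz]
  rfl

/-- Evaluation of sections in the coordinates of a chart. -/
def fnHom (hz : z ∈ imageOpens c.base W) : X.sections W →ₐ[ℂ] ExteriorAlgebra ℂ (Fin q → ℂ) :=
  (evHom hz).comp ((c.iso.pull (imageOpens c.base W) (image_subset_target _ _)).symm.toAlgHom.comp
    (X.res (preim_image_le c.base W)))

theorem fnHom_apply (hz : z ∈ imageOpens c.base W) (s : X.sections W) :
    c.fnHom hz s = c.fn s z := rfl

section

variable (hz : z ∈ imageOpens c.base W) (s t : X.sections W)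
include hz

theorem fn_mul : c.fn (s * t) z = c.fn s z * c.fn t z := map_mul (c.fnHom hz) s t
theorem fn_add : c.fn (s + t) z = c.fn s z + c.fn t z := map_add (c.fnHom hz) s t
theorem fn_sub : c.fn (s - t) z = c.fn s z - c.fn t z := map_sub (c.fnHom hz) s t
theorem fn_smul (k : ℂ) : c.fn (k • s) z = k • c.fn s z := map_smul (c.fnHom hz) k s
theorem fn_one : c.fn (1 : X.sections W) z = 1 := map_one (c.fnHom hz)

theorem holAt_fn : HolAt (c.fn s) z := holAt_ev hz _

theorem body_fn : ExteriorAlgebra.algebraMapInv (c.fn s z) =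
    X.body W s ⟨c.base.symm z, hz.2⟩ := by
  rw [fn, ← body_eq hz]
  have h := c.iso.body_pull _ (image_subset_target c.base W) (c.express s)
    ⟨c.base.symm z, c.base.map_target hz.1, by
      change c.base (c.base.symm z) ∈ imageOpens c.base W
      rwa [c.base.right_inv hz.1]⟩
  rw [express, AlgEquiv.apply_symm_apply, X.body_res] at h
  rw [h]
  exact congrArg ((superAffine q).body _ _) (Subtype.ext (c.base.right_inv hz.1).symm)

theorem fn_parity : c.fn (X.parity W s) z = ExteriorAlgebra.map (-LinearMap.id) (c.fn s z) := by
  have key : c.express (X.parity W s) = (superAffine q).parity _ (c.express s) := by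
    rw [express, express, AlgEquiv.symm_apply_eq, c.iso.pull_parity, AlgEquiv.apply_symm_apply,
      X.parity_res]
  rw [fn, key, ev_parity hz]
  rfl

end

theorem mem_image_iff {W : Opens C} (hx : x ∈ c.domain) :
    c.base x ∈ imageOpens c.base W ↔ x ∈ W := by
  constructor
  · intro h
    have h2 := h.2
    rwa [Set.mem_preimage, c.base.left_inv hx] at h2
  · exact fun h => mem_image c.base h hx

theorem ext_fn (hW : W ≤ c.domain) {s t : X.sections W}
    (h : ∀ z ∈ imageOpens c.base W, c.fn s z = c.fn t z) : s = t := by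
  have h1 : c.express s = c.express t := superAffine.ext h
  have h2 := (AlgEquiv.injective _) h1
  have h3 := congrArg (X.res (le_preim_image c.base W hW)) h2
  rwa [X.res_res, X.res_res, X.res_self, X.res_self] at h3

theorem fn_lift (hz : z ∈ c.base.target) (F : (superAffine q).sections c.target) :
    c.fn (c.lift F) z = ev F z := by
  have hz' : z ∈ imageOpens c.base c.domain := ⟨hz, c.base.map_target hz⟩
  exact (c.fn_res _ hz' _).trans (c.fn_pull_of_mem subset_rfl hz F)

theorem fn_even (hz : z ∈ c.base.target) : c.fn c.even z = algebraMap ℂ _ z := by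
  rw [even, fn_lift _ hz]
  exact ev_evenCoord hz

/-- The odd function of a chart that is linear in the odd coordinates with constant
coefficients. -/
def oddLin (v : Fin q → ℂ) : X.sections c.domain := c.lift (oddLinear _ v)

theorem fn_oddLin (hz : z ∈ c.base.target) (v : Fin q → ℂ) :
    c.fn (c.oddLin v) z = ExteriorAlgebra.ι ℂ v := by
  rw [oddLin, fn_lift _ hz]
  exact ev_oddLinear hz v

theorem parity_lift (F : (superAffine q).sections c.target) :
    X.parity c.domain (c.lift F) = c.lift ((superAffine q).parity _ F) := by
  exact (X.parity_res _ _).trans (congrArg (X.res _) (c.iso.pull_parity _ _ F).symm)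

theorem parity_even : X.parity c.domain c.even = c.even := by
  rw [even, parity_lift, parity_evenCoord]

theorem parity_oddLin (v : Fin q → ℂ) : X.parity c.domain (c.oddLin v) = -c.oddLin v := by
  rw [oddLin, parity_lift, parity_oddLinear, map_neg]

theorem body_even (x : c.domain) : X.body c.domain c.even x = c.base x := by
  have hz : c.base x.1 ∈ imageOpens c.base c.domain := mem_image _ x.2 x.2
  have h := c.body_fn hz c.even
  rw [fn_even c hz.1, ExteriorAlgebra.algebraMap_leftInverse] at h
  rw [h]
  exact congrArg (X.body _ _) (Subtype.ext (c.base.left_inv x.2).symm)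

end Supermanifold.Chart

/-! ### Taylor expansion of homomorphisms from superfunctions -/

namespace superAffine

variable {q : ℕ} {V : Opens ℂ}

/-- The superfunctions with constant coefficients. -/
def constHom (V : Opens ℂ) :
    ExteriorAlgebra ℂ (Fin q → ℂ) →ₐ[ℂ] (superAffine q).sections V where
  toFun l := ofFun V (fun _ => l) fun _ _ => HolAt.const _
  map_one' := rfl
  map_mul' _ _ := rfl
  map_zero' := rfl
  map_add' _ _ := rfl
  commutes' _ := rfl

theorem ev_constHom {z : ℂ} (hz : z ∈ V) (l : ExteriorAlgebra ℂ (Fin q → ℂ)) :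
    ev (constHom V l) z = l := by
  rw [ev_of_mem hz]; rfl

theorem constHom_ι (v : Fin q → ℂ) : constHom V (ExteriorAlgebra.ι ℂ v) = oddLinear V v :=
  ext fun z hz => by rw [ev_constHom hz, ev_oddLinear hz]

theorem holAt_algebraMap {f : ℂ → ℂ} {z : ℂ} (hf : HolAt f z) :
    HolAt (fun w => algebraMap ℂ (ExteriorAlgebra ℂ (Fin q → ℂ)) (f w)) z :=
  hf.map (Algebra.linearMap ℂ (ExteriorAlgebra ℂ (Fin q → ℂ)))

/-- The superfunctions without odd coordinates. -/
def scalar (V : Opens ℂ) (f : ℂ → ℂ) (hf : ∀ z ∈ V, HolAt f z) : (superAffine q).sections V :=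
  ofFun V (fun z => algebraMap ℂ _ (f z)) fun z hz => holAt_algebraMap (hf z hz)

theorem ev_scalar {f : ℂ → ℂ} (hf : ∀ z ∈ V, HolAt f z) {z : ℂ} (hz : z ∈ V) :
    ev (scalar (q := q) V f hf) z = algebraMap ℂ _ (f z) := ev_ofFun _ hz

variable {B : Type*} [Ring B] [Algebra ℂ B] {z₀ : ℂ} (p : (superAffine q).sections V →ₐ[ℂ] B)

theorem holAt_dslope {f : ℂ → ℂ} (hz₀ : z₀ ∈ V) (hf : ∀ z ∈ V, HolAt f z) :
    ∀ z ∈ V, HolAt (dslope f z₀) z := by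
  have h : DifferentiableOn ℂ f V := fun z hz =>
    ((hf z hz).differentiableAt LinearMap.id).differentiableWithinAt
  have h2 := (Complex.differentiableOn_dslope (V.isOpen.mem_nhds hz₀)).2 h
  exact fun z hz => holAt_iff_analyticAt.2 (h2.analyticAt (V.isOpen.mem_nhds hz))

/-- Hadamard's lemma: the difference quotient `dslope` is holomorphic across `z₀`, so the division
by `z - z₀` takes place among superfunctions. -/
theorem scalar_eq (hz₀ : z₀ ∈ V) {f : ℂ → ℂ} (hf : ∀ z ∈ V, HolAt f z) :
    scalar (q := q) V f hf = algebraMap ℂ _ (f z₀) + (evenCoord V - algebraMap ℂ _ z₀) *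
      scalar V (dslope f z₀) (holAt_dslope hz₀ hf) := by
  refine ext fun z hz => ?_
  rw [← evHom_apply hz (_ + _), map_add, map_mul, map_sub, AlgHom.commutes, AlgHom.commutes,
    evHom_apply, evHom_apply, ev_scalar _ hz, ev_scalar _ hz, ev_evenCoord hz, ← map_sub,
    ← map_mul, ← map_add]
  congr 1
  have := sub_smul_dslope f z₀ z
  rw [smul_eq_mul] at this
  rw [this]
  ring

/-- Hadamard's lemma is applied twice; the remainder carries the factor `(p z - z₀)²`, which is
zero. The argument is algebraic and needs no continuity of `p`. -/
theorem map_scalar (hz₀ : z₀ ∈ V)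
    (hp : (p (evenCoord V) - algebraMap ℂ B z₀) * (p (evenCoord V) - algebraMap ℂ B z₀) = 0)
    {f : ℂ → ℂ} (hf : ∀ z ∈ V, HolAt f z) :
    p (scalar V f hf) = algebraMap ℂ B (f z₀) +
      deriv f z₀ • (p (evenCoord V) - algebraMap ℂ B z₀) := by
  rw [scalar_eq hz₀ hf, scalar_eq hz₀ (holAt_dslope hz₀ hf)]
  simp only [map_add, map_mul, map_sub, AlgHom.commutes, mul_add]
  rw [← mul_assoc, hp, zero_mul, add_zero, dslope_same, ← Algebra.commutes, Algebra.smul_def]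

theorem eq_sum_scalar (F : (superAffine q).sections V) :
    F = ∑ i, scalar V (fun z => (Module.finBasis ℂ (ExteriorAlgebra ℂ (Fin q → ℂ))).coord i (ev F z))
      (fun _ hz => (holAt_ev hz F).map _) * constHom V (Module.finBasis ℂ _ i) := by
  refine ext fun z hz => ?_
  rw [← evHom_apply hz (Finset.sum _ _), map_sum]
  simp only [map_mul, evHom_apply, ev_scalar _ hz, ev_constHom hz, ← Algebra.smul_def]
  conv_lhs => rw [← (Module.finBasis ℂ (ExteriorAlgebra ℂ (Fin q → ℂ))).sum_repr (ev F z)]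
  rfl

/-- A homomorphism from superfunctions is determined by its values on the coordinates. -/
theorem map_eq_taylor (hz₀ : z₀ ∈ V)
    (hp : (p (evenCoord V) - algebraMap ℂ B z₀) * (p (evenCoord V) - algebraMap ℂ B z₀) = 0)
    (F : (superAffine q).sections V) :
    p F = p (constHom V (ev F z₀)) +
      (p (evenCoord V) - algebraMap ℂ B z₀) * p (constHom V (hderiv (ev F) z₀)) := by
  set b := Module.finBasis ℂ (ExteriorAlgebra ℂ (Fin q → ℂ))
  -- A superfunction is a finite sum of scalar functions times constant ones, so the scalar
  -- expansion applies to each term.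
  conv_lhs => rw [eq_sum_scalar F, map_sum]
  have h1 : p (constHom V (ev F z₀)) = ∑ i, b.coord i (ev F z₀) • p (constHom V (b i)) := by
    conv_lhs => rw [← b.sum_repr (ev F z₀)]
    simp only [map_sum, map_smul, Module.Basis.coord_apply]
  have h2 : p (constHom V (hderiv (ev F) z₀)) =
      ∑ i, deriv (fun w => b.coord i (ev F w)) z₀ • p (constHom V (b i)) := by
    simp only [hderiv, map_sum, map_smul]
    rfl
  rw [h1, h2, Finset.mul_sum, ← Finset.sum_add_distrib]
  refine Finset.sum_congr rfl fun i _ => ?_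
  rw [map_mul, map_scalar p hz₀ hp, add_mul, ← Algebra.smul_def, mul_smul_comm]
  exact congrArg₂ _ rfl (smul_mul_assoc _ _ _)

end superAffine

/-! ### Transition maps between two charts -/

namespace Supermanifold.Chart

open superAffine

variable {C : Type u} [TopologicalSpace C] [ChartedSpace ℂ C]

section general

variable {q : ℕ} {E : C → Type u}
    [∀ x, AddCommGroup (E x)] [∀ x, Module ℂ (E x)] [∀ x, TopologicalSpace (E x)]
    [TopologicalSpace (Bundle.TotalSpace (Fin q → ℂ) E)] [FiberBundle (Fin q → ℂ) E]
    [VectorBundle ℂ (Fin q → ℂ) E] {X : Supermanifold q E}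

variable (a b : X.Chart) {W : Opens C} {x : C}

/-- The substitution of the odd coordinates of `b` by their values in the coordinates of `a`. -/
def sub (hx : x ∈ a.domain ⊓ b.domain) :
    ExteriorAlgebra ℂ (Fin q → ℂ) →ₐ[ℂ] ExteriorAlgebra ℂ (Fin q → ℂ) :=
  (a.fnHom (mem_image a.base hx.2 hx.1 : a.base x ∈ imageOpens a.base b.domain)).comp
    (b.lift.comp (constHom _))

theorem sub_apply (hx : x ∈ a.domain ⊓ b.domain) (l : ExteriorAlgebra ℂ (Fin q → ℂ)) :
    a.sub b hx l = a.fn (b.lift (constHom _ l)) (a.base x) := rfl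

theorem sub_ι (hx : x ∈ a.domain ⊓ b.domain) (v : Fin q → ℂ) :
    a.sub b hx (ExteriorAlgebra.ι ℂ v) = a.fn (b.oddLin v) (a.base x) := by
  rw [sub_apply, constHom_ι]; rfl

/-- The nilpotent part of the even coordinate of `b` in the coordinates of `a`. -/
def nil (x : C) : ExteriorAlgebra ℂ (Fin q → ℂ) :=
  a.fn b.even (a.base x) - algebraMap ℂ _ (b.base x)

/-- Expressing in `a` a superfunction of the coordinates of `b` is an algebra homomorphism, so its
Taylor expansion at the reduced point `b.base x` gives the change of coordinates. -/
theorem fn_eq_taylor (hx : x ∈ a.domain ⊓ b.domain) (hW : x ∈ W)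
    (hn : a.nil b x * a.nil b x = 0) (s : X.sections W) :
    a.fn s (a.base x) = a.sub b hx (b.fn s (b.base x)) +
      a.nil b x * a.sub b hx (hderiv (b.fn s) (b.base x)) := by
  set V := imageOpens b.base W with hV
  have hbx : b.base x ∈ V := mem_image b.base hW hx.2
  have hxV : x ∈ preimOpens b.base V := ⟨hx.2, hbx⟩
  have hz : a.base x ∈ imageOpens a.base (preimOpens b.base V) := mem_image a.base hxV hx.1
  let p : (superAffine q).sections V →ₐ[ℂ] ExteriorAlgebra ℂ (Fin q → ℂ) :=
    (a.fnHom hz).comp (b.iso.pull V (image_subset_target _ _)).toAlgHom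
  have hVt : V ≤ b.target := image_subset_target _ _
  have hp : ∀ F : (superAffine q).sections b.target,
      p ((superAffine q).res hVt F) = a.fn (b.lift F) (a.base x) := fun F => by
    have e1 : p ((superAffine q).res hVt F) = a.fn (b.iso.pull V (image_subset_target _ _)
      ((superAffine q).res hVt F)) (a.base x) := rfl
    have hle : preimOpens b.base V ≤ b.domain := fun _ h => h.1
    have e2 : b.iso.pull V (image_subset_target _ _) ((superAffine q).res hVt F) =
        X.res hle (b.lift F) :=
      (b.iso.pull_res subset_rfl _ hVt F).trans (X.res_res _ _ _).symm
    rw [e1, e2, a.fn_res hle hz]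
  have hps : p (b.express s) = a.fn s (a.base x) := by
    have e1 : p (b.express s) = a.fn (b.iso.pull V (image_subset_target _ _) (b.express s))
      (a.base x) := rfl
    rw [e1, express, AlgEquiv.apply_symm_apply, a.fn_res _ hz]
  have hc : ∀ l, p (constHom V l) = a.sub b hx l := fun l => hp (constHom _ l)
  have he : p (evenCoord V) - algebraMap ℂ _ (b.base x) = a.nil b x := by
    rw [nil, even, ← hp]; rfl
  have key := map_eq_taylor p hbx (by rw [he]; exact hn) (b.express s)
  rw [hps, he, hc, hc] at key
  exact key

theorem par_nil (hx : x ∈ a.domain ⊓ b.domain) :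
    ExteriorAlgebra.map (-LinearMap.id) (a.nil b x) = a.nil b x := by
  have hz : a.base x ∈ imageOpens a.base b.domain := mem_image a.base hx.2 hx.1
  rw [nil, map_sub, ← a.fn_parity hz, parity_even, AlgHom.commutes]

theorem body_nil (hx : x ∈ a.domain ⊓ b.domain) :
    ExteriorAlgebra.algebraMapInv (a.nil b x) = 0 := by
  have hz : a.base x ∈ imageOpens a.base b.domain := mem_image a.base hx.2 hx.1
  rw [nil, map_sub, body_fn _ hz, body_even, ExteriorAlgebra.algebraMap_leftInverse, sub_eq_zero]
  exact congrArg b.base (a.base.left_inv hx.1)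

theorem par_sub_ι (hx : x ∈ a.domain ⊓ b.domain) (v : Fin q → ℂ) :
    ExteriorAlgebra.map (-LinearMap.id) (a.sub b hx (ExteriorAlgebra.ι ℂ v)) =
      -a.sub b hx (ExteriorAlgebra.ι ℂ v) := by
  have hz : a.base x ∈ imageOpens a.base b.domain := mem_image a.base hx.2 hx.1
  rw [sub_ι, ← a.fn_parity hz, parity_oddLin, ← a.fnHom_apply hz, map_neg, fnHom_apply]

/-- The linear part of the odd coordinates of `b` in terms of those of `a`. -/
def lin (hx : x ∈ a.domain ⊓ b.domain) : (Fin q → ℂ) →ₗ[ℂ] (Fin q → ℂ) :=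
  ExteriorAlgebra.ιInv ∘ₗ (a.sub b hx).toLinearMap ∘ₗ ExteriorAlgebra.ι ℂ

theorem lin_apply (hx : x ∈ a.domain ⊓ b.domain) (v : Fin q → ℂ) :
    a.lin b hx v = ExteriorAlgebra.ιInv (a.fn (b.oddLin v) (a.base x)) := by
  rw [← sub_ι a b hx]; rfl

end general

section three

variable {E : C → Type u}
    [∀ x, AddCommGroup (E x)] [∀ x, Module ℂ (E x)] [∀ x, TopologicalSpace (E x)]
    [TopologicalSpace (Bundle.TotalSpace (Fin 3 → ℂ) E)] [FiberBundle (Fin 3 → ℂ) E]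
    [VectorBundle ℂ (Fin 3 → ℂ) E] {X : Supermanifold 3 E}

variable (a b d : X.Chart) {W : Opens C} {x : C} (hx : x ∈ a.domain ⊓ b.domain)
include hx

/-- `nil` is even and has no constant term; with three generators only degree two is left. Its
square has degree four and vanishes, which makes the first-order expansion exact. -/
theorem nil_eq : a.nil b x = Gr.deg2 (a.nil b x) := by
  obtain ⟨h0, h1, h2, h012⟩ := (Gr.even_iff _).1 (a.par_nil b hx)
  have hC := a.body_nil b hx
  rw [← Gr.cC_eq] at hC
  conv_lhs => rw [Gr.eq_mk (a.nil b x), h0, h1, h2, h012, hC]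
  rfl

theorem nil_mul_nil : a.nil b x * a.nil b x = 0 := by
  rw [a.nil_eq b hx, Gr.deg2, Gr.mk_mul]
  simp [Gr.mk]

theorem taylor (hW : x ∈ W) (s : X.sections W) :
    a.fn s (a.base x) = a.sub b hx (b.fn s (b.base x)) +
      a.nil b x * a.sub b hx (hderiv (b.fn s) (b.base x)) :=
  a.fn_eq_taylor b hx hW (a.nil_mul_nil b hx) s

theorem sub_eq (l : Gr) : a.sub b hx l = ExteriorAlgebra.map (a.lin b hx) l +
    Gr.c012 (a.sub b hx (ExteriorAlgebra.ι ℂ (ExteriorAlgebra.ιInv l))) •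
      Gr.mk 0 0 0 0 0 0 0 1 :=
  Gr.hom_eq_map_add _ (a.par_sub_ι b hx) l

end three

end Supermanifold.Chart

namespace Gr

theorem cC_map (g : (Fin 3 → ℂ) →ₗ[ℂ] (Fin 3 → ℂ)) (x : Gr) :
    cC (ExteriorAlgebra.map g x) = cC x := by
  conv_lhs => rw [eq_mk x]
  rw [map_mk g _ _ _ _ _ _ _ _ _ _ _ rfl rfl rfl, cC_mk]

theorem ιInv_map (g : (Fin 3 → ℂ) →ₗ[ℂ] (Fin 3 → ℂ)) (x : Gr) :
    ExteriorAlgebra.ιInv (ExteriorAlgebra.map g x) = g (ExteriorAlgebra.ιInv x) :=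
  LinearMap.congr_fun (ExteriorAlgebra.ιInv_comp_map g) x

theorem deg2_map (g : (Fin 3 → ℂ) →ₗ[ℂ] (Fin 3 → ℂ)) (x : Gr) :
    deg2 (ExteriorAlgebra.map g x) = ExteriorAlgebra.map g (deg2 x) := by
  conv_lhs => rw [eq_mk x]
  rw [deg2, deg2, map_mk g _ _ _ _ _ _ _ _ _ _ _ rfl rfl rfl,
    map_mk g _ _ _ _ _ _ _ _ _ _ _ rfl rfl rfl, c01_mk, c02_mk, c12_mk]
  simp

theorem deg2_add (x y : Gr) : deg2 (x + y) = deg2 x + deg2 y := by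
  simp only [deg2, mk_add, map_add, add_zero]

theorem deg2_smul (k : ℂ) (x : Gr) : deg2 (k • x) = k • deg2 x := by
  simp only [deg2, mk, map_smul, smul_eq_mul]; module

theorem deg2_deg2_mul (x y : Gr) : deg2 (deg2 x * y) = cC y • deg2 x := by
  simp only [deg2, mul_eq_mk, cC_mk, c0_mk, c1_mk, c2_mk, c01_mk, c02_mk, c12_mk, c012_mk]
  simp only [mk]
  module

theorem ιInv_deg2_mul (x y : Gr) : ExteriorAlgebra.ιInv (deg2 x * y) = 0 := by
  simp only [ιInv_eq, deg2, mul_eq_mk, cC_mk, c0_mk, c1_mk, c2_mk]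
  ext i
  fin_cases i <;> simp

end Gr

/-! ### How the components of a section change with the chart -/

namespace Supermanifold.Chart

variable {C : Type u} [TopologicalSpace C] [ChartedSpace ℂ C] {E : C → Type u}
    [∀ x, AddCommGroup (E x)] [∀ x, Module ℂ (E x)] [∀ x, TopologicalSpace (E x)]
    [TopologicalSpace (Bundle.TotalSpace (Fin 3 → ℂ) E)] [FiberBundle (Fin 3 → ℂ) E]
    [VectorBundle ℂ (Fin 3 → ℂ) E] {X : Supermanifold 3 E}
    (a b d : X.Chart) {W : Opens C} {x : C}

/-- The Taylor correction starts in degree two and the nonlinear part of the substitution is cubic,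
so neither reaches degree one. -/
theorem ιInv_fn (hx : x ∈ a.domain ⊓ b.domain) (hW : x ∈ W) (s : X.sections W) :
    ExteriorAlgebra.ιInv (a.fn s (a.base x)) =
      a.lin b hx (ExteriorAlgebra.ιInv (b.fn s (b.base x))) := by
  rw [a.taylor b hx hW, a.nil_eq b hx, map_add, Gr.ιInv_deg2_mul, a.sub_eq b hx, map_add,
    Gr.ιInv_map, map_smul, Gr.ιInv_eq (Gr.mk 0 0 0 0 0 0 0 1), Gr.c0_mk, Gr.c1_mk, Gr.c2_mk]
  have h : (![0, 0, 0] : Fin 3 → ℂ) = 0 := by ext i; fin_cases i <;> rfl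
  rw [h, smul_zero, add_zero, add_zero]

theorem cC_fn (hx : x ∈ a.domain ⊓ b.domain) (hW : x ∈ W) (s : X.sections W) :
    Gr.cC (a.fn s (a.base x)) = Gr.cC (b.fn s (b.base x)) := by
  rw [Gr.cC_eq, Gr.cC_eq, a.body_fn (mem_image a.base hW hx.1),
    b.body_fn (mem_image b.base hW hx.2)]
  exact congrArg _ (Subtype.ext ((a.base.left_inv hx.1).trans (b.base.left_inv hx.2).symm))

/-- In degree two the cubic part of the substitution does not matter, and the factor `nil` of the
Taylor correction meets only the constant term of the derivative. For an even coordinate this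
becomes the cocycle identity. -/
theorem deg2_fn (hx : x ∈ a.domain ⊓ b.domain) (hW : x ∈ W) (s : X.sections W) :
    Gr.deg2 (a.fn s (a.base x)) =
      ExteriorAlgebra.map (a.lin b hx) (Gr.deg2 (b.fn s (b.base x))) +
        deriv (fun w => Gr.cC (b.fn s w)) (b.base x) • a.nil b x := by
  have hb : HolAt (b.fn s) (b.base x) := b.holAt_fn (mem_image b.base hW hx.2) s
  have h1 : Gr.deg2 (Gr.mk 0 0 0 0 0 0 0 1) = 0 := by
    rw [Gr.deg2, Gr.c01_mk, Gr.c02_mk, Gr.c12_mk]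
    simp [Gr.mk]
  have h2 : Gr.cC (Gr.mk 0 0 0 0 0 0 0 1) = 0 := Gr.cC_mk _ _ _ _ _ _ _ _
  rw [a.taylor b hx hW]
  conv_lhs => rw [a.nil_eq b hx]
  rw [Gr.deg2_add, Gr.deg2_deg2_mul, ← a.nil_eq b hx, a.sub_eq b hx, a.sub_eq b hx (hderiv _ _),
    Gr.deg2_add, Gr.deg2_smul, h1, smul_zero, add_zero, Gr.deg2_map, map_add, map_smul, h2,
    smul_zero, add_zero, Gr.cC_map, map_hderiv hb]

/-- The maps `lin` are the transition matrices of the modelling bundle; the rule for linear parts,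
applied to odd coordinates, is their cocycle condition. -/
theorem lin_comp (hx : x ∈ a.domain ⊓ b.domain) (hx' : x ∈ b.domain ⊓ d.domain)
    (hx'' : x ∈ a.domain ⊓ d.domain) : a.lin b hx ∘ₗ b.lin d hx' = a.lin d hx'' := by
  refine LinearMap.ext fun v => ?_
  rw [LinearMap.comp_apply, lin_apply b d, lin_apply a d, ← a.ιInv_fn b hx hx'.2]

theorem lin_self (hx : x ∈ a.domain ⊓ a.domain) : a.lin a hx = LinearMap.id := by
  refine LinearMap.ext fun v => ?_
  rw [lin_apply, a.fn_oddLin (a.base.map_source hx.1)]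
  exact ExteriorAlgebra.ι_leftInverse v

end Supermanifold.Chart

/-! ### Charts of the split model -/

/-- For a constant argument, multiplicativity reduces the claim to generators; a variable argument
is expanded in a basis. -/
theorem HolAt.extMap {M : Type*} [TopologicalSpace M] [ChartedSpace ℂ M] {q : ℕ} {W : Type*}
    [AddCommGroup W] [Module ℂ W] [FiniteDimensional ℂ (ExteriorAlgebra ℂ W)] {x : M}
    {g : M → (Fin q → ℂ) →ₗ[ℂ] W} (hg : ∀ v, HolAt (fun y => g y v) x)
    {f : M → ExteriorAlgebra ℂ (Fin q → ℂ)} (hf : HolAt f x) :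
    HolAt (fun y => ExteriorAlgebra.map (g y) (f y)) x := by
  have key : ∀ l : ExteriorAlgebra ℂ (Fin q → ℂ),
      HolAt (fun y => ExteriorAlgebra.map (g y) l) x := fun l => by
    induction l using ExteriorAlgebra.induction with
    | algebraMap r =>
      simp only [AlgHom.commutes]
      exact HolAt.const _
    | ι v =>
      simp only [ExteriorAlgebra.map_apply_ι]
      exact (hg v).map (ExteriorAlgebra.ι ℂ)
    | mul a b ha hb =>
      simp only [map_mul]
      exact ha.mul hb
    | add a b ha hb =>
      simp only [map_add]
      exact ha.add hb
  let b := Module.finBasis ℂ (ExteriorAlgebra ℂ (Fin q → ℂ))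
  have h : HolAt (fun y => ∑ i, b.coord i (f y) • ExteriorAlgebra.map (g y) (b i)) x :=
    HolAt.sum fun i _ => (holAt_iff.2 (hf _)).smul (key _)
  refine h.congr (Filter.Eventually.of_forall fun y => ?_)
  change ExteriorAlgebra.map (g y) (f y) = _
  conv_lhs => rw [← b.sum_repr (f y)]
  simp only [map_sum, map_smul, Module.Basis.coord_apply]

section SplitChart

variable {C : Type u} [TopologicalSpace C] [ChartedSpace ℂ C] (q : ℕ) (E : C → Type u)
  [∀ x, AddCommGroup (E x)] [∀ x, Module ℂ (E x)] [∀ x, TopologicalSpace (E x)]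
  [TopologicalSpace (Bundle.TotalSpace (Fin q → ℂ) E)] [FiberBundle (Fin q → ℂ) E]
  [VectorBundle ℂ (Fin q → ℂ) E]

/-- The open set over which the preferred trivialisation of `E` at `p` is defined. -/
def trivSet (p : C) : Opens C :=
  ⟨(trivializationAt (Fin q → ℂ) E p).baseSet, (trivializationAt (Fin q → ℂ) E p).open_baseSet⟩

theorem mem_trivSet (p : C) : p ∈ trivSet q E p := FiberBundle.mem_baseSet_trivializationAt' p

/-- The inverse of the preferred trivialisation of `E` at `p`. -/
def trivSymm (p x : C) : (Fin q → ℂ) →ₗ[ℂ] E x :=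
  (trivializationAt (Fin q → ℂ) E p).symmₗ ℂ x

variable {q E}

theorem trivSymm_triv {p x : C} (hx : x ∈ trivSet q E p) (v : E x) :
    trivSymm q E p x (triv q E p x v) = v :=
  (trivializationAt (Fin q → ℂ) E p).symmₗ_linearMapAt hx v

theorem triv_trivSymm {p x : C} (hx : x ∈ trivSet q E p) (v : Fin q → ℂ) :
    triv q E p x (trivSymm q E p x v) = v :=
  (trivializationAt (Fin q → ℂ) E p).linearMapAt_symmₗ hx v

theorem map_trivSymm_extTriv {p x : C} (hx : x ∈ trivSet q E p) (v : ExteriorAlgebra ℂ (E x)) :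
    ExteriorAlgebra.map (trivSymm q E p x) (extTriv q E p x v) = v := by
  have h : trivSymm q E p x ∘ₗ triv q E p x = LinearMap.id :=
    LinearMap.ext (trivSymm_triv hx)
  rw [extTriv, AlgHom.toLinearMap_apply, ← AlgHom.comp_apply, ExteriorAlgebra.map_comp_map, h,
    ExteriorAlgebra.map_id, AlgHom.id_apply]

theorem extTriv_map_trivSymm {p x : C} (hx : x ∈ trivSet q E p)
    (v : ExteriorAlgebra ℂ (Fin q → ℂ)) :
    extTriv q E p x (ExteriorAlgebra.map (trivSymm q E p x) v) = v := by
  have h : triv q E p x ∘ₗ trivSymm q E p x = LinearMap.id :=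
    LinearMap.ext (triv_trivSymm hx)
  rw [extTriv, AlgHom.toLinearMap_apply, ← AlgHom.comp_apply, ExteriorAlgebra.map_comp_map, h,
    ExteriorAlgebra.map_id, AlgHom.id_apply]

variable [ContMDiffVectorBundle ω (Fin q → ℂ) E 𝓘(ℂ)]

theorem holAt_trivChange {p p' x : C} (hx : x ∈ trivSet q E p) (hx' : x ∈ trivSet q E p')
    (v : Fin q → ℂ) : HolAt (fun y => triv q E p' y (trivSymm q E p y v)) x := by
  have h := (contMDiffOn_coordChangeL (IB := 𝓘(ℂ)) (n := ω)
    (trivializationAt (Fin q → ℂ) E p) (trivializationAt (Fin q → ℂ) E p')).contMDiffAt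
    (((trivSet q E p).isOpen.inter (trivSet q E p').isOpen).mem_nhds ⟨hx, hx'⟩)
  have h2 : ContMDiffAt 𝓘(ℂ) 𝓘(ℂ, Fin q → ℂ) ω (fun y : C =>
      (trivializationAt (Fin q → ℂ) E p).coordChangeL ℂ (trivializationAt (Fin q → ℂ) E p') y v) x :=
    h.clm_apply contMDiffAt_const
  intro ℓ
  have h3 : ContMDiffAt 𝓘(ℂ) 𝓘(ℂ) ω (fun y : C => LinearMap.toContinuousLinearMap ℓ
      ((trivializationAt (Fin q → ℂ) E p).coordChangeL ℂ
        (trivializationAt (Fin q → ℂ) E p') y v)) x :=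
    (LinearMap.toContinuousLinearMap ℓ).contMDiff.contMDiffAt.comp x h2
  refine h3.congr_of_eventuallyEq ?_
  filter_upwards [(trivSet q E p).isOpen.mem_nhds hx, (trivSet q E p').isOpen.mem_nhds hx']
    with y hy hy'
  rw [LinearMap.coe_toContinuousLinearMap', Bundle.Trivialization.coe_coordChangeL _ _ ⟨hy, hy'⟩]
  congr 1
  rw [triv, trivSymm, Bundle.Trivialization.symmₗ_apply _ hy,
    Bundle.Trivialization.linearMapAt_apply]
  exact (if_pos hy').trans rfl

/-- Holomorphy of sections of `⋀ E` may be tested in any trivialisation. -/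
theorem isHolomorphicAt_extTriv_of_mem {p p' x₀ : C} {U : Opens C} (hU : x₀ ∈ U)
    (hp : x₀ ∈ trivSet q E p) (hp' : x₀ ∈ trivSet q E p')
    {s : ∀ x : U, ExteriorAlgebra ℂ (E x)} (h : IsHolomorphicAt (extTriv q E p) s x₀) :
    IsHolomorphicAt (extTriv q E p') s x₀ := by
  classical
  let f : C → ExteriorAlgebra ℂ (Fin q → ℂ) := fun x =>
    if h : x ∈ U then extTriv q E p x (s ⟨x, h⟩) else 0
  have hf : HolAt f x₀ := (isHolomorphicAt_iff hU fun x => by simp [f]).1 h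
  let f' : C → ExteriorAlgebra ℂ (Fin q → ℂ) := fun x =>
    if h : x ∈ U then extTriv q E p' x (s ⟨x, h⟩) else 0
  refine (isHolomorphicAt_iff (f := f') hU fun x => by simp [f']).2 ?_
  refine (HolAt.extMap (g := fun y => triv q E p' y ∘ₗ trivSymm q E p y)
    (holAt_trivChange hp hp') hf).congr ?_
  filter_upwards [(trivSet q E p).isOpen.mem_nhds hp, U.isOpen.mem_nhds hU] with y hy hyU
  have hyU' : y ∈ U := hyU
  simp only [f, f', hyU', dif_pos]
  rw [← ExteriorAlgebra.map_comp_map, AlgHom.comp_apply, map_trivSymm_extTriv hy]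
  rfl

variable (q E)

/-- The chart of `C` at `p`, restricted to the domain of the trivialisation of `E` at `p`. -/
def splitBase (p : C) : OpenPartialHomeomorph C ℂ := (chartAt ℂ p).restr (trivSet q E p)

theorem splitBase_source (p : C) :
    (splitBase q E p).source = (chartAt ℂ p).source ∩ trivSet q E p :=
  (chartAt ℂ p).restr_source' _ (trivSet q E p).isOpen

theorem mem_splitBase_source (p : C) : p ∈ (splitBase q E p).source := by
  rw [splitBase_source]
  exact ⟨mem_chart_source ℂ p, mem_trivSet q E p⟩

theorem splitBase_mem_maximalAtlas [IsManifold 𝓘(ℂ) ω C] (p : C) :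
    splitBase q E p ∈ IsManifold.maximalAtlas 𝓘(ℂ) ω C :=
  restr_mem_maximalAtlas _ (IsManifold.chart_mem_maximalAtlas p) (trivSet q E p).isOpen

variable {q E}

theorem mem_trivSet_of_mem {p x : C} (hx : x ∈ (splitBase q E p).source) : x ∈ trivSet q E p := by
  rw [splitBase_source] at hx
  exact hx.2

/-- Evaluation of sections of `⋀ E` at a point. -/
def extEvalHom {U : Opens C} (x : U) :
    (splitModel q E).sections U →ₐ[ℂ] ExteriorAlgebra ℂ (E x.1) :=
  (Pi.evalAlgHom ℂ (fun x : U => ExteriorAlgebra ℂ (E x.1)) x).comp (extSections q E U).val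

theorem splitModel_ext {U : Opens C} {s t : (splitModel q E).sections U}
    (h : ∀ x : U, extEval s x = extEval t x) : s = t := Subtype.ext (funext h)

/-- A section of the split model with given values. -/
def splitSection {B : Type*} [Ring B] [Algebra ℂ B] {U : Opens C}
    (φ : ∀ x : U, B →ₐ[ℂ] ExteriorAlgebra ℂ (E x.1))
    (h : ∀ b (x₀ : U), IsHolomorphicAt (extTriv q E x₀.1) (fun x => φ x b) x₀.1) :
    B →ₐ[ℂ] (splitModel q E).sections U :=
  AlgHom.codRestrict (AlgHom.pi φ) (extSections q E U) h

variable [IsManifold 𝓘(ℂ) ω C]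

theorem isHolomorphicAt_pull {p : C} {V : Opens ℂ} (F : (superAffine q).sections V)
    (x₀ : preimOpens (splitBase q E p) V) : IsHolomorphicAt (extTriv q E x₀.1)
      (fun x : preimOpens (splitBase q E p) V =>
        ExteriorAlgebra.map (trivSymm q E p x) (superAffine.ev F (splitBase q E p x))) x₀.1 := by
  refine isHolomorphicAt_extTriv_of_mem x₀.2 (mem_trivSet_of_mem x₀.2.1) (mem_trivSet q E _) ?_
  refine (isHolomorphicAt_iff (f := fun x => superAffine.ev F (splitBase q E p x)) x₀.2
    fun x => extTriv_map_trivSymm (mem_trivSet_of_mem x.2.1) _).2 ?_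
  exact (superAffine.holAt_ev x₀.2.2 F).comp
    (contMDiffAt_of_mem_maximalAtlas (splitBase_mem_maximalAtlas q E p) x₀.2.1)

/-- The pull-back of superfunctions along the chart of the split model at `p`. -/
def splitPullHom (p : C) (V : Opens ℂ) :
    (superAffine q).sections V →ₐ[ℂ] (splitModel q E).sections (preimOpens (splitBase q E p) V) :=
  splitSection (fun x => (ExteriorAlgebra.map (trivSymm q E p x)).comp (superAffine.evHom x.2.2))
    isHolomorphicAt_pull

theorem symm_mem_preimOpens {M N : Type*} [TopologicalSpace M] [TopologicalSpace N]
    {e : OpenPartialHomeomorph M N} {V : Opens N} (hV : (V : Set N) ⊆ e.target) {z : N}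
    (hz : z ∈ V) : e.symm z ∈ preimOpens e V :=
  ⟨e.map_target (hV hz), by
    change e (e.symm z) ∈ V
    rwa [e.right_inv (hV hz)]⟩

theorem isHolomorphicAt_push {p : C} {V : Opens ℂ} (hV : (V : Set ℂ) ⊆ (splitBase q E p).target)
    (s : (splitModel q E).sections (preimOpens (splitBase q E p) V)) (z₀ : V) :
    IsHolomorphicAt (extTriv q (Bundle.Trivial ℂ (Fin q → ℂ)) z₀.1)
      (fun z : V => ExteriorAlgebra.map (triv q E p ((splitBase q E p).symm z))
        (extEval s ⟨_, symm_mem_preimOpens hV z.2⟩)) z₀.1 := by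
  classical
  let f : C → ExteriorAlgebra ℂ (Fin q → ℂ) := fun x =>
    if h : x ∈ preimOpens (splitBase q E p) V then extTriv q E p x (extEval s ⟨x, h⟩) else 0
  have hz : (splitBase q E p).symm z₀ ∈ preimOpens (splitBase q E p) V := symm_mem_preimOpens hV z₀.2
  have hf : HolAt f ((splitBase q E p).symm z₀) := by
    have h := (show extSections q E (preimOpens (splitBase q E p) V) from s).2 ⟨(splitBase q E p).symm z₀, hz⟩
    exact (isHolomorphicAt_iff hz fun x => by simp [f, extEval]).1
      (isHolomorphicAt_extTriv_of_mem (p' := p) hz (mem_trivSet q E _) (mem_trivSet_of_mem hz.1) h)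
  refine (isHolomorphicAt_iff (f := fun z => f ((splitBase q E p).symm z)) z₀.2 fun z => ?_).2 (hf.comp
    (contMDiffAt_symm_of_mem_maximalAtlas (splitBase_mem_maximalAtlas q E p) (hV z₀.2)))
  rw [superAffine.extTriv_trivial]
  simp only [f, symm_mem_preimOpens hV z.2, dif_pos]
  rfl

/-- The expression of a section of the split model in the chart at `p`. -/
def splitPushHom (p : C) {V : Opens ℂ} (hV : (V : Set ℂ) ⊆ (splitBase q E p).target) :
    (splitModel q E).sections (preimOpens (splitBase q E p) V) →ₐ[ℂ] (superAffine q).sections V :=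
  splitSection (E := Bundle.Trivial ℂ (Fin q → ℂ))
    (fun z => (ExteriorAlgebra.map (triv q E p ((splitBase q E p).symm z))).comp
      (extEvalHom ⟨_, symm_mem_preimOpens hV z.2⟩))
    (isHolomorphicAt_push hV)

theorem ev_splitPushHom {p : C} {V : Opens ℂ} (hV : (V : Set ℂ) ⊆ (splitBase q E p).target)
    (s : (splitModel q E).sections (preimOpens (splitBase q E p) V)) {z : ℂ} (hz : z ∈ V) :
    superAffine.ev (splitPushHom p hV s) z =
      extTriv q E p _ (extEval s ⟨_, symm_mem_preimOpens hV hz⟩) := by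
  rw [superAffine.ev_of_mem hz]; rfl

theorem extEval_splitPullHom {p : C} {V : Opens ℂ} (F : (superAffine q).sections V)
    (x : preimOpens (splitBase q E p) V) : extEval (splitPullHom p V F) x =
      ExteriorAlgebra.map (trivSymm q E p x) (superAffine.ev F (splitBase q E p x)) := rfl

variable (q E)

/-- The chart of the split model at `p`. -/
def splitChart (p : C) : PartialIso (splitModel q E) (superAffine q) (splitBase q E p) where
  pull V hV := AlgEquiv.ofAlgHom (splitPullHom p V) (splitPushHom p hV)
    (by
      refine AlgHom.ext fun s => splitModel_ext fun x => ?_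
      rw [AlgHom.comp_apply, AlgHom.id_apply, extEval_splitPullHom, ev_splitPushHom hV _ x.2.2]
      have hx : (splitBase q E p).symm (splitBase q E p x) = x.1 :=
        (splitBase q E p).left_inv x.2.1
      -- The fibre depends on the point, so `e.symm (e x)` cannot be rewritten to `x` in place; the
      -- point is generalised and the values are compared heterogeneously.
      have key : ∀ (y : C) (hy : y ∈ preimOpens (splitBase q E p) V), y = x.1 →
          HEq (extTriv q E p y (extEval s ⟨y, hy⟩)) (extTriv q E p x.1 (extEval s x)) := by
        rintro y hy rfl
        rfl
      rw [eq_of_heq (key _ (symm_mem_preimOpens hV x.2.2) hx),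
        map_trivSymm_extTriv (mem_trivSet_of_mem x.2.1)])
    (by
      refine AlgHom.ext fun F => superAffine.ext fun z hz => ?_
      have hz' := symm_mem_preimOpens hV hz
      rw [AlgHom.comp_apply, AlgHom.id_apply, ev_splitPushHom hV _ hz, extEval_splitPullHom,
        extTriv_map_trivSymm (mem_trivSet_of_mem hz'.1), (splitBase q E p).right_inv (hV hz)])
  pull_res {V V'} hV hV' h s := splitModel_ext fun x => by
    change ExteriorAlgebra.map (trivSymm q E p x) (superAffine.ev _ (splitBase q E p x)) = _
    rw [superAffine.ev_res h x.2.2]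
    rfl
  pull_parity V hV s := splitModel_ext fun x => by
    change ExteriorAlgebra.map (trivSymm q E p x) (superAffine.ev _ (splitBase q E p x)) =
      ExteriorAlgebra.map (-LinearMap.id)
        (ExteriorAlgebra.map (trivSymm q E p x) (superAffine.ev s (splitBase q E p x)))
    rw [superAffine.ev_parity x.2.2, ← AlgHom.comp_apply, ← AlgHom.comp_apply,
      ExteriorAlgebra.map_comp_map, ExteriorAlgebra.map_comp_map]
    congr 2
    ext v
    simp
  body_pull V hV s x := by
    rw [superAffine.body_eq x.2.2]
    change ExteriorAlgebra.algebraMapInv (ExteriorAlgebra.map (trivSymm q E p x)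
      (superAffine.ev s (splitBase q E p x))) = _
    rw [← AlgHom.comp_apply]
    congr 1
    ext v
    simp [ExteriorAlgebra.algebraMapInv]

variable {q E}

theorem extEval_splitChart_pull {p : C} {V : Opens ℂ} (hV : (V : Set ℂ) ⊆ (splitBase q E p).target)
    (F : (superAffine q).sections V) (x : preimOpens (splitBase q E p) V) :
    extEval ((splitChart q E p).pull V hV F) x =
      ExteriorAlgebra.map (trivSymm q E p x) (superAffine.ev F (splitBase q E p x)) := rfl

end SplitChart

/-! ### Tangent vectors -/

section Tangent

variable {C : Type u} [TopologicalSpace C] [ChartedSpace ℂ C]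

/-- The differential of a function to `ℂ`. -/
def dFun (f : C → ℂ) (x : C) : TangentSpace 𝓘(ℂ) x →ₗ[ℂ] ℂ :=
  (mfderiv 𝓘(ℂ) 𝓘(ℂ) f x : TangentSpace 𝓘(ℂ) x →L[ℂ] ℂ).toLinearMap

variable {e e' : OpenPartialHomeomorph C ℂ} {x : C}

theorem contMDiffAt_base (he : e ∈ IsManifold.maximalAtlas 𝓘(ℂ) ω C) (hx : x ∈ e.source) :
    ContMDiffAt 𝓘(ℂ) 𝓘(ℂ) ω e x := contMDiffAt_of_mem_maximalAtlas he hx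

theorem holAt_transition (he : e ∈ IsManifold.maximalAtlas 𝓘(ℂ) ω C)
    (he' : e' ∈ IsManifold.maximalAtlas 𝓘(ℂ) ω C) (hx : x ∈ e.source) (hx' : x ∈ e'.source) :
    HolAt (fun z => e' (e.symm z)) (e x) := by
  refine HolAt.comp (f := e') (g := e.symm) (holAt_iff.2 ?_)
    (contMDiffAt_symm_of_mem_maximalAtlas he (e.map_source hx))
  rw [e.left_inv hx]
  exact contMDiffAt_base he' hx'

theorem dFun_eq (he : e ∈ IsManifold.maximalAtlas 𝓘(ℂ) ω C)
    (he' : e' ∈ IsManifold.maximalAtlas 𝓘(ℂ) ω C) (hx : x ∈ e.source) (hx' : x ∈ e'.source)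
    (v : TangentSpace 𝓘(ℂ) x) :
    dFun e' x v = deriv (fun z => e' (e.symm z)) (e x) * dFun e x v := by
  have h1 : (e' : C → ℂ) =ᶠ[nhds x] (fun z => e' (e.symm z)) ∘ e := by
    filter_upwards [e.open_source.mem_nhds hx] with y hy
    simp [e.left_inv hy]
  have hd : DifferentiableAt ℂ (fun z => e' (e.symm z)) (e x) :=
    (holAt_transition he he' hx hx').differentiableAt LinearMap.id
  have hm : MDifferentiableAt 𝓘(ℂ) 𝓘(ℂ) e x :=
    (contMDiffAt_base he hx).mdifferentiableAt (by simp)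
  have h2 := mfderiv_comp x hd.mdifferentiableAt hm
  have h3 : dFun e' x = dFun ((fun z => e' (e.symm z)) ∘ e) x := by
    rw [dFun, dFun, h1.mfderiv_eq]
  rw [h3, dFun, h2, mfderiv_eq_fderiv]
  change fderiv ℂ (fun z => e' (e.symm z)) (e x) (dFun e x v) = _
  rw [fderiv_eq_smul_deriv, smul_eq_mul, mul_comm]

theorem deriv_transition_mul (he : e ∈ IsManifold.maximalAtlas 𝓘(ℂ) ω C)
    (he' : e' ∈ IsManifold.maximalAtlas 𝓘(ℂ) ω C) (hx : x ∈ e.source) (hx' : x ∈ e'.source) :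
    deriv (fun z => e' (e.symm z)) (e x) * deriv (fun z => e (e'.symm z)) (e' x) = 1 := by
  have h1 : DifferentiableAt ℂ (fun z => e' (e.symm z)) (e x) :=
    (holAt_transition he he' hx hx').differentiableAt LinearMap.id
  have h2 : DifferentiableAt ℂ (fun z => e (e'.symm z)) (e' x) :=
    (holAt_transition he' he hx' hx).differentiableAt LinearMap.id
  have h3 : e (e'.symm (e' x)) = e x := by rw [e'.left_inv hx']
  have h4 := deriv_comp (e' x) (h₂ := fun z => e' (e.symm z)) (h := fun z => e (e'.symm z))
    (by rw [h3]; exact h1) h2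
  rw [h3] at h4
  rw [← h4]
  have h5 : (fun z => e' (e.symm z)) ∘ (fun z => e (e'.symm z)) =ᶠ[nhds (e' x)] id := by
    have hc : ContinuousAt e'.symm (e' x) := e'.symm.continuousAt (e'.map_source hx')
    have hs : ∀ᶠ z in nhds (e' x), e'.symm z ∈ e.source :=
      hc.eventually (by rw [e'.left_inv hx']; exact e.open_source.mem_nhds hx)
    filter_upwards [hs, e'.open_target.mem_nhds (e'.map_source hx')] with z hz hz'
    simp [e.left_inv hz, e'.right_inv hz']
  rw [h5.deriv_eq, deriv_id]

variable [IsManifold 𝓘(ℂ) ω C]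

theorem tangentTriv_eq {x₀ : C} (hx : x ∈ (chartAt ℂ x₀).source) (v : TangentSpace 𝓘(ℂ) x) :
    tangentTriv x₀ x v = dFun (chartAt ℂ x₀) x v := by
  have : IsManifold 𝓘(ℂ) 1 C := IsManifold.of_le (n := ω) le_top
  have h := TangentBundle.continuousLinearMapAt_trivializationAt (I := 𝓘(ℂ)) hx
  exact DFunLike.congr_fun h v

theorem dFun_inverse (he : e ∈ IsManifold.maximalAtlas 𝓘(ℂ) ω C) (hx : x ∈ e.source) (c : ℂ) :
    dFun e x ((mfderiv 𝓘(ℂ) 𝓘(ℂ) e x).inverse c) = c ∧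
      ∀ v, (mfderiv 𝓘(ℂ) 𝓘(ℂ) e x).inverse (dFun e x v) = v := by
  have : IsManifold 𝓘(ℂ) 1 C := IsManifold.of_le (n := ω) le_top
  have h1 : e ∈ IsManifold.maximalAtlas 𝓘(ℂ) 1 C :=
    IsManifold.maximalAtlas_subset_of_le (n := ω) le_top he
  have hmd : e.MDifferentiable 𝓘(ℂ) 𝓘(ℂ) :=
    ⟨fun y hy => (mdifferentiableAt_of_mem_maximalAtlas h1 hy).mdifferentiableWithinAt,
      fun y hy => (mdifferentiableAt_symm_of_mem_maximalAtlas h1 hy).mdifferentiableWithinAt⟩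
  have h2 : mfderiv 𝓘(ℂ) 𝓘(ℂ) e x = (hmd.mfderiv hx : _ →L[ℂ] _) := rfl
  constructor
  · rw [dFun, h2, ContinuousLinearMap.inverse_equiv]
    exact (hmd.mfderiv hx).apply_symm_apply c
  · intro v
    rw [dFun, h2, ContinuousLinearMap.inverse_equiv]
    exact (hmd.mfderiv hx).symm_apply_apply v

end Tangent

theorem HolAt.apply {M : Type*} [TopologicalSpace M] [ChartedSpace ℂ M] {q : ℕ} {W : Type*}
    [AddCommGroup W] [Module ℂ W] {x : M}
    {g : M → (Fin q → ℂ) →ₗ[ℂ] W} (hg : ∀ v, HolAt (fun y => g y v) x)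
    {f : M → Fin q → ℂ} (hf : HolAt f x) : HolAt (fun y => g y (f y)) x := by
  have h : HolAt (fun y => ∑ i, f y i • g y (Pi.single i 1)) x :=
    HolAt.sum fun i _ => (hf.map (LinearMap.proj i)).smul (hg _)
  refine h.congr (Filter.Eventually.of_forall fun y => ?_)
  change g y (f y) = _
  conv_lhs => rw [LinearMap.pi_apply_eq_sum_univ (g y) (f y)]
  refine Finset.sum_congr rfl fun i _ => ?_
  congr 2
  ext j
  simp [Pi.single_apply, eq_comm]

/-! ### Frames -/

namespace Supermanifold

variable {C : Type u} [TopologicalSpace C] [ChartedSpace ℂ C]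

section

variable {q : ℕ} {E : C → Type u}
    [∀ x, AddCommGroup (E x)] [∀ x, Module ℂ (E x)] [∀ x, TopologicalSpace (E x)]
    [TopologicalSpace (Bundle.TotalSpace (Fin q → ℂ) E)] [FiberBundle (Fin q → ℂ) E]
    [VectorBundle ℂ (Fin q → ℂ) E] [ContMDiffVectorBundle ω (Fin q → ℂ) E 𝓘(ℂ)]
    [IsManifold 𝓘(ℂ) ω C] (X : Supermanifold q E)

/-- Around each point there is a chart in which the symbol is computed by a trivialisation. -/
theorem exists_chart (x : C) : ∃ c : X.Chart, x ∈ c.domain ∧ ∃ p, c.domain ≤ trivSet q E p ∧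
    ∀ (U : Opens C) (s : X.sections U) (y : C) (hU : y ∈ U), y ∈ c.domain →
      X.symbol U s ⟨y, hU⟩ = trivSymm q E p y (ExteriorAlgebra.ιInv (c.fn s (c.base y))) := by
  obtain ⟨W, Φ, hxW, hΦ⟩ := X.locally_split x
  have hbase : (OpenPartialHomeomorph.ofSet (W : Set C) W.isOpen).trans (splitBase q E x) ∈
      IsManifold.maximalAtlas 𝓘(ℂ) ω C := by
    rw [OpenPartialHomeomorph.ofSet_trans]
    exact restr_mem_maximalAtlas _ (splitBase_mem_maximalAtlas q E x) W.isOpen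
  let c : X.Chart := ⟨_, hbase, Φ.trans (splitChart q E x)⟩
  have hmem : ∀ y, y ∈ c.domain ↔ y ∈ W ∧ y ∈ (splitBase q E x).source := fun y => by
    change y ∈ ((OpenPartialHomeomorph.ofSet (W : Set C) W.isOpen).trans
      (splitBase q E x)).source ↔ _
    rw [OpenPartialHomeomorph.trans_source]
    rfl
  refine ⟨c, (hmem x).2 ⟨hxW, mem_splitBase_source q E x⟩, x,
    fun y hy => mem_trivSet_of_mem ((hmem y).1 hy).2, fun U s y hU hy => ?_⟩
  set V := imageOpens c.base U
  have hV : (V : Set ℂ) ⊆ c.base.target := image_subset_target _ _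
  have hyV : c.base y ∈ V := mem_image c.base hU hy
  have hyp : y ∈ preimOpens c.base V := ⟨hy, hyV⟩
  have e1 : c.iso.pull V hV (c.express s) = X.res (preim_image_le c.base U) s :=
    AlgEquiv.apply_symm_apply _ _
  have e2 := congrFun (congrArg (X.symbol _) e1) ⟨y, hyp⟩
  rw [X.symbol_res] at e2
  rw [← e2]
  have e3 : c.iso.pull V hV (c.express s) = X.res (preimOpens_trans _ _ V).ge
      (Φ.pull (preimOpens (splitBase q E x) V) (preimOpens_subset_target hV)
        ((splitChart q E x).pull V (subset_target_of_trans hV) (c.express s))) := rfl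
  rw [e3, X.symbol_res]
  refine (hΦ (preimOpens (splitBase q E x) V) (preimOpens_subset_target hV) _ ⟨y, _⟩).trans ?_
  rw [extEval_splitChart_pull]
  exact LinearMap.congr_fun (ExteriorAlgebra.ιInv_comp_map _) _

end

namespace Chart

variable {E : C → Type u}
    [∀ x, AddCommGroup (E x)] [∀ x, Module ℂ (E x)] [∀ x, TopologicalSpace (E x)]
    [TopologicalSpace (Bundle.TotalSpace (Fin 3 → ℂ) E)] [FiberBundle (Fin 3 → ℂ) E]
    [VectorBundle ℂ (Fin 3 → ℂ) E] [ContMDiffVectorBundle ω (Fin 3 → ℂ) E 𝓘(ℂ)]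
    [IsManifold 𝓘(ℂ) ω C] {X : Supermanifold 3 E} (a b d : X.Chart) {x : C}

open scoped Classical in
/-- The frame of a chart, extended by zero. -/
def frm (y : C) : (Fin 3 → ℂ) →ₗ[ℂ] E y := if h : y ∈ a.domain then a.frame ⟨y, h⟩ else 0

omit [ContMDiffVectorBundle ω (Fin 3 → ℂ) E 𝓘(ℂ)] [IsManifold 𝓘(ℂ) ω C] in
theorem frm_eq (hx : x ∈ a.domain) : a.frm x = a.frame ⟨x, hx⟩ := dif_pos hx

omit [ContMDiffVectorBundle ω (Fin 3 → ℂ) E 𝓘(ℂ)] [IsManifold 𝓘(ℂ) ω C] in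
theorem frm_apply (hx : x ∈ a.domain) (v : Fin 3 → ℂ) :
    a.frm x v = X.symbol a.domain (a.oddLin v) ⟨x, hx⟩ := by
  rw [frm_eq a hx]; rfl

/-- The symbol of a section in terms of the frame of a chart. -/
theorem symbol_eq (hx : x ∈ a.domain) {U : Opens C} (hU : x ∈ U) (s : X.sections U) :
    X.symbol U s ⟨x, hU⟩ = a.frm x (ExteriorAlgebra.ιInv (a.fn s (a.base x))) := by
  -- In a chart adapted to a local splitting the symbol is explicit; both sides are compared there.
  obtain ⟨c, hc, p, -, hs⟩ := X.exists_chart x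
  rw [frm_apply a hx, hs _ _ _ _ hc, hs _ _ _ _ hc, ← lin_apply c a ⟨hc, hx⟩,
    c.ιInv_fn a ⟨hc, hx⟩ hU]

theorem frm_lin (hx : x ∈ a.domain ⊓ b.domain) (v : Fin 3 → ℂ) :
    a.frm x (a.lin b hx v) = b.frm x v := by
  rw [frm_apply b hx.2, a.symbol_eq hx.1, lin_apply]

/-- The frame of an adapted chart is an inverse trivialisation of `E`. Any other frame differs from
it by `lin`, which is invertible by `lin_comp`. -/
theorem frm_bijective (hx : x ∈ a.domain) : Function.Bijective (a.frm x) := by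
  obtain ⟨c, hc, p, hp, hs⟩ := X.exists_chart x
  have hcf : ∀ v, c.frm x v = trivSymm 3 E p x v := fun v => by
    rw [frm_apply c hc, hs _ _ _ _ hc, c.fn_oddLin (c.base.map_source hc),
      ExteriorAlgebra.ι_leftInverse]
  have hac : x ∈ a.domain ⊓ c.domain := ⟨hx, hc⟩
  have hca : x ∈ c.domain ⊓ a.domain := ⟨hc, hx⟩
  have haa : x ∈ a.domain ⊓ a.domain := ⟨hx, hx⟩
  have h1 : ∀ v, a.lin c hac (c.lin a hca v) = v := fun v => by
    have h := LinearMap.congr_fun ((a.lin_comp c a hac hca haa).trans (a.lin_self haa)) v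
    exact h
  constructor
  · intro v w hvw
    rw [← frm_lin c a hca, ← frm_lin c a hca, hcf, hcf] at hvw
    have h2 := congrArg (triv 3 E p x) hvw
    rw [triv_trivSymm (hp hc), triv_trivSymm (hp hc)] at h2
    rw [← h1 v, h2, h1]
  · intro w
    refine ⟨a.lin c hac (triv 3 E p x w), ?_⟩
    rw [frm_lin a c hac, hcf, trivSymm_triv (hp hc)]

open scoped Classical in
/-- The inverse of the frame of a chart. -/
def frmInv (y : C) : E y →ₗ[ℂ] (Fin 3 → ℂ) :=
  if h : y ∈ a.domain then
    ((LinearEquiv.ofBijective (a.frm y) (a.frm_bijective h)).symm : E y →ₗ[ℂ] (Fin 3 → ℂ))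
  else 0

theorem frm_frmInv (hx : x ∈ a.domain) (w : E x) : a.frm x (a.frmInv x w) = w := by
  rw [frmInv, dif_pos hx]
  exact (LinearEquiv.ofBijective (a.frm x) (a.frm_bijective hx)).apply_symm_apply w

theorem frmInv_frm (hx : x ∈ a.domain) (v : Fin 3 → ℂ) : a.frmInv x (a.frm x v) = v :=
  (a.frm_bijective hx).1 (a.frm_frmInv hx _)

theorem frmInv_frm' (hx : x ∈ a.domain ⊓ b.domain) (v : Fin 3 → ℂ) :
    a.frmInv x (b.frm x v) = a.lin b hx v := by
  rw [← a.frm_lin b hx, a.frmInv_frm hx.1]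

theorem holAt_fn_base {W : Opens C} (hx : x ∈ a.domain) (hW : x ∈ W) (s : X.sections W) :
    HolAt (fun y => a.fn s (a.base y)) x :=
  (a.holAt_fn (mem_image a.base hW hx) s).comp (contMDiffAt_base a.base_mem hx)

theorem holAt_lin [DecidablePred (· ∈ a.domain ⊓ b.domain)] (hx : x ∈ a.domain ⊓ b.domain)
    (v : Fin 3 → ℂ) :
    HolAt (fun y => if h : y ∈ a.domain ⊓ b.domain then a.lin b h v else 0) x := by
  refine ((a.holAt_fn_base hx.1 hx.2 (b.oddLin v)).map ExteriorAlgebra.ιInv).congr ?_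
  filter_upwards [(a.domain ⊓ b.domain).isOpen.mem_nhds hx] with y hy
  have hy' : y ∈ a.domain ⊓ b.domain := hy
  rw [dif_pos hy', lin_apply]

theorem holAt_frm (hx : x ∈ a.domain) {p : C} (hp : x ∈ trivSet 3 E p) (v : Fin 3 → ℂ) :
    HolAt (fun y => triv 3 E p y (a.frm y v)) x := by
  obtain ⟨c, hc, p', hp', hs⟩ := X.exists_chart x
  have h := HolAt.apply (g := fun y => triv 3 E p y ∘ₗ trivSymm 3 E p' y)
    (holAt_trivChange (hp' hc) hp)
    ((c.holAt_fn_base hc hx (a.oddLin v)).map ExteriorAlgebra.ιInv)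
  refine h.congr ?_
  filter_upwards [(a.domain ⊓ c.domain).isOpen.mem_nhds ⟨hx, hc⟩] with y hy
  rw [frm_apply a hy.1, hs _ _ _ _ hy.2]
  rfl

/-- Passing through an adapted chart turns the inverse frame into a `lin` composed with a change of
trivialisation, so no matrix has to be inverted holomorphically. -/
theorem holAt_frmInv (hx : x ∈ a.domain) {p : C} (hp : x ∈ trivSet 3 E p) (v : Fin 3 → ℂ) :
    HolAt (fun y => a.frmInv y (trivSymm 3 E p y v)) x := by
  classical
  obtain ⟨c, hc, p', hp', hs⟩ := X.exists_chart x
  have hcf : ∀ y (_ : y ∈ c.domain) (v : Fin 3 → ℂ), c.frm y v = trivSymm 3 E p' y v :=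
    fun y hy v => by
    rw [frm_apply c hy, hs _ _ _ _ hy, c.fn_oddLin (c.base.map_source hy),
      ExteriorAlgebra.ι_leftInverse]
  have h := HolAt.apply
    (g := fun y => if h : y ∈ a.domain ⊓ c.domain then a.lin c h else 0)
    (f := fun y => triv 3 E p' y (trivSymm 3 E p y v))
    (fun w => (a.holAt_lin c ⟨hx, hc⟩ w).congr (Filter.Eventually.of_forall fun y => by
      dsimp only
      split_ifs <;> rfl))
    (holAt_trivChange hp (hp' hc) v)
  refine h.congr ?_
  filter_upwards [(a.domain ⊓ c.domain).isOpen.mem_nhds ⟨hx, hc⟩] with y hy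
  have hy' : y ∈ a.domain ⊓ c.domain := hy
  rw [dif_pos hy', ← a.frmInv_frm' c hy', hcf y hy'.2, trivSymm_triv (hp' hy'.2)]

/-! ### Tangent vectors of charts -/

theorem dFun_partialDeriv (hx : x ∈ a.domain) : dFun a.base x (a.partialDeriv x) = 1 :=
  (dFun_inverse a.base_mem hx 1).1

theorem eq_smul_partialDeriv (hx : x ∈ a.domain) (v : TangentSpace 𝓘(ℂ) x) :
    v = dFun a.base x v • a.partialDeriv x := by
  have h := (mfderiv 𝓘(ℂ) 𝓘(ℂ) a.base x).inverse.map_smul (dFun a.base x v) (1 : ℂ)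
  refine ((dFun_inverse a.base_mem hx 1).2 v).symm.trans (Eq.trans ?_ h)
  exact congrArg _ (mul_one _).symm

/-- The derivative of the reduced transition map. -/
def jac (x : C) : ℂ := deriv (fun z => b.base (a.base.symm z)) (a.base x)

theorem partialDeriv_eq (hx : x ∈ a.domain ⊓ b.domain) :
    a.partialDeriv x = a.jac b x • b.partialDeriv x := by
  conv_lhs => rw [b.eq_smul_partialDeriv hx.2 (a.partialDeriv x),
    dFun_eq a.base_mem b.base_mem hx.1 hx.2, dFun_partialDeriv a hx.1, mul_one]
  rfl

theorem jac_ne_zero (hx : x ∈ a.domain ⊓ b.domain) : a.jac b x ≠ 0 :=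
  left_ne_zero_of_mul_eq_one (deriv_transition_mul a.base_mem b.base_mem hx.1 hx.2)

theorem cC_fn_even (hx : x ∈ a.domain ⊓ b.domain) :
    Gr.cC (a.fn b.even (a.base x)) = b.base x := by
  rw [a.cC_fn b hx hx.2, b.fn_even (b.base.map_source hx.2), Gr.cC_algebraMap]

theorem cC_fn_even' {z : ℂ} (hz : z ∈ imageOpens a.base (a.domain ⊓ b.domain)) :
    Gr.cC (a.fn b.even z) = b.base (a.base.symm z) := by
  have h := a.cC_fn_even b hz.2
  rwa [a.base.right_inv hz.1] at h

theorem deriv_cC_fn_even (hx : x ∈ a.domain ⊓ b.domain) :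
    deriv (fun w => Gr.cC (a.fn b.even w)) (a.base x) = a.jac b x := by
  refine Filter.EventuallyEq.deriv_eq ?_
  filter_upwards [(imageOpens a.base (a.domain ⊓ b.domain)).isOpen.mem_nhds
    (mem_image a.base hx hx.1)] with z hz
  exact a.cC_fn_even' b hz

/-- This is `deg2_fn` for the even coordinate of `d`: the cocycle identity before the frames of `E`
and `TC` are inserted. -/
theorem nil_comp (hx : x ∈ a.domain) (hx' : x ∈ b.domain) (hx'' : x ∈ d.domain) :
    a.nil d x = ExteriorAlgebra.map (a.lin b ⟨hx, hx'⟩) (b.nil d x) + b.jac d x • a.nil b x := by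
  have h := a.deg2_fn b ⟨hx, hx'⟩ hx'' d.even
  -- `nil` differs from the even coordinate by a constant, which does not affect degree two.
  have hd : ∀ (c : X.Chart), x ∈ c.domain → Gr.deg2 (c.fn d.even (c.base x)) = c.nil d x := by
    intro c hc
    rw [c.nil_eq d ⟨hc, hx''⟩, nil, sub_eq_add_neg, Gr.deg2_add, ← map_neg]
    simp [Gr.deg2, Gr.c01_algebraMap, Gr.c02_algebraMap, Gr.c12_algebraMap, Gr.mk]
  rwa [hd a hx, hd b hx', b.deriv_cC_fn_even d ⟨hx', hx''⟩] at h

end Chart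

end Supermanifold

/-! ### The obstruction cocycle -/

theorem exteriorPower_coe_map {M N : Type*} [AddCommGroup M] [Module ℂ M] [AddCommGroup N]
    [Module ℂ N] {n : ℕ} (g : M →ₗ[ℂ] N) (w : ⋀[ℂ]^n M) :
    (exteriorPower.map n g w : ExteriorAlgebra ℂ N) = ExteriorAlgebra.map g w := by
  have h : (⋀[ℂ]^n N).subtype ∘ₗ exteriorPower.map n g =
      (ExteriorAlgebra.map g).toLinearMap ∘ₗ (⋀[ℂ]^n M).subtype := by
    refine exteriorPower.linearMap_ext (AlternatingMap.ext fun m => ?_)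
    simp only [LinearMap.compAlternatingMap_apply, LinearMap.comp_apply, Submodule.subtype_apply,
      exteriorPower.map_apply_ιMulti, exteriorPower.ιMulti_apply_coe, AlgHom.toLinearMap_apply,
      ExteriorAlgebra.map_apply_ιMulti]
  exact LinearMap.congr_fun h w

namespace Gr

/-- The component of degree two. -/
def two : Gr →ₗ[ℂ] ⋀[ℂ]^2 (Fin 3 → ℂ) :=
  DirectSum.component ℂ ℕ (fun i : ℕ => ⋀[ℂ]^i (Fin 3 → ℂ)) 2 ∘ₗ
    (DirectSum.decomposeLinearEquiv (fun i : ℕ => ⋀[ℂ]^i (Fin 3 → ℂ))).toLinearMap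

theorem two_apply (l : Gr) :
    two l = DirectSum.decompose (fun i : ℕ => ⋀[ℂ]^i (Fin 3 → ℂ)) l 2 := rfl

theorem coe_two (l : Gr) : (two l : Gr) = deg2 l := coe_decompose_two l

theorem two_coe (w : ⋀[ℂ]^2 (Fin 3 → ℂ)) : two (w : Gr) = w :=
  Subtype.ext (DirectSum.decompose_of_mem_same (fun i : ℕ => ⋀[ℂ]^i (Fin 3 → ℂ)) w.2)

theorem deg2_coe (w : ⋀[ℂ]^2 (Fin 3 → ℂ)) : deg2 (w : Gr) = w := by rw [← coe_two, two_coe]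

theorem two_map (g : (Fin 3 → ℂ) →ₗ[ℂ] (Fin 3 → ℂ)) (l : Gr) :
    two (ExteriorAlgebra.map g l) = exteriorPower.map 2 g (two l) :=
  Subtype.ext (by rw [exteriorPower_coe_map, coe_two, coe_two, deg2_map])

theorem deg2_algebraMap (k : ℂ) : deg2 (algebraMap ℂ Gr k) = 0 := by
  rw [deg2, c01_algebraMap, c02_algebraMap, c12_algebraMap]
  simp [mk]

theorem two_eq_of_deg2 {l l' : Gr} (h : deg2 l = deg2 l') : two l = two l' :=
  Subtype.ext (by rw [coe_two, coe_two, h])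

end Gr

namespace Supermanifold.Chart

variable {C : Type u} [TopologicalSpace C] [ChartedSpace ℂ C] {E : C → Type u}
    [∀ x, AddCommGroup (E x)] [∀ x, Module ℂ (E x)] [∀ x, TopologicalSpace (E x)]
    [TopologicalSpace (Bundle.TotalSpace (Fin 3 → ℂ) E)] [FiberBundle (Fin 3 → ℂ) E]
    [VectorBundle ℂ (Fin 3 → ℂ) E] [ContMDiffVectorBundle ω (Fin 3 → ℂ) E 𝓘(ℂ)]
    [IsManifold 𝓘(ℂ) ω C] {X : Supermanifold 3 E} (a b d : X.Chart) {x : C}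

/-- The element of `⋀² E ⊗ TC` with given components in the frame of a chart. -/
def frame2 (x : C) (l : Gr) (v : TangentSpace 𝓘(ℂ) x) :
    (⋀[ℂ]^2 (E x)) ⊗[ℂ] (TangentSpace 𝓘(ℂ) x) :=
  exteriorPower.map 2 (a.frm x) (Gr.two l) ⊗ₜ[ℂ] v

/-- The obstruction cocycle, extended by zero. -/
def obs (x : C) : (⋀[ℂ]^2 (E x)) ⊗[ℂ] (TangentSpace 𝓘(ℂ) x) :=
  a.frame2 x (a.nil b x) (b.partialDeriv x)

theorem obstruction_eq (x : (a.domain ⊓ b.domain : Opens C)) :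
    a.obstruction b x = a.obs b x := by
  have hz := mem_image a.base x.2 x.2.1
  have h : superAffine.eval (a.evenTransition b) ⟨a.base x.1, hz⟩ = a.fn b.even (a.base x) := by
    rw [← superAffine.ev_of_mem hz]
    exact a.fn_res inf_le_right hz b.even
  rw [obstruction, obs, frame2, h, frm_eq a x.2.1, ← Gr.two_apply]
  congr 2
  refine Gr.two_eq_of_deg2 ?_
  rw [nil, sub_eq_add_neg, ← map_neg, Gr.deg2_add, Gr.deg2_algebraMap, add_zero]

/-- In `nil_comp` the frames of `E` absorb the matrix `lin`, and the Jacobian turns the vector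
`∂/∂y` of `d` into that of `b`. -/
theorem obs_add (hx : x ∈ a.domain) (hx' : x ∈ b.domain) (hx'' : x ∈ d.domain) :
    a.obs d x = a.obs b x + b.obs d x := by
  have hab : x ∈ a.domain ⊓ b.domain := ⟨hx, hx'⟩
  have h1 : ∀ w, exteriorPower.map 2 (a.frm x) (exteriorPower.map 2 (a.lin b hab) w) =
      exteriorPower.map 2 (b.frm x) w := fun w => by
    have e : a.frm x ∘ₗ a.lin b hab = b.frm x := LinearMap.ext fun v => a.frm_lin b hab v
    refine (LinearMap.congr_fun (exteriorPower.map_comp _ _) w).symm.trans ?_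
    rw [e]
  have h2 : Gr.two (a.nil d x) = exteriorPower.map 2 (a.lin b hab) (Gr.two (b.nil d x)) +
      b.jac d x • Gr.two (a.nil b x) := by
    rw [a.nil_comp b d hx hx' hx'', map_add, map_smul, Gr.two_map]
  rw [obs, frame2, h2, map_add, map_smul, h1, TensorProduct.add_tmul, add_comm, obs, obs, frame2,
    frame2, b.partialDeriv_eq d ⟨hx', hx''⟩, TensorProduct.tmul_smul, TensorProduct.smul_tmul']

/-- The coefficients of an element of `⋀² E ⊗ TC` in the frame of a chart. -/
def cof (x : C) : (⋀[ℂ]^2 (E x)) ⊗[ℂ] (TangentSpace 𝓘(ℂ) x) →ₗ[ℂ] Gr :=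
  (⋀[ℂ]^2 (Fin 3 → ℂ)).subtype ∘ₗ (TensorProduct.rid ℂ _).toLinearMap ∘ₗ
    TensorProduct.map (exteriorPower.map 2 (a.frmInv x)) (dFun a.base x)

theorem cof_tmul (w : ⋀[ℂ]^2 (E x)) (v : TangentSpace 𝓘(ℂ) x) :
    a.cof x (w ⊗ₜ v) = dFun a.base x v • ExteriorAlgebra.map (a.frmInv x) (w : ExteriorAlgebra ℂ (E x)) := by
  rw [← exteriorPower_coe_map]
  rfl

theorem cof_frame2 (hx : x ∈ a.domain ⊓ b.domain) (l : Gr) (v : TangentSpace 𝓘(ℂ) x) :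
    a.cof x (b.frame2 x l v) =
      dFun a.base x v • ExteriorAlgebra.map (a.lin b hx) (Gr.deg2 l) := by
  rw [frame2, cof_tmul, exteriorPower_coe_map, Gr.coe_two]
  congr 1
  rw [← AlgHom.comp_apply, ExteriorAlgebra.map_comp_map]
  congr 2
  exact LinearMap.ext fun w => a.frmInv_frm' b hx w

theorem deg2_cof (t : (⋀[ℂ]^2 (E x)) ⊗[ℂ] (TangentSpace 𝓘(ℂ) x)) :
    Gr.deg2 (a.cof x t) = a.cof x t := Gr.deg2_coe _

theorem frame2_cof (hx : x ∈ a.domain) (t : (⋀[ℂ]^2 (E x)) ⊗[ℂ] (TangentSpace 𝓘(ℂ) x)) :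
    a.frame2 x (a.cof x t) (a.partialDeriv x) = t := by
  induction t using TensorProduct.induction_on with
  | zero => rw [map_zero, frame2, map_zero, map_zero, TensorProduct.zero_tmul]
  | add t t' h h' =>
    rw [frame2] at h h' ⊢
    rw [map_add, map_add, map_add, TensorProduct.add_tmul, h, h']
  | tmul w v =>
    have h1 : ∀ w, exteriorPower.map 2 (a.frm x) (exteriorPower.map 2 (a.frmInv x) w) = w :=
      fun w => by
      have e : a.frm x ∘ₗ a.frmInv x = LinearMap.id := LinearMap.ext fun v => a.frm_frmInv hx v
      refine (LinearMap.congr_fun (exteriorPower.map_comp _ _) w).symm.trans ?_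
      rw [e, exteriorPower.map_id, LinearMap.id_apply]
    rw [frame2, cof_tmul, map_smul, map_smul, TensorProduct.smul_tmul,
      ← a.eq_smul_partialDeriv hx v, ← exteriorPower_coe_map, Gr.two_coe, h1]

/-- The transformation of the coefficients of a coboundary. -/
theorem nil_eq_of_obs_eq (hx : x ∈ a.domain ⊓ b.domain)
    {s t : (⋀[ℂ]^2 (E x)) ⊗[ℂ] (TangentSpace 𝓘(ℂ) x)} (h : a.obs b x = t - s) :
    a.nil b x = ExteriorAlgebra.map (a.lin b hx) (b.cof x t) - a.jac b x • a.cof x s := by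
  have haa : x ∈ a.domain ⊓ a.domain := ⟨hx.1, hx.1⟩
  have h1 : a.jac b x * dFun a.base x (b.partialDeriv x) = 1 := by
    have h := congrArg (dFun a.base x) (a.partialDeriv_eq b hx)
    rw [map_smul, a.dFun_partialDeriv hx.1] at h
    exact h.symm
  have h2 := congrArg (a.cof x) h
  have h3 : a.cof x t = dFun a.base x (b.partialDeriv x) •
      ExteriorAlgebra.map (a.lin b hx) (b.cof x t) := by
    conv_lhs => rw [← b.frame2_cof hx.2 t, a.cof_frame2 b hx, b.deg2_cof]
  rw [map_sub, h3, obs, a.cof_frame2 a haa, ← a.nil_eq b hx, a.lin_self haa,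
    ExteriorAlgebra.map_id, AlgHom.id_apply] at h2
  -- `cof` uses the tangent vector of `a`, whereas `obs` is written with that of `b`; the Jacobian
  -- converts one into the other.
  have h4 := congrArg (a.jac b x • ·) h2
  simp only [smul_sub, smul_smul, h1, one_smul] at h4
  exact h4

/-! ### Holomorphy of the obstruction cocycle -/

theorem holAt_tangentTriv_partialDeriv (hx : x ∈ b.domain) :
    HolAt (fun y => tangentTriv x y (b.partialDeriv y)) x := by
  have h1 : HolAt (fun z => chartAt ℂ x (b.base.symm z)) (b.base x) :=
    holAt_transition b.base_mem (IsManifold.chart_mem_maximalAtlas x) hx (mem_chart_source ℂ x)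
  have h2 : HolAt (deriv fun z => chartAt ℂ x (b.base.symm z)) (b.base x) :=
    holAt_iff_analyticAt.2 (holAt_iff_analyticAt.1 h1).deriv
  refine (h2.comp (contMDiffAt_base b.base_mem hx)).congr ?_
  filter_upwards [b.domain.isOpen.mem_nhds hx,
    (chartAt ℂ x).open_source.mem_nhds (mem_chart_source ℂ x)] with y hy hy'
  rw [tangentTriv_eq hy', dFun_eq b.base_mem (IsManifold.chart_mem_maximalAtlas x) hy hy',
    b.dFun_partialDeriv hy, mul_one]

theorem holAt_nil (hx : x ∈ a.domain ⊓ b.domain) : HolAt (a.nil b) x :=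
  (a.holAt_fn_base hx.1 hx.2 b.even).sub
    ((holAt_iff.2 (contMDiffAt_base b.base_mem hx.2)).map (Algebra.linearMap ℂ Gr))

theorem holAt_obs (hx : x ∈ a.domain ⊓ b.domain) :
    HolAt (fun y => obstructionTriv 3 E x y (a.obs b y)) x := by
  have h1 : HolAt (fun y => ExteriorAlgebra.map (triv 3 E x y ∘ₗ a.frm y) (a.nil b y)) x :=
    HolAt.extMap (g := fun y => triv 3 E x y ∘ₗ a.frm y)
      (fun v => a.holAt_frm hx.1 (mem_trivSet 3 E x) v) (a.holAt_nil b hx)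
  have h2 := (h1.map Gr.two).map (W' := (⋀[ℂ]^2 (Fin 3 → ℂ)) ⊗[ℂ] ℂ)
    ((TensorProduct.mk ℂ (⋀[ℂ]^2 (Fin 3 → ℂ)) ℂ).flip 1)
  refine ((b.holAt_tangentTriv_partialDeriv hx.2).smul h2).congr
    (Filter.Eventually.of_forall fun y => ?_)
  change exteriorPower.map 2 (triv 3 E x y) (exteriorPower.map 2 (a.frm y) (Gr.two (a.nil b y))) ⊗ₜ
    tangentTriv x y (b.partialDeriv y) = tangentTriv x y (b.partialDeriv y) •
      (Gr.two (ExteriorAlgebra.map (triv 3 E x y ∘ₗ a.frm y) (a.nil b y)) ⊗ₜ[ℂ] (1 : ℂ))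
  rw [Gr.two_map, ← TensorProduct.tmul_smul, smul_eq_mul, mul_one]
  exact congrArg (· ⊗ₜ[ℂ] _) (LinearMap.congr_fun (exteriorPower.map_comp _ _) _).symm

theorem obs_mem_sec {U : Opens C} (hU : U ≤ a.domain ⊓ b.domain) :
    (fun y : U => a.obs b y) ∈ (obstructionSheaf 3 E).sec U := fun x₀ =>
  (isHolomorphicAt_iff (f := fun y => obstructionTriv 3 E x₀ y (a.obs b y)) x₀.2 fun _ => rfl).2
    (a.holAt_obs b (hU x₀.2))

open scoped Classical in
/-- The coefficients of sections of `⋀² E ⊗ TC` are holomorphic. -/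
theorem holAt_cof {U : Opens C} {σ : ∀ x : U, (⋀[ℂ]^2 (E x.1)) ⊗[ℂ] (TangentSpace 𝓘(ℂ) x.1)}
    (hσ : σ ∈ (obstructionSheaf 3 E).sec U) (hxU : x ∈ U) (hx : x ∈ a.domain) :
    HolAt (fun y => if h : y ∈ U then a.cof y (σ ⟨y, h⟩) else 0) x := by
  set f : C → (⋀[ℂ]^2 (Fin 3 → ℂ)) ⊗[ℂ] ℂ :=
    fun y => if h : y ∈ U then obstructionTriv 3 E x y (σ ⟨y, h⟩) else 0 with hf
  have h0 : HolAt f x := by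
    refine (isHolomorphicAt_iff (G := fun x : C => (⋀[ℂ]^2 (E x)) ⊗[ℂ] (TangentSpace 𝓘(ℂ) x))
      (τ := obstructionTriv 3 E x) (s := σ) hxU fun y => ?_).1 (hσ ⟨x, hxU⟩)
    rw [hf]
    simp only [y.2, dif_pos]
  have h1 : HolAt (deriv fun z => a.base ((chartAt ℂ x).symm z)) (chartAt ℂ x x) :=
    holAt_iff_analyticAt.2 (holAt_iff_analyticAt.1
      (holAt_transition (IsManifold.chart_mem_maximalAtlas x) a.base_mem (mem_chart_source ℂ x)
        hx)).deriv
  have h2 := h1.comp (contMDiffAt_base (IsManifold.chart_mem_maximalAtlas x) (mem_chart_source ℂ x))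
  have h3 := HolAt.extMap (g := fun y => a.frmInv y ∘ₗ trivSymm 3 E x y)
      (fun v => a.holAt_frmInv hx (mem_trivSet 3 E x) v)
      ((h0.map (TensorProduct.rid ℂ _).toLinearMap).map (⋀[ℂ]^2 (Fin 3 → ℂ)).subtype)
  refine (h2.smul h3).congr ?_
  filter_upwards [U.isOpen.mem_nhds hxU, a.domain.isOpen.mem_nhds hx,
    (trivSet 3 E x).isOpen.mem_nhds (mem_trivSet 3 E x),
    (chartAt ℂ x).open_source.mem_nhds (mem_chart_source ℂ x)] with y hyU hy hyE hyc
  have hyU' : y ∈ U := hyU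
  simp only [hf, hyU', dif_pos]
  generalize σ ⟨y, hyU'⟩ = t
  induction t using TensorProduct.induction_on with
  | zero => simp only [map_zero, smul_zero]
  | add t t' h h' => simp only [map_add, smul_add, h, h']
  | tmul w v =>
    rw [cof_tmul, dFun_eq (IsManifold.chart_mem_maximalAtlas x) a.base_mem hyc hy, obstructionTriv,
      TensorProduct.map_tmul, tangentTriv_eq hyc, mul_smul]
    congr 1
    change _ = ExteriorAlgebra.map (a.frmInv y ∘ₗ trivSymm 3 E x y)
      ((dFun (chartAt ℂ x) y v • exteriorPower.map 2 (triv 3 E x y) w :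
        ⋀[ℂ]^2 (Fin 3 → ℂ)) : Gr)
    rw [Submodule.coe_smul, map_smul, exteriorPower_coe_map, ← ExteriorAlgebra.map_comp_map,
      AlgHom.comp_apply]
    congr 2
    exact (map_trivSymm_extTriv hyE _).symm

end Supermanifold.Chart

/-! ### The obstruction class -/

section Cech

variable {M : Type u} [TopologicalSpace M] {G : M → Type v} [∀ x, AddCommGroup (G x)]
  [∀ x, Module ℂ (G x)] (F : SectionPresheaf G)

theorem SectionPresheaf.classOf_refineCocycle {𝔘 𝔙 : Cover M} (h : 𝔘 ≤ 𝔙) (c : F.cocycles 𝔘) :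
    F.classOf (F.refineCocycle h c) = F.classOf c := by
  classical
  exact Module.DirectLimit.of_f (R := ℂ) (G := F.coverH1) (f := F.refine) (hij := h)
    (x := Submodule.Quotient.mk c)

/-- Cocycles that are cohomologous on a common refinement have the same class. -/
theorem SectionPresheaf.classOf_eq {𝔘 𝔙 𝔚 : Cover M} (h : 𝔘 ≤ 𝔚) (h' : 𝔙 ≤ 𝔚) (c : F.cocycles 𝔘)
    (c' : F.cocycles 𝔙) (hc : F.refineCocycle h c - F.refineCocycle h' c' ∈ F.coboundaries 𝔚) :
    F.classOf c = F.classOf c' := by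
  rw [← F.classOf_refineCocycle h, ← F.classOf_refineCocycle h', classOf, classOf,
    (Submodule.Quotient.eq _).2 hc]

/-- An element of a direct limit that vanishes already vanishes at some stage. The refinement is
needed because an arbitrary atlas does not have to compute the cohomology. -/
theorem SectionPresheaf.exists_of_classOf_eq_zero {𝔘 : Cover M} (c : F.cocycles 𝔘)
    (hc : F.classOf c = 0) : ∃ (𝔙 : Cover M) (h : 𝔘 ≤ 𝔙),
      F.refineCocycle h c ∈ F.coboundaries 𝔙 := by
  classical
  obtain ⟨𝔙, h, h0⟩ := Module.DirectLimit.of.zero_exact hc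
  exact ⟨𝔙, h, (Submodule.Quotient.mk_eq_zero _).1 h0⟩

end Cech

namespace Supermanifold

variable {C : Type u} [TopologicalSpace C] [ChartedSpace ℂ C] {E : C → Type u}
    [∀ x, AddCommGroup (E x)] [∀ x, Module ℂ (E x)] [∀ x, TopologicalSpace (E x)]
    [TopologicalSpace (Bundle.TotalSpace (Fin 3 → ℂ) E)] [FiberBundle (Fin 3 → ℂ) E]
    [VectorBundle ℂ (Fin 3 → ℂ) E] [ContMDiffVectorBundle ω (Fin 3 → ℂ) E 𝓘(ℂ)]
    [IsManifold 𝓘(ℂ) ω C] {X : Supermanifold 3 E}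

/-- The obstruction cocycle of an atlas. -/
def Atlas.cocycle (𝔄 : X.Atlas) : (obstructionSheaf 3 E).cocycles 𝔄.cover :=
  ⟨fun a b x => (𝔄.chart a).obs (𝔄.chart b) x, fun _ _ => (𝔄.chart _).obs_mem_sec _ le_rfl,
    fun a b d _ ha hb hd => (𝔄.chart a).obs_add (𝔄.chart b) (𝔄.chart d) ha hb hd⟩

/-- On the common refinement the obstruction from a chart of `𝔅` to the chart of `𝔄` with the same
label is a `0`-cochain. By `obs_add` for mixed triples of charts, its coboundary is the difference
of the two cocycles. -/
theorem Atlas.classOf_cocycle (𝔄 𝔅 : X.Atlas) :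
    (obstructionSheaf 3 E).classOf 𝔄.cocycle = (obstructionSheaf 3 E).classOf 𝔅.cocycle := by
  let 𝔚 : Cover C := ⟨fun x => 𝔄.cover.set x ⊓ 𝔅.cover.set x,
    fun x => ⟨𝔄.cover.mem x, 𝔅.cover.mem x⟩⟩
  refine (obstructionSheaf 3 E).classOf_eq (𝔚 := 𝔚) (fun x => inf_le_left) (fun x => inf_le_right)
    _ _ ⟨fun a x => (𝔅.chart a).obs (𝔄.chart a) x, fun a => ?_, fun a b x ha hb => ?_⟩
  · exact (𝔅.chart a).obs_mem_sec (𝔄.chart a) (le_of_eq (inf_comm _ _))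
  · have h1 := (𝔅.chart a).obs_add (𝔅.chart b) (𝔄.chart b) ha.2 hb.2 hb.1
    have h2 := (𝔅.chart a).obs_add (𝔄.chart a) (𝔄.chart b) ha.2 ha.1 hb.1
    change (𝔄.chart a).obs (𝔄.chart b) x - (𝔅.chart a).obs (𝔅.chart b) x =
      (𝔅.chart b).obs (𝔄.chart b) x - (𝔅.chart a).obs (𝔄.chart a) x
    rw [sub_eq_sub_iff_add_eq_add, add_comm, ← h2, h1, add_comm]

theorem isPrimaryObstructionClass (𝔄 : X.Atlas) :
    X.IsPrimaryObstructionClass ((obstructionSheaf 3 E).classOf 𝔄.cocycle) := fun 𝔅 =>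
  ⟨𝔅.cocycle, fun _ _ x => ((𝔅.chart _).obstruction_eq (𝔅.chart _) x).symm, 𝔄.classOf_cocycle 𝔅⟩

end Supermanifold

/-! ### The obstruction class of a split supermanifold -/

namespace Supermanifold

variable {C : Type u} [TopologicalSpace C] [ChartedSpace ℂ C] {q : ℕ} {E : C → Type u}
    [∀ x, AddCommGroup (E x)] [∀ x, Module ℂ (E x)] [∀ x, TopologicalSpace (E x)]
    [TopologicalSpace (Bundle.TotalSpace (Fin q → ℂ) E)] [FiberBundle (Fin q → ℂ) E]
    [VectorBundle ℂ (Fin q → ℂ) E] [ContMDiffVectorBundle ω (Fin q → ℂ) E 𝓘(ℂ)]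
    [IsManifold 𝓘(ℂ) ω C] (X : Supermanifold q E)

/-- The values of sections are holomorphic. -/
theorem contMDiffAt_body {W : Opens C} (s : X.sections W) {f : C → ℂ}
    (hf : ∀ x : W, X.body W s x = f x) {x : C} (hx : x ∈ W) : ContMDiffAt 𝓘(ℂ) 𝓘(ℂ) ω f x := by
  obtain ⟨c, hc, -⟩ := X.exists_chart x
  have h : HolAt (fun y => ExteriorAlgebra.algebraMapInv.toLinearMap (c.fn s (c.base y))) x :=
    ((c.holAt_fn (mem_image c.base hx hc) s).comp (contMDiffAt_base c.base_mem hc)).map _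
  refine (holAt_iff.1 h).congr_of_eventuallyEq ?_
  filter_upwards [W.isOpen.mem_nhds hx, c.domain.isOpen.mem_nhds hc] with y hy hyc
  refine (hf ⟨y, hy⟩).symm.trans (Eq.trans ?_ (c.body_fn (mem_image c.base hy hyc) s).symm)
  exact congrArg _ (Subtype.ext (c.base.left_inv hyc).symm)

/-- The reduced map of an isomorphism with a domain in `ℂ^{1|q}` is a holomorphic chart. -/
theorem mem_maximalAtlas_of_partialIso {e : OpenPartialHomeomorph C ℂ}
    (Φ : PartialIso X.toSuperSpace (superAffine q) e) : e ∈ IsManifold.maximalAtlas 𝓘(ℂ) ω C := by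
  let T : Opens ℂ := ⟨e.target, e.open_target⟩
  refine e.mem_maximalAtlas_of_contMDiffOn (fun x hx => ?_) fun z hz => ?_
  -- `e` is the body of the pulled-back even coordinate, and bodies of sections are holomorphic.
  · refine (X.contMDiffAt_body (Φ.pull T subset_rfl (superAffine.evenCoord T)) (f := e)
      (fun y => ?_) (x := x) ⟨hx, e.map_source hx⟩).contMDiffWithinAt
    rw [Φ.body_pull, superAffine.body_eq y.2.2, superAffine.ev_evenCoord y.2.2]
    exact ExteriorAlgebra.algebraMap_leftInverse _ _
  · have hx := e.map_target hz
    obtain ⟨c, hc, -⟩ := X.exists_chart (e.symm z)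
    have hxc : e.symm z ∈ c.base.source := hc
    set V := imageOpens e c.domain
    have hV : (V : Set ℂ) ⊆ e.target := image_subset_target _ _
    have hzV : z ∈ V := ⟨hz, hc⟩
    -- For the inverse of `e`, the even coordinate of a chart `c` is transported to `ℂ`; its body is
    -- `c.base ∘ e.symm`.
    set F := (Φ.pull V hV).symm (X.res (preim_image_le e c.domain) c.even) with hF
    have h1 : ContMDiffAt 𝓘(ℂ) 𝓘(ℂ) ω (fun w => c.base (e.symm w)) z := by
      refine (holAt_iff.1 ((superAffine.holAt_ev hzV F).map
        ExteriorAlgebra.algebraMapInv.toLinearMap)).congr_of_eventuallyEq ?_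
      filter_upwards [V.isOpen.mem_nhds hzV] with w hw
      have hw' := symm_mem_preimOpens hV hw
      have h2 := Φ.body_pull V hV F ⟨_, hw'⟩
      rw [hF, AlgEquiv.apply_symm_apply, X.body_res, c.body_even, ← hF] at h2
      refine h2.trans (Eq.trans ?_ (superAffine.body_eq hw F))
      exact congrArg _ (Subtype.ext (e.right_inv (hV hw)))
    have h3 : ContMDiffAt 𝓘(ℂ) 𝓘(ℂ) ω (fun w => c.base.symm (c.base (e.symm w))) z :=
      (contMDiffAt_symm_of_mem_maximalAtlas c.base_mem (c.base.map_source hxc)).comp z h1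
    refine (h3.congr_of_eventuallyEq ?_).contMDiffWithinAt
    filter_upwards [V.isOpen.mem_nhds hzV] with w hw
    exact (c.base.left_inv hw.2).symm

variable {X}

/-- The charts of a supermanifold induced by an isomorphism with the split model. -/
def splitAtlasChart {φ : C ≃ₜ C}
    (Φ : PartialIso X.toSuperSpace (splitModel q E) φ.toOpenPartialHomeomorph) (x : C) : X.Chart :=
  ⟨_, X.mem_maximalAtlas_of_partialIso (Φ.trans (splitChart q E (φ x))),
    Φ.trans (splitChart q E (φ x))⟩

variable {φ : C ≃ₜ C} (Φ : PartialIso X.toSuperSpace (splitModel q E) φ.toOpenPartialHomeomorph)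

theorem mem_splitAtlasChart_domain {x y : C} :
    y ∈ (splitAtlasChart Φ x).domain ↔ φ y ∈ (splitBase q E (φ x)).source := by
  change y ∈ (φ.toOpenPartialHomeomorph.trans (splitBase q E (φ x))).source ↔ _
  rw [OpenPartialHomeomorph.trans_source]
  exact ⟨fun h => h.2, fun h => ⟨trivial, h⟩⟩

/-- The charts of the split model have no obstruction. -/
theorem nil_splitAtlasChart {x x' y : C} (hy : y ∈ (splitAtlasChart Φ x).domain)
    (hy' : y ∈ (splitAtlasChart Φ x').domain) :
    (splitAtlasChart Φ x).nil (splitAtlasChart Φ x') y = 0 := by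
  set a := splitAtlasChart Φ x with ha
  set b := splitAtlasChart Φ x' with hb
  have hab : y ∈ a.domain ⊓ b.domain := ⟨hy, hy'⟩
  set V := imageOpens a.base (a.domain ⊓ b.domain)
  have hV : (V : Set ℂ) ⊆ a.base.target := image_subset_target _ _
  have hyV : a.base y ∈ V := mem_image a.base hab hy
  have hhol : ∀ z ∈ V, HolAt (fun z => b.base (a.base.symm z)) z := fun z hz => by
    have h := holAt_transition a.base_mem b.base_mem (a.base.map_target hz.1) hz.2.2
    rwa [a.base.right_inv hz.1] at h
  -- `F` is the reduced transition map, regarded as a superfunction without odd coordinates. The aim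
  -- is that its pull-back along `a` is the whole even coordinate of `b`.
  set F := superAffine.scalar (q := q) V _ hhol
  let P : Opens C := preimOpens (splitBase q E (φ x)) V ⊓
    ⟨(splitBase q E (φ x')).source, (splitBase q E (φ x')).open_source⟩
  have h1 : P ≤ preimOpens (splitBase q E (φ x)) V := inf_le_left
  have h2 : P ≤ preimOpens (splitBase q E (φ x')) b.target := fun p hp =>
    ⟨hp.2, by
      have h := b.base.map_source ((mem_splitAtlasChart_domain Φ (y := φ.symm p)).2
        (by rw [φ.apply_symm_apply]; exact hp.2))
      have e : b.base (φ.symm p) = splitBase q E (φ x') p := by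
        change splitBase q E (φ x') (φ (φ.symm p)) = _
        rw [φ.apply_symm_apply]
      rw [e] at h
      exact h⟩
  have hVs := subset_target_of_trans hV
  have hbt : (b.target : Set ℂ) ⊆ (splitBase q E (φ x')).target :=
    subset_target_of_trans (subset_refl b.base.target)
  -- In the split model both functions are scalar, and the trivialisations of `⋀ E` fix scalars;
  -- only the reduced maps remain to be compared.
  have key : (splitModel q E).res h1 ((splitChart q E (φ x)).pull V hVs F) =
      (splitModel q E).res h2 ((splitChart q E (φ x')).pull b.target hbt
        (superAffine.evenCoord _)) := by
    refine splitModel_ext fun p => ?_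
    have hp1 := h1 p.2
    have hp2 := h2 p.2
    change ExteriorAlgebra.map (trivSymm q E (φ x) p) (superAffine.ev F _) =
      ExteriorAlgebra.map (trivSymm q E (φ x') p) (superAffine.ev _ _)
    rw [superAffine.ev_scalar _ hp1.2, superAffine.ev_evenCoord hp2.2, AlgHom.commutes,
      AlgHom.commutes]
    congr 1
    have hpa : φ.symm p ∈ a.domain := (mem_splitAtlasChart_domain Φ).2
      (by rw [φ.apply_symm_apply]; exact hp1.1)
    have e : splitBase q E (φ x) p = a.base (φ.symm p) := by
      change _ = splitBase q E (φ x) (φ (φ.symm p))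
      rw [φ.apply_symm_apply]
    rw [e, a.base.left_inv hpa]
    change splitBase q E (φ x') (φ (φ.symm p)) = _
    rw [φ.apply_symm_apply]
  set Q := preimOpens φ.toOpenPartialHomeomorph P
  have hyP : φ y ∈ P := ⟨⟨(mem_splitAtlasChart_domain Φ).1 hy, hyV⟩,
    (mem_splitAtlasChart_domain Φ).1 hy'⟩
  have hyQ : y ∈ Q := ⟨trivial, hyP⟩
  have hQa : Q ≤ preimOpens a.base V := fun p hp => by
    exact (preimOpens_trans φ.toOpenPartialHomeomorph (splitBase q E (φ x)) V).le
      ⟨trivial, h1 hp.2⟩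
  have hQb : Q ≤ b.domain := fun p hp => (mem_splitAtlasChart_domain Φ).2 hp.2.2
  have huniv : ∀ U : Opens C, (U : Set C) ⊆ φ.toOpenPartialHomeomorph.target :=
    fun U _ _ => trivial
  have key2 : X.res hQa (a.iso.pull V hV F) = X.res hQb b.even := by
    have e1 := Φ.pull_res (huniv _) (huniv _) h1 ((splitChart q E (φ x)).pull V hVs F)
    have e2 := Φ.pull_res (huniv _) (huniv _) h2 ((splitChart q E (φ x')).pull b.target hbt
        (superAffine.evenCoord _))
    rw [key] at e1
    have e3 := e1.symm.trans e2
    refine (X.res_res _ _ _).trans (Eq.trans ?_ (X.res_res _ _ _).symm)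
    refine e3.trans (X.res_res _ _ _).symm
  have hz : a.base y ∈ imageOpens a.base Q := mem_image a.base hyQ hy
  have h3 : a.fn b.even (a.base y) = superAffine.ev F (a.base y) := by
    rw [← a.fn_res hQb hz, ← key2, a.fn_res hQa hz, a.fn_pull_of_mem hV hyV]
  rw [Chart.nil, h3, superAffine.ev_scalar _ hyV, a.base.left_inv hy, sub_self]

end Supermanifold

section

variable {C : Type u} [TopologicalSpace C] [ChartedSpace ℂ C] {E : C → Type u}
    [∀ x, AddCommGroup (E x)] [∀ x, Module ℂ (E x)] [∀ x, TopologicalSpace (E x)]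
    [TopologicalSpace (Bundle.TotalSpace (Fin 3 → ℂ) E)] [FiberBundle (Fin 3 → ℂ) E]
    [VectorBundle ℂ (Fin 3 → ℂ) E] [ContMDiffVectorBundle ω (Fin 3 → ℂ) E 𝓘(ℂ)]
    [IsManifold 𝓘(ℂ) ω C] {X : Supermanifold 3 E}

/-- The atlas transported from the split model has the zero cocycle, and the class does not depend
on the atlas. -/
theorem Supermanifold.IsSplit.classOf_cocycle_eq_zero (h : X.IsSplit) (𝔄 : X.Atlas) :
    (obstructionSheaf 3 E).classOf 𝔄.cocycle = 0 := by
  obtain ⟨φ, ⟨Φ⟩⟩ := h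
  let 𝔅 : X.Atlas := ⟨splitAtlasChart Φ, fun x =>
    (mem_splitAtlasChart_domain Φ).2 (mem_splitBase_source 3 E (φ x))⟩
  have h0 : 𝔅.cocycle = 0 := Subtype.ext (funext fun a => funext fun b => funext fun y => by
    change (𝔅.chart a).obs (𝔅.chart b) y = 0
    have hn : (𝔅.chart a).nil (𝔅.chart b) y = 0 := nil_splitAtlasChart Φ y.2.1 y.2.2
    rw [Chart.obs, hn, Chart.frame2, map_zero, map_zero, TensorProduct.zero_tmul])
  rw [𝔄.classOf_cocycle 𝔅, h0, SectionPresheaf.classOf]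
  exact map_zero _

end

/-! ### Gluing -/

namespace SuperSpace

variable {M : Type u} [TopologicalSpace M] (A : SuperSpace M) {ι : Type u} {U : ι → Opens M}
  {V : Opens M} (hU : ∀ i, U i ≤ V) (hV : ∀ x ∈ V, ∃ i, x ∈ U i)
include hV

theorem eq_of_locally_eq {s t : A.sections V} (h : ∀ i, A.res (hU i) s = A.res (hU i) t) :
    s = t :=
  TopCat.Sheaf.eq_of_locally_eq' A.sheaf U V (fun i => homOfLE (hU i))
    (fun x hx => Opens.mem_iSup.2 (hV x hx)) s t h

theorem exists_gluing (s : ∀ i, A.sections (U i))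
    (hs : ∀ i j, A.res (inf_le_left : U i ⊓ U j ≤ U i) (s i) =
      A.res (inf_le_right : U i ⊓ U j ≤ U j) (s j)) :
    ∃ t : A.sections V, ∀ i, A.res (hU i) t = s i :=
  (TopCat.Sheaf.existsUnique_gluing' A.sheaf U V (fun i => homOfLE (hU i))
    (fun x hx => Opens.mem_iSup.2 (hV x hx)) s hs).exists

end SuperSpace

/-! ### Supermanifolds with linear transition maps are split -/

namespace Supermanifold

variable {C : Type u} [TopologicalSpace C] [ChartedSpace ℂ C] {E : C → Type u}
    [∀ x, AddCommGroup (E x)] [∀ x, Module ℂ (E x)] [∀ x, TopologicalSpace (E x)]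
    [TopologicalSpace (Bundle.TotalSpace (Fin 3 → ℂ) E)] [FiberBundle (Fin 3 → ℂ) E]
    [VectorBundle ℂ (Fin 3 → ℂ) E] [ContMDiffVectorBundle ω (Fin 3 → ℂ) E 𝓘(ℂ)]
    [IsManifold 𝓘(ℂ) ω C] {X : Supermanifold 3 E}

namespace Chart

variable (a b : X.Chart) {x : C}

/-- The transition map is trivial in the even coordinate and linear in the odd ones. -/
def IsLinearTransition : Prop :=
  ∀ x ∈ a.domain ⊓ b.domain, a.nil b x = 0 ∧ ∀ v, Gr.c012 (a.fn (b.oddLin v) (a.base x)) = 0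

theorem map_frm_injective (hx : x ∈ a.domain) :
    Function.Injective (ExteriorAlgebra.map (a.frm x)) := by
  have h : a.frmInv x ∘ₗ a.frm x = LinearMap.id := LinearMap.ext fun v => a.frmInv_frm hx v
  have h2 : Function.LeftInverse (ExteriorAlgebra.map (a.frmInv x))
      (ExteriorAlgebra.map (a.frm x)) := fun l => by
    rw [← AlgHom.comp_apply, ExteriorAlgebra.map_comp_map, h, ExteriorAlgebra.map_id,
      AlgHom.id_apply]
  exact h2.injective

theorem map_frm_map_frmInv (hx : x ∈ a.domain) (l : ExteriorAlgebra ℂ (E x)) :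
    ExteriorAlgebra.map (a.frm x) (ExteriorAlgebra.map (a.frmInv x) l) = l := by
  have h : a.frm x ∘ₗ a.frmInv x = LinearMap.id := LinearMap.ext fun v => a.frm_frmInv hx v
  rw [← AlgHom.comp_apply, ExteriorAlgebra.map_comp_map, h, ExteriorAlgebra.map_id,
    AlgHom.id_apply]

variable {a b}

/-- Without quadratic and cubic terms the Taylor formula reduces to the map of exterior algebras
induced by `lin`, which the frames absorb. The value of a section in `⋀ E` is therefore independent
of the chart and defines `toSplit`. -/
theorem IsLinearTransition.map_frm_fn (h : a.IsLinearTransition b) (hx : x ∈ a.domain ⊓ b.domain)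
    {W : Opens C} (hW : x ∈ W) (s : X.sections W) :
    ExteriorAlgebra.map (a.frm x) (a.fn s (a.base x)) =
      ExteriorAlgebra.map (b.frm x) (b.fn s (b.base x)) := by
  have e : a.frm x ∘ₗ a.lin b hx = b.frm x := LinearMap.ext fun v => a.frm_lin b hx v
  rw [a.taylor b hx hW, (h x hx).1, zero_mul, add_zero, a.sub_eq b hx, a.sub_ι b hx,
    (h x hx).2, zero_smul, add_zero, ← AlgHom.comp_apply, ExteriorAlgebra.map_comp_map, e]

/-- The section with given holomorphic values in the coordinates of a chart. -/
def ofFn (a : X.Chart) {W : Opens C} (hW : W ≤ a.domain) (f : ℂ → Gr)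
    (hf : ∀ z ∈ imageOpens a.base W, HolAt f z) : X.sections W :=
  X.res (le_preim_image a.base W hW)
    (a.iso.pull _ (image_subset_target a.base W) (superAffine.ofFun _ f hf))

theorem fn_ofFn (a : X.Chart) {W : Opens C} (hW : W ≤ a.domain) {f : ℂ → Gr}
    (hf : ∀ z ∈ imageOpens a.base W, HolAt f z) {z : ℂ} (hz : z ∈ imageOpens a.base W) :
    a.fn (a.ofFn hW f hf) z = f z := by
  rw [ofFn, a.fn_res _ hz, a.fn_pull_of_mem _ hz, superAffine.ev_ofFun _ hz]

end Chart

namespace Atlas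

variable {𝔄 : X.Atlas} (h𝔄 : ∀ a b, (𝔄.chart a).IsLinearTransition (𝔄.chart b))

section

include h𝔄

theorem isHolomorphicAt_map_frm {U : Opens C} (s : X.sections U) (x₀ : U) :
    IsHolomorphicAt (extTriv 3 E x₀.1) (fun x : U => ExteriorAlgebra.map ((𝔄.chart x).frm x)
      ((𝔄.chart x).fn s ((𝔄.chart x).base x))) x₀.1 := by
  refine (isHolomorphicAt_iff (f := fun x => extTriv 3 E x₀.1 x (ExteriorAlgebra.map
    ((𝔄.chart x).frm x) ((𝔄.chart x).fn s ((𝔄.chart x).base x)))) x₀.2 fun x => rfl).2 ?_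
  have hx := 𝔄.mem_domain x₀.1
  refine (HolAt.extMap (g := fun y => triv 3 E x₀.1 y ∘ₗ (𝔄.chart x₀.1).frm y)
    (fun v => (𝔄.chart x₀.1).holAt_frm hx (mem_trivSet 3 E x₀.1) v)
    ((𝔄.chart x₀.1).holAt_fn_base hx x₀.2 s)).congr ?_
  filter_upwards [(𝔄.chart x₀.1).domain.isOpen.mem_nhds hx, U.isOpen.mem_nhds x₀.2] with y hy hyU
  rw [← ExteriorAlgebra.map_comp_map, AlgHom.comp_apply,
    (h𝔄 x₀ y).map_frm_fn ⟨hy, 𝔄.mem_domain y⟩ hyU s]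
  rfl

/-- The homomorphism to the split model defined by an atlas with linear transition maps. -/
def toSplit (U : Opens C) : X.sections U →ₐ[ℂ] (splitModel 3 E).sections U :=
  splitSection (fun x => (ExteriorAlgebra.map ((𝔄.chart x).frm x)).comp
    ((𝔄.chart x).fnHom (mem_image _ x.2 (𝔄.mem_domain x)))) (isHolomorphicAt_map_frm h𝔄)

theorem extEval_toSplit {U : Opens C} (s : X.sections U) (x : U) {a : C}
    (ha : x.1 ∈ (𝔄.chart a).domain) : extEval (toSplit h𝔄 U s) x =
      ExteriorAlgebra.map ((𝔄.chart a).frm x) ((𝔄.chart a).fn s ((𝔄.chart a).base x)) :=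
  (h𝔄 x a).map_frm_fn ⟨𝔄.mem_domain x, ha⟩ x.2 s

theorem toSplit_res {U V : Opens C} (h : V ≤ U) (s : X.sections U) :
    toSplit h𝔄 V (X.res h s) = (splitModel 3 E).res h (toSplit h𝔄 U s) :=
  splitModel_ext fun x => congrArg (ExteriorAlgebra.map _)
    ((𝔄.chart x).fn_res h (mem_image _ x.2 (𝔄.mem_domain x)) s)

theorem toSplit_injective (U : Opens C) : Function.Injective (toSplit h𝔄 U) := by
  intro s t hst
  refine X.eq_of_locally_eq (U := fun a => U ⊓ (𝔄.chart a).domain) (fun a => inf_le_left)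
    (fun x hx => ⟨x, hx, 𝔄.mem_domain x⟩) fun a => (𝔄.chart a).ext_fn inf_le_right fun z hz => ?_
  rw [(𝔄.chart a).fn_res _ hz, (𝔄.chart a).fn_res _ hz]
  have h1 := congrArg (fun f => extEval f ⟨(𝔄.chart a).base.symm z, hz.2.1⟩) hst
  simp only at h1
  rw [extEval_toSplit h𝔄 s _ hz.2.2, extEval_toSplit h𝔄 t _ hz.2.2] at h1
  have h2 := (𝔄.chart a).map_frm_injective hz.2.2 h1
  rwa [(𝔄.chart a).base.right_inv hz.1] at h2

-- Preimages are written down chart by chart with the inverse frames. They agree on overlaps by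
-- injectivity of `toSplit`, so they glue.
open scoped Classical in
theorem toSplit_surjective (U : Opens C) : Function.Surjective (toSplit h𝔄 U) := by
  intro t
  let f : C → ℂ → Gr := fun a z => if h : (𝔄.chart a).base.symm z ∈ U then
    ExteriorAlgebra.map ((𝔄.chart a).frmInv ((𝔄.chart a).base.symm z))
      (extEval t ⟨(𝔄.chart a).base.symm z, h⟩) else 0
  have hf : ∀ a, ∀ z ∈ imageOpens (𝔄.chart a).base (U ⊓ (𝔄.chart a).domain), HolAt (f a) z := by
    intro a z hz
    set x₀ := (𝔄.chart a).base.symm z with hx₀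
    let g : C → Gr := fun x => if h : x ∈ U then extTriv 3 E x₀ x (extEval t ⟨x, h⟩) else 0
    have hg : HolAt g x₀ :=
      (isHolomorphicAt_iff hz.2.1 fun x => by simp [g, extEval]).1
        ((show extSections 3 E U from t).2 ⟨x₀, hz.2.1⟩)
    -- Holomorphy is checked by passing from the trivialisation of `E` at `x₀` to the frame of the
    -- chart.
    have h1 := HolAt.extMap (g := fun y => (𝔄.chart a).frmInv y ∘ₗ trivSymm 3 E x₀ y)
      (fun v => (𝔄.chart a).holAt_frmInv hz.2.2 (mem_trivSet 3 E x₀) v) hg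
    have h2 := h1.comp (contMDiffAt_symm_of_mem_maximalAtlas (𝔄.chart a).base_mem hz.1)
    refine h2.congr ?_
    have hc : Filter.Tendsto (𝔄.chart a).base.symm (nhds z) (nhds x₀) :=
      ((𝔄.chart a).base.symm.continuousAt hz.1)
    filter_upwards [hc.eventually (U.isOpen.mem_nhds hz.2.1),
      hc.eventually ((trivSet 3 E x₀).isOpen.mem_nhds (mem_trivSet 3 E x₀))] with w hw hw'
    have hwU : (𝔄.chart a).base.symm w ∈ U := hw
    simp only [f, g, hwU, dif_pos]
    rw [← ExteriorAlgebra.map_comp_map, AlgHom.comp_apply, map_trivSymm_extTriv hw']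
  let s : ∀ a, X.sections (U ⊓ (𝔄.chart a).domain) := fun a =>
    (𝔄.chart a).ofFn inf_le_right (f a) (hf a)
  have hs : ∀ a, toSplit h𝔄 _ (s a) = (splitModel 3 E).res inf_le_left t := by
    intro a
    refine splitModel_ext fun x => ?_
    rw [extEval_toSplit h𝔄 _ x x.2.2, (𝔄.chart a).fn_ofFn _ _ (mem_image _ x.2 x.2.2)]
    have hx : (𝔄.chart a).base.symm ((𝔄.chart a).base x) = x := (𝔄.chart a).base.left_inv x.2.2
    have hxU : x.1 ∈ U := x.2.1
    have key : ∀ y : C, y = x → ExteriorAlgebra.map ((𝔄.chart a).frm x)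
        (if h : y ∈ U then ExteriorAlgebra.map ((𝔄.chart a).frmInv y) (extEval t ⟨y, h⟩) else 0) =
 extEval t ⟨x.1, hxU⟩ := by
      rintro y rfl
      rw [dif_pos hxU, (𝔄.chart a).map_frm_map_frmInv x.2.2]
    exact key _ hx
  obtain ⟨r, hr⟩ := X.exists_gluing (U := fun a => U ⊓ (𝔄.chart a).domain) (V := U)
    (fun a => inf_le_left) (fun x hx => ⟨x, hx, 𝔄.mem_domain x⟩) s fun a b => by
      refine toSplit_injective h𝔄 _ ?_
      rw [toSplit_res, toSplit_res, hs, hs]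
      exact ((splitModel 3 E).res_res _ _ t).trans ((splitModel 3 E).res_res _ _ t).symm
  refine ⟨r, (splitModel 3 E).eq_of_locally_eq (U := fun a => U ⊓ (𝔄.chart a).domain)
    (fun a => inf_le_left) (fun x hx => ⟨x, hx, 𝔄.mem_domain x⟩) fun a => ?_⟩
  rw [← toSplit_res, hr, hs]

/-- A supermanifold with an atlas with linear transition maps is split. -/
theorem isSplit : X.IsSplit := by
  let e : OpenPartialHomeomorph C C := (Homeomorph.refl C).toOpenPartialHomeomorph
  -- The preimage under the identity is an intersection with the whole space, so sections have to be
  -- transported along this equality.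
  have he : ∀ V, V = preimOpens e V := fun V => Opens.ext (Set.univ_inter _).symm
  let T : ∀ U, X.sections U ≃ₐ[ℂ] (splitModel 3 E).sections U := fun U =>
    AlgEquiv.ofBijective (toSplit h𝔄 U) ⟨toSplit_injective h𝔄 U, toSplit_surjective h𝔄 U⟩
  have hT : ∀ U s, toSplit h𝔄 U ((T U).symm s) = s := fun U => (T U).apply_symm_apply
  refine ⟨Homeomorph.refl C, ⟨⟨fun V _ => (T V).symm.trans (X.resEquiv (he V)), ?_, ?_, ?_⟩⟩⟩
  · intro V V' hV hV' h s
    -- Compatibility of the inverse is checked after applying the injective map `toSplit`.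
    have h1 : (T V').symm ((splitModel 3 E).res h s) = X.res h ((T V).symm s) := by
      refine toSplit_injective h𝔄 _ ?_
      rw [hT, toSplit_res, hT]
    simp only [AlgEquiv.trans_apply, SuperSpace.resEquiv_apply]
    rw [h1, X.res_res, X.res_res]
  · intro V hV s
    have h1 : (T V).symm ((splitModel 3 E).parity V s) = X.parity V ((T V).symm s) := by
      refine toSplit_injective h𝔄 _ ?_
      rw [hT]
      refine splitModel_ext fun x => ?_
      have h2 := congrArg (fun t => ExteriorAlgebra.map (-LinearMap.id) (extEval t x)) (hT V s)
      refine Eq.trans h2.symm ?_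
      rw [extEval_toSplit h𝔄 _ x (𝔄.mem_domain x), extEval_toSplit h𝔄 _ x (𝔄.mem_domain x),
        (𝔄.chart x).fn_parity (mem_image _ x.2 (𝔄.mem_domain x)), ← AlgHom.comp_apply,
        ← AlgHom.comp_apply, ExteriorAlgebra.map_comp_map, ExteriorAlgebra.map_comp_map]
      congr 2
      ext v
      simp
    simp only [AlgEquiv.trans_apply, SuperSpace.resEquiv_apply]
    rw [h1, X.parity_res]
  · intro V hV s x
    have hx : x.1 ∈ V := x.2.2
    simp only [AlgEquiv.trans_apply, SuperSpace.resEquiv_apply]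
    rw [X.body_res]
    have h2 := congrArg (fun t => ExteriorAlgebra.algebraMapInv (extEval t ⟨x.1, hx⟩)) (hT V s)
    refine Eq.trans ?_ h2
    have h5 := extEval_toSplit h𝔄 ((T V).symm s) ⟨x.1, hx⟩ (𝔄.mem_domain x.1)
    refine Eq.trans ?_ (congrArg ExteriorAlgebra.algebraMapInv h5).symm
    have hz := mem_image (𝔄.chart x).base hx (𝔄.mem_domain x)
    have h3 := (𝔄.chart x).body_fn hz ((T V).symm s)
    have h4 : ∀ l : Gr, ExteriorAlgebra.algebraMapInv (ExteriorAlgebra.map ((𝔄.chart x).frm x) l) =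
        ExteriorAlgebra.algebraMapInv l := fun l => by
      rw [← AlgHom.comp_apply]
      congr 1
      ext v
      simp [ExteriorAlgebra.algebraMapInv]
    rw [h4, h3]
    exact congrArg _ (Subtype.ext ((𝔄.chart x).base.left_inv (𝔄.mem_domain x)).symm)

end

end Atlas

end Supermanifold

/-! ### Superconformal vector fields in coordinates -/

namespace Gr

/-- The odd derivation `∂/∂θ`, where `θ` is the first generator. -/
def dθ : Gr →ₗ[ℂ] Gr :=
  c0.smulRight 1 + c01.smulRight (gen 1) + c02.smulRight (gen 2) + c012.smulRight (gen 1 * gen 2)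

theorem dθ_apply (l : Gr) : dθ l = mk (c0 l) 0 (c01 l) (c02 l) 0 0 (c012 l) 0 := by
  simp [dθ, mk]

theorem dθ_mk (c a₀ a₁ a₂ p q r h : ℂ) :
    dθ (mk c a₀ a₁ a₂ p q r h) = mk a₀ 0 p q 0 0 h 0 := by
  rw [dθ_apply, c0_mk, c01_mk, c02_mk, c012_mk]

theorem dθ_mul (l m : Gr) : dθ (l * m) = dθ l * m + par l * dθ m := by
  obtain ⟨_, _, _, _, _, _, _, _, rfl⟩ := exists_eq_mk l
  obtain ⟨_, _, _, _, _, _, _, _, rfl⟩ := exists_eq_mk m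
  simp only [mk_mul, dθ_mk, par_mk, mk_add]
  congr 1 <;> ring

theorem gen_zero_eq_mk : gen 0 = mk 0 1 0 0 0 0 0 0 := by simp [mk]

end Gr

theorem _root_.SuperGeom.VectorField.op_one {M : Type u} [TopologicalSpace M] {A : SuperSpace M}
    {U : Opens M} (D : VectorField A U true) {V : Opens M} (hV : V ≤ U) : D.op V hV 1 = 0 := by
  have h := D.op_mul V hV 1 1
  simp only [mul_one, if_true, map_one, one_mul] at h
  exact left_eq_add.1 h

namespace Supermanifold.Chart

variable {C : Type u} [TopologicalSpace C] [ChartedSpace ℂ C]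

section

variable {q : ℕ} {E : C → Type u}
    [∀ x, AddCommGroup (E x)] [∀ x, Module ℂ (E x)] [∀ x, TopologicalSpace (E x)]
    [TopologicalSpace (Bundle.TotalSpace (Fin q → ℂ) E)] [FiberBundle (Fin q → ℂ) E]
    [VectorBundle ℂ (Fin q → ℂ) E] {X : Supermanifold q E} (a : X.Chart) {W : Opens C}

/-- Pull-back of superfunctions to an open part of the domain of a chart. -/
def liftOn (hW : W ≤ a.domain) :
    (superAffine q).sections (imageOpens a.base W) →ₐ[ℂ] X.sections W :=
  (X.res (le_preim_image a.base W hW)).comp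
    (a.iso.pull _ (image_subset_target a.base W)).toAlgHom

variable (hW : W ≤ a.domain)

theorem liftOn_express (s : X.sections W) : a.liftOn hW (a.express s) = s := by
  have h : a.liftOn hW (a.express s) = X.res (le_preim_image a.base W hW)
      (a.iso.pull _ (image_subset_target a.base W) (a.express s)) := rfl
  rw [h, express, AlgEquiv.apply_symm_apply, X.res_res, X.res_self]

theorem fn_liftOn {z : ℂ} (hz : z ∈ imageOpens a.base W)
    (F : (superAffine q).sections (imageOpens a.base W)) :
    a.fn (a.liftOn hW F) z = superAffine.ev F z :=
  (a.fn_res _ hz _).trans (a.fn_pull_of_mem _ hz F)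

theorem liftOn_evenCoord : a.liftOn hW (superAffine.evenCoord _) = X.res hW a.even :=
  a.ext_fn hW fun z hz => by
    rw [fn_liftOn a hW hz, superAffine.ev_evenCoord hz, a.fn_res hW hz, a.fn_even hz.1]

theorem liftOn_oddLinear (v : Fin q → ℂ) :
    a.liftOn hW (superAffine.oddLinear _ v) = X.res hW (a.oddLin v) :=
  a.ext_fn hW fun z hz => by
    rw [fn_liftOn a hW hz, superAffine.ev_oddLinear hz, a.fn_res hW hz, a.fn_oddLin hz.1]

end

variable {E : C → Type u}
    [∀ x, AddCommGroup (E x)] [∀ x, Module ℂ (E x)] [∀ x, TopologicalSpace (E x)]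
    [TopologicalSpace (Bundle.TotalSpace (Fin 3 → ℂ) E)] [FiberBundle (Fin 3 → ℂ) E]
    [VectorBundle ℂ (Fin 3 → ℂ) E] {X : Supermanifold 3 E} {a : X.Chart}
    {D : VectorField X.toSuperSpace a.domain true} (hD : a.IsSuperconformalField D)
    {W : Opens C} (hW : W ≤ a.domain) {x : C} (hx : x ∈ W)
include hD hx

theorem fn_op_oddLin (v : Fin 3 → ℂ) :
    a.fn (D.op W hW (X.res hW (a.oddLin v))) (a.base x) = algebraMap ℂ Gr (v 0) := by
  have hz := mem_image a.base hx (hW hx)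
  have e : v = v 0 • Pi.single 0 1 + v 1 • Pi.single 1 1 + v 2 • Pi.single 2 1 := by
    ext i; fin_cases i <;> simp
  have h : ∀ i, a.odd i = a.oddLin (Pi.single i 1) := fun i => rfl
  have h1 : a.oddLin v = v 0 • a.odd 0 + v 1 • a.odd 1 + v 2 • a.odd 2 := by
    rw [h, h, h]
    conv_lhs => rw [e]
    simp only [oddLin, map_add, map_smul]
  have h2 : D.op a.domain le_rfl (a.oddLin v) = v 0 • 1 := by
    rw [h1]
    simp only [map_add, map_smul]
    rw [hD.2.1, hD.2.2 1 (by decide), hD.2.2 2 (by decide), smul_zero, smul_zero, add_zero,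
      add_zero]
  have h3 : D.op W hW (X.res hW (a.oddLin v)) = X.res hW (D.op a.domain le_rfl (a.oddLin v)) :=
    D.op_res le_rfl hW _
  rw [h3, a.fn_res hW hz, h2, a.fn_smul (mem_image a.base (hW hx) (hW hx)),
    a.fn_one (mem_image a.base (hW hx) (hW hx)), Algebra.algebraMap_eq_smul_one]

/-- Both sides obey the Leibniz rule of an odd derivation in `l`, so agreement on scalars and
generators suffices. -/
theorem fn_op_const (l : Gr) :
    a.fn (D.op W hW (a.liftOn hW (superAffine.constHom _ l))) (a.base x) = Gr.dθ l := by
  have hz := mem_image a.base hx (hW hx)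
  induction l using ExteriorAlgebra.induction with
  | algebraMap r =>
    rw [AlgHom.commutes, AlgHom.commutes, Algebra.algebraMap_eq_smul_one, map_smul, D.op_one,
      smul_zero, Gr.algebraMap_eq_mk, Gr.dθ_mk]
    exact (map_zero (a.fnHom hz)).trans (by simp [Gr.mk])
  | ι v =>
    rw [superAffine.constHom_ι, liftOn_oddLinear, fn_op_oddLin hD hW hx, Gr.ι_eq_mk, Gr.dθ_mk,
      Gr.algebraMap_eq_mk]
  | mul l m hl hm =>
    rw [map_mul, map_mul, D.op_mul, if_pos rfl, a.fn_add hz, a.fn_mul hz, a.fn_mul hz, hl, hm,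
      a.fn_parity hz, fn_liftOn a hW hz, fn_liftOn a hW hz, superAffine.ev_constHom hz,
      superAffine.ev_constHom hz, Gr.dθ_mul]
  | add l m hl hm =>
    rw [map_add, map_add, map_add, a.fn_add hz, hl, hm, map_add]

/-- By Hadamard's lemma `f - f(z₀)` is `(x - z₀)g` with `g(z₀) = f'(z₀)`. In the Leibniz rule the
term with `Dg` has the factor `x - z₀`, which vanishes at the point; the other term is `θ g`. -/
theorem fn_op_scalar {f : ℂ → ℂ} (hf : ∀ z ∈ imageOpens a.base W, HolAt f z) :
    a.fn (D.op W hW (a.liftOn hW (superAffine.scalar _ f hf))) (a.base x) =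
      deriv f (a.base x) • Gr.gen 0 := by
  have hz := mem_image a.base hx (hW hx)
  set g := superAffine.scalar (q := 3) (imageOpens a.base W) _ (superAffine.holAt_dslope hz hf)
  have h0 : D.op W hW (X.res hW a.even) = X.res hW (a.odd 0) :=
    (D.op_res le_rfl hW _).trans (congrArg _ hD.1)
  have h1 : D.op W hW (X.res hW a.even - algebraMap ℂ _ (a.base x)) = X.res hW (a.odd 0) := by
    rw [map_sub, h0, Algebra.algebraMap_eq_smul_one, map_smul, D.op_one, smul_zero, sub_zero]
  have h2 : a.fn (X.parity W (X.res hW a.even - algebraMap ℂ _ (a.base x))) (a.base x) = 0 := by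
    rw [a.fn_parity hz, a.fn_sub hz, a.fn_res hW hz, a.fn_even hz.1]
    have h3 : a.fn (algebraMap ℂ (X.sections W) (a.base x)) (a.base x) = algebraMap ℂ _ (a.base x) :=
      (a.fnHom hz).commutes _
    rw [h3, sub_self, map_zero]
  have h4 : a.fn (X.res hW (a.odd 0)) (a.base x) = Gr.gen 0 := by
    rw [a.fn_res hW hz]
    exact a.fn_oddLin hz.1 _
  rw [superAffine.scalar_eq hz hf, map_add, map_mul, map_sub, AlgHom.commutes, AlgHom.commutes,
    map_add, D.op_mul, if_pos rfl, liftOn_evenCoord, h1, Algebra.algebraMap_eq_smul_one (f _),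
    map_smul, D.op_one, smul_zero, zero_add, a.fn_add hz, a.fn_mul hz, a.fn_mul hz, h2, zero_mul,
    add_zero, h4, fn_liftOn a hW hz, superAffine.ev_scalar _ hz, dslope_same, ← Algebra.commutes,
    ← Algebra.smul_def]

/-- The field `∂/∂θ + θ ∂/∂x` in coordinates. -/
theorem fn_op (s : X.sections W) : a.fn (D.op W hW s) (a.base x) =
    Gr.dθ (a.fn s (a.base x)) + Gr.gen 0 * hderiv (a.fn s) (a.base x) := by
  have hz := mem_image a.base hx (hW hx)
  set b := Module.finBasis ℂ Gr with hb
  -- The section is written as a sum of scalar functions times constants, so that the two preceding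
  -- lemmas determine the field.
  have h1 : s = ∑ i, a.liftOn hW (superAffine.scalar _ (fun z => b.coord i (a.fn s z))
      (fun _ hz => (a.holAt_fn hz s).map _)) * a.liftOn hW (superAffine.constHom _ (b i)) := by
    conv_lhs => rw [← a.liftOn_express hW s, superAffine.eq_sum_scalar (a.express s), map_sum]
    exact Finset.sum_congr rfl fun i _ => map_mul _ _ _
  have h2 : ∀ t : Fin _ → X.sections W, a.fn (D.op W hW (∑ i, t i)) (a.base x) =
      ∑ i : Fin (Module.finrank ℂ Gr), a.fn (D.op W hW (t i)) (a.base x) := fun t => by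
    rw [map_sum]
    exact map_sum (a.fnHom hz) _ _
  have h3 : ∀ i, a.fn (D.op W hW (a.liftOn hW (superAffine.scalar _ (fun z => b.coord i (a.fn s z))
      (fun _ hz => (a.holAt_fn hz s).map _)) * a.liftOn hW (superAffine.constHom _ (b i))))
      (a.base x) = Gr.gen 0 * (deriv (fun z => b.coord i (a.fn s z)) (a.base x) • b i) +
        Gr.dθ (b.coord i (a.fn s (a.base x)) • b i) := fun i => by
    rw [D.op_mul, if_pos rfl, a.fn_add hz, a.fn_mul hz, a.fn_mul hz, fn_op_scalar hD hW hx,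
      fn_op_const hD hW hx, a.fn_parity hz, fn_liftOn a hW hz, fn_liftOn a hW hz,
      superAffine.ev_constHom hz, superAffine.ev_scalar _ hz, AlgHom.commutes, smul_mul_assoc,
      mul_smul_comm, map_smul, Algebra.smul_def (b.coord i (a.fn s (a.base x)))]
  conv_lhs => rw [h1, h2]
  rw [Finset.sum_congr rfl fun i _ => h3 i, Finset.sum_add_distrib, ← Finset.mul_sum, ← map_sum,
    add_comm]
  congr 2
  exact b.sum_repr (a.fn s (a.base x))

end Supermanifold.Chart

/-! ### Superconformal transition maps -/

/-- The coefficient of the cubic term in the change of coordinates that removes the quadratic term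
`s₁ θξ₁ + s₂ θξ₂ + t ξ₁ξ₂` from an even coordinate. -/
def cubicCoeff (S : ℂ → Gr) (z : ℂ) : ℂ :=
  -(Gr.c12 (hderiv S z) + Gr.c01 (S z) * Gr.c02 (hderiv S z)
    - Gr.c02 (S z) * Gr.c01 (hderiv S z)) / 2

/-- The computation behind the theorem. Here `g`, `ζ`, `ψᵢ`, `r`, `h` are the coefficients of a
superconformal transition map, `s₁, s₂, t` the quadratic data of the source chart and `B₁, B₂, Bt`
those of the target chart. `e₁`, `e₂`, `er` say that the quadratic cocycle is their coboundary, and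
`hr` is the superconformal relation in top degree. The left side of the conclusion is the cubic term
left after both changes of coordinates. The relations hold near `z` because they are differentiated;
`ζ²` enters through the chain rule as the derivative of `g`. -/
theorem cubic_identity {z h : ℂ} {g ζ ψ₁ ψ₂ r s₁ s₂ t B₁ B₂ Bt : ℂ → ℂ}
    (hg : HasDerivAt g (ζ z ^ 2) z) (hζ : DifferentiableAt ℂ ζ z) (hs₁ : DifferentiableAt ℂ s₁ z)
    (hs₂ : DifferentiableAt ℂ s₂ z) (ht : DifferentiableAt ℂ t z)
    (hB₁ : DifferentiableAt ℂ B₁ (g z)) (hB₂ : DifferentiableAt ℂ B₂ (g z))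
    (hBt : DifferentiableAt ℂ Bt (g z)) (hz : ζ z ≠ 0)
    (e₁ : ψ₁ =ᶠ[nhds z] fun w => B₁ (g w) - ζ w * s₁ w)
    (e₂ : ψ₂ =ᶠ[nhds z] fun w => B₂ (g w) - ζ w * s₂ w)
    (er : r =ᶠ[nhds z] fun w => Bt (g w) - B₁ (g w) * ψ₂ w + B₂ (g w) * ψ₁ w - ζ w ^ 2 * t w)
    (hr : deriv r z = 2 * ζ z * h + deriv ψ₁ z * ψ₂ z - deriv ψ₂ z * ψ₁ z) :
    h + ζ z * (-(deriv Bt (g z) + B₁ (g z) * deriv B₂ (g z) - B₂ (g z) * deriv B₁ (g z)) / 2)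
      - ζ z * (-(deriv t z + s₁ z * deriv s₂ z - s₂ z * deriv s₁ z) / 2)
      + t z * deriv ζ z - s₂ z * deriv ψ₁ z + s₁ z * deriv ψ₂ z = 0 := by
  have hB₁' := (hB₁.hasDerivAt.comp z hg)
  have hB₂' := (hB₂.hasDerivAt.comp z hg)
  have hBt' := (hBt.hasDerivAt.comp z hg)
  have d₁ := ((hB₁'.sub (hζ.hasDerivAt.mul hs₁.hasDerivAt)).congr_of_eventuallyEq e₁)
  have d₂ := ((hB₂'.sub (hζ.hasDerivAt.mul hs₂.hasDerivAt)).congr_of_eventuallyEq e₂)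
  have dr := (((hBt'.sub (hB₁'.mul d₂)).add (hB₂'.mul d₁)).sub
    ((hζ.hasDerivAt.pow 2).mul ht.hasDerivAt)).congr_of_eventuallyEq er
  have v₁ := e₁.eq_of_nhds
  have v₂ := e₂.eq_of_nhds
  rw [dr.deriv, d₁.deriv, d₂.deriv] at hr
  rw [d₁.deriv, d₂.deriv]
  simp only [Function.comp_apply, Pi.pow_apply] at hr
  rw [v₁, v₂] at hr
  -- `hr` contains `h` only in the product `2ζh`, so the claim is proved after multiplication by
  -- `2ζ`.
  refine mul_left_cancel₀ (mul_ne_zero two_ne_zero hz) ?_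
  linear_combination (-1) * hr

namespace Supermanifold.Chart

variable {C : Type u} [TopologicalSpace C] [ChartedSpace ℂ C] {E : C → Type u}
    [∀ x, AddCommGroup (E x)] [∀ x, Module ℂ (E x)] [∀ x, TopologicalSpace (E x)]
    [TopologicalSpace (Bundle.TotalSpace (Fin 3 → ℂ) E)] [FiberBundle (Fin 3 → ℂ) E]
    [VectorBundle ℂ (Fin 3 → ℂ) E] {X : Supermanifold 3 E}

/-- The transition map from `a` to `b` is a superconformal family parametrised by the last two odd
coordinates. -/
structure IsSuperconformalTransition (a b : X.Chart) : Prop where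
  param : ∀ k : Fin 2, X.res (inf_le_left : a.domain ⊓ b.domain ≤ _) (a.odd k.succ) =
    X.res inf_le_right (b.odd k.succ)
  rel : ∀ x ∈ a.domain ⊓ b.domain,
    Gr.dθ (a.fn b.even (a.base x)) + Gr.gen 0 * hderiv (a.fn b.even) (a.base x) =
      (Gr.dθ (a.fn (b.odd 0) (a.base x)) + Gr.gen 0 * hderiv (a.fn (b.odd 0)) (a.base x)) *
        a.fn (b.odd 0) (a.base x)

theorem hderiv_fn_res (a : X.Chart) {W W' : Opens C} (h : W' ≤ W) {z : ℂ}
    (hz : z ∈ imageOpens a.base W') (s : X.sections W) :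
    hderiv (a.fn (X.res h s)) z = hderiv (a.fn s) z := by
  refine hderiv_congr ?_
  filter_upwards [(imageOpens a.base W').isOpen.mem_nhds hz] with w hw
  exact a.fn_res h hw s

/-- Let `D_a = u D_b`. Since `D_b η = 1` and `D_b y = η`, the factor is `u = D_a η`, and `D_a y =
(D_a η) η`; this eliminates the unknown `u`. -/
theorem _root_.SuperGeom.SuperconformalAtlas.isSuperconformalTransition
    (𝔄 : SuperconformalAtlas (n := 2) X) (i j : C) :
    (𝔄.chart i).IsSuperconformalTransition (𝔄.chart j) where
  param k := 𝔄.param_eq i j k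
  rel x hx := by
    set a := 𝔄.chart i
    set b := 𝔄.chart j
    set W := a.domain ⊓ b.domain with hWd
    have ha : W ≤ a.domain := inf_le_left
    have hb : W ≤ b.domain := inf_le_right
    have hz : a.base x ∈ imageOpens a.base W := mem_image a.base hx hx.1
    obtain ⟨u, hu⟩ := 𝔄.superconformal i j
    have hu' : ∀ s : X.sections W, (𝔄.field i).op W ha s = u * (𝔄.field j).op W hb s := fun s =>
      (hu W le_rfl s).trans (congrArg (· * _) (X.res_self _ u))
    obtain ⟨e1, e2, -⟩ := 𝔄.isSuperconformalField j
    have h1 : (𝔄.field j).op W hb (X.res hb b.even) = X.res hb (b.odd 0) :=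
      ((𝔄.field j).op_res le_rfl hb _).trans (congrArg _ e1)
    have h2 : (𝔄.field j).op W hb (X.res hb (b.odd 0)) = 1 :=
      ((𝔄.field j).op_res le_rfl hb _).trans ((congrArg _ e2).trans (map_one (X.res hb)))
    have h3 : (𝔄.field i).op W ha (X.res hb b.even) =
        (𝔄.field i).op W ha (X.res hb (b.odd 0)) * X.res hb (b.odd 0) := by
      rw [hu', hu', h1, h2, mul_one]
    have h4 := congrArg (fun s => a.fn s (a.base x)) h3
    rw [a.fn_mul hz, fn_op (𝔄.isSuperconformalField i) ha hx,
      fn_op (𝔄.isSuperconformalField i) ha hx, a.fn_res hb hz, a.fn_res hb hz,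
      a.hderiv_fn_res hb hz, a.hderiv_fn_res hb hz] at h4
    exact h4

variable {a b : X.Chart} {x : C}

theorem even_coeffs (hx : x ∈ a.domain ⊓ b.domain) :
    Gr.c0 (a.fn b.even (a.base x)) = 0 ∧ Gr.c1 (a.fn b.even (a.base x)) = 0 ∧
      Gr.c2 (a.fn b.even (a.base x)) = 0 ∧ Gr.c012 (a.fn b.even (a.base x)) = 0 := by
  refine (Gr.even_iff _).1 ?_
  rw [Gr.par, ← a.fn_parity (mem_image a.base hx.2 hx.1), parity_even]

theorem odd_coeffs (hx : x ∈ a.domain ⊓ b.domain) (v : Fin 3 → ℂ) :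
    Gr.cC (a.fn (b.oddLin v) (a.base x)) = 0 ∧ Gr.c01 (a.fn (b.oddLin v) (a.base x)) = 0 ∧
      Gr.c02 (a.fn (b.oddLin v) (a.base x)) = 0 ∧ Gr.c12 (a.fn (b.oddLin v) (a.base x)) = 0 := by
  refine (Gr.odd_iff _).1 ?_
  have h := a.par_sub_ι b hx v
  rwa [sub_ι] at h

namespace IsSuperconformalTransition

variable (h : a.IsSuperconformalTransition b)
include h

theorem fn_odd_succ (hx : x ∈ a.domain ⊓ b.domain) (k : Fin 2) :
    a.fn (b.odd k.succ) (a.base x) = Gr.gen k.succ := by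
  have hz := mem_image a.base hx hx.1
  rw [← a.fn_res inf_le_right hz, ← h.param k, a.fn_res inf_le_left hz]
  exact a.fn_oddLin hz.1 _

theorem lin_succ (hx : x ∈ a.domain ⊓ b.domain) (k : Fin 2) :
    a.lin b hx (Pi.single k.succ 1) = Pi.single k.succ 1 := by
  rw [lin_apply]
  exact (congrArg ExteriorAlgebra.ιInv (h.fn_odd_succ hx k)).trans
    (ExteriorAlgebra.ι_leftInverse _)

omit h in
theorem lin_zero (hx : x ∈ a.domain ⊓ b.domain) :
    a.lin b hx (Pi.single 0 1) = ![Gr.c0 (a.fn (b.odd 0) (a.base x)),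
      Gr.c1 (a.fn (b.odd 0) (a.base x)), Gr.c2 (a.fn (b.odd 0) (a.base x))] := by
  rw [lin_apply, Gr.ιInv_eq]
  rfl

/-- As the parameters `ξ₁, ξ₂` are common to both charts, only the first column of `lin` is
nontrivial, and its determinant is `ζ`. -/
theorem map_lin (hx : x ∈ a.domain ⊓ b.domain) (c a₀ a₁ a₂ p q r k : ℂ) {ζ ψ₁ ψ₂ : ℂ}
    (h₀ : Gr.c0 (a.fn (b.odd 0) (a.base x)) = ζ) (h₁ : Gr.c1 (a.fn (b.odd 0) (a.base x)) = ψ₁)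
    (h₂ : Gr.c2 (a.fn (b.odd 0) (a.base x)) = ψ₂) :
    ExteriorAlgebra.map (a.lin b hx) (Gr.mk c a₀ a₁ a₂ p q r k) =
      Gr.mk c (a₀ * ζ) (a₀ * ψ₁ + a₁) (a₀ * ψ₂ + a₂) (p * ζ) (q * ζ) (r - p * ψ₂ + q * ψ₁)
        (k * ζ) := by
  rw [Gr.map_mk _ _ _ _ _ _ _ _ _ _ _ _ (lin_zero hx) (h.lin_succ hx 0) (h.lin_succ hx 1),
    h₀, h₁, h₂]
  simp [Pi.single_apply]
  congr 1
  ring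

/-- The coefficients of a superconformal transition map. -/
theorem coeffs (hx : x ∈ a.domain ⊓ b.domain) :
    deriv (fun z => Gr.cC (a.fn b.even z)) (a.base x) = Gr.c0 (a.fn (b.odd 0) (a.base x)) ^ 2 ∧
    Gr.c01 (a.fn b.even (a.base x)) =
      Gr.c0 (a.fn (b.odd 0) (a.base x)) * Gr.c1 (a.fn (b.odd 0) (a.base x)) ∧
    Gr.c02 (a.fn b.even (a.base x)) =
      Gr.c0 (a.fn (b.odd 0) (a.base x)) * Gr.c2 (a.fn (b.odd 0) (a.base x)) ∧
    deriv (fun z => Gr.c12 (a.fn b.even z)) (a.base x) =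
      2 * Gr.c0 (a.fn (b.odd 0) (a.base x)) * Gr.c012 (a.fn (b.odd 0) (a.base x)) +
      deriv (fun z => Gr.c1 (a.fn (b.odd 0) z)) (a.base x) *
        Gr.c2 (a.fn (b.odd 0) (a.base x)) -
      deriv (fun z => Gr.c2 (a.fn (b.odd 0) z)) (a.base x) *
        Gr.c1 (a.fn (b.odd 0) (a.base x)) := by
  have hz : a.base x ∈ imageOpens a.base b.domain := mem_image a.base hx.2 hx.1
  have hY := a.holAt_fn hz b.even
  have hH := a.holAt_fn hz (b.odd 0)
  obtain ⟨-, hY1, hY2, hY012⟩ := even_coeffs hx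
  obtain ⟨hH1, hH2, hH3, hH4⟩ := odd_coeffs hx (Pi.single 0 1)
  change Gr.cC (a.fn (b.odd 0) _) = 0 at hH1
  change Gr.c01 (a.fn (b.odd 0) _) = 0 at hH2
  change Gr.c02 (a.fn (b.odd 0) _) = 0 at hH3
  change Gr.c12 (a.fn (b.odd 0) _) = 0 at hH4
  have key := h.rel x hx
  rw [Gr.dθ_apply, Gr.dθ_apply, Gr.gen_zero_eq_mk] at key
  simp only [← map_hderiv hY, ← map_hderiv hH]
  -- The four identities are the coefficients of θ, ξ₁, ξ₂ and θξ₁ξ₂ in Dy = (Dη)η.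
  have k0 := congrArg Gr.c0 key
  have k1 := congrArg Gr.c1 key
  have k2 := congrArg Gr.c2 key
  have k3 := congrArg Gr.c012 key
  simp only [map_add, Gr.cC_mul, Gr.c0_mul, Gr.c1_mul, Gr.c2_mul, Gr.c01_mul, Gr.c02_mul,
    Gr.c12_mul, Gr.c012_mul, Gr.cC_mk, Gr.c0_mk, Gr.c1_mk, Gr.c2_mk, Gr.c01_mk, Gr.c02_mk,
    Gr.c12_mk, Gr.c012_mk, hY1, hY2, hY012, hH1, hH2, hH3, hH4] at k0 k1 k2 k3
  refine ⟨?_, ?_, ?_, ?_⟩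
  · linear_combination k0
  · linear_combination k1
  · linear_combination k2
  · linear_combination k3

section

variable [ContMDiffVectorBundle ω (Fin 3 → ℂ) E 𝓘(ℂ)] [IsManifold 𝓘(ℂ) ω C]

theorem jac_eq (hx : x ∈ a.domain ⊓ b.domain) :
    a.jac b x = Gr.c0 (a.fn (b.odd 0) (a.base x)) ^ 2 := by
  rw [← a.deriv_cC_fn_even b hx, (h.coeffs hx).1]

/-- The cubic coefficient of a superconformal transition map whose quadratic terms are removed by
changes of coordinates. -/
theorem cubic (hx : x ∈ a.domain ⊓ b.domain) {S T : ℂ → Gr} (hS : HolAt S (a.base x))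
    (hT : HolAt T (b.base x)) (hT2 : ∀ z, Gr.deg2 (T z) = T z)
    (hST : ∀ᶠ y in nhds x, ∀ hy : y ∈ a.domain ⊓ b.domain, a.nil b y =
      ExteriorAlgebra.map (a.lin b hy) (T (b.base y)) - a.jac b y • S (a.base y)) :
    Gr.c012 (a.fn (b.odd 0) (a.base x)) +
      Gr.c0 (a.fn (b.odd 0) (a.base x)) * cubicCoeff T (b.base x) -
      Gr.c0 (a.fn (b.odd 0) (a.base x)) * cubicCoeff S (a.base x) +
      Gr.c12 (S (a.base x)) * Gr.c0 (hderiv (a.fn (b.odd 0)) (a.base x)) -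
      Gr.c02 (S (a.base x)) * Gr.c1 (hderiv (a.fn (b.odd 0)) (a.base x)) +
      Gr.c01 (S (a.base x)) * Gr.c2 (hderiv (a.fn (b.odd 0)) (a.base x)) = 0 := by
  have hz : a.base x ∈ imageOpens a.base (a.domain ⊓ b.domain) := mem_image a.base hx hx.1
  have hz' : a.base x ∈ imageOpens a.base b.domain := mem_image a.base hx.2 hx.1
  have hY := a.holAt_fn hz' b.even
  have hH := a.holAt_fn hz' (b.odd 0)
  have hgx : Gr.cC (a.fn b.even (a.base x)) = b.base x := a.cC_fn_even b hx
  have hc : Filter.Tendsto a.base.symm (nhds (a.base x)) (nhds x) := by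
    have h1 := a.base.symm.continuousAt (a.base.map_source hx.1)
    rwa [ContinuousAt, a.base.left_inv hx.1] at h1
  -- The square of `ζ` is the Jacobian of the reduced transition map.
  have hζ0 : Gr.c0 (a.fn (b.odd 0) (a.base x)) ≠ 0 := fun h0 =>
    a.jac_ne_zero b hx (by rw [h.jac_eq hx, h0]; ring)
  have hζ : DifferentiableAt ℂ (fun w => Gr.c0 (a.fn (b.odd 0) w)) (a.base x) :=
    hH.differentiableAt _
  -- The coboundary relation, coefficient by coefficient. It is needed on a neighbourhood since its
  -- derivative enters; by superconformality the first two coefficients are divisible by `ζ`.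
  have key : ∀ᶠ w in nhds (a.base x),
      Gr.c1 (a.fn (b.odd 0) w) = Gr.c01 (T (Gr.cC (a.fn b.even w))) -
        Gr.c0 (a.fn (b.odd 0) w) * Gr.c01 (S w) ∧
      Gr.c2 (a.fn (b.odd 0) w) = Gr.c02 (T (Gr.cC (a.fn b.even w))) -
        Gr.c0 (a.fn (b.odd 0) w) * Gr.c02 (S w) ∧
      Gr.c12 (a.fn b.even w) = Gr.c12 (T (Gr.cC (a.fn b.even w))) -
        Gr.c01 (T (Gr.cC (a.fn b.even w))) * Gr.c2 (a.fn (b.odd 0) w) +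
        Gr.c02 (T (Gr.cC (a.fn b.even w))) * Gr.c1 (a.fn (b.odd 0) w) -
        Gr.c0 (a.fn (b.odd 0) w) ^ 2 * Gr.c12 (S w) := by
    filter_upwards [hc.eventually hST, (imageOpens a.base (a.domain ⊓ b.domain)).isOpen.mem_nhds hz,
      hζ.continuousAt.eventually_ne hζ0] with w hw hwV hw0
    have hy := hwV.2
    have hw' := hw hy
    set y := a.base.symm w
    have hay : a.base y = w := a.base.right_inv hwV.1
    obtain ⟨-, c2, c3, -⟩ := h.coeffs hy
    rw [hay] at c2 c3
    have hj := h.jac_eq hy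
    rw [hay] at hj
    rw [← a.cC_fn_even b hy, hay, hj] at hw'
    have hn : ∀ ℓ : Gr →ₗ[ℂ] ℂ, (∀ k, ℓ (algebraMap ℂ Gr k) = 0) →
        ℓ (a.nil b y) = ℓ (a.fn b.even w) := fun ℓ hℓ => by
      rw [nil, map_sub, hℓ, sub_zero, hay]
    have m1 := congrArg Gr.c01 hw'
    have m2 := congrArg Gr.c02 hw'
    have m3 := congrArg Gr.c12 hw'
    rw [hn _ Gr.c01_algebraMap] at m1
    rw [hn _ Gr.c02_algebraMap] at m2
    rw [hn _ Gr.c12_algebraMap] at m3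
    have hmap := h.map_lin hy 0 0 0 0 (Gr.c01 (T (Gr.cC (a.fn b.even w))))
      (Gr.c02 (T (Gr.cC (a.fn b.even w)))) (Gr.c12 (T (Gr.cC (a.fn b.even w)))) 0
      (congrArg (fun w => Gr.c0 (a.fn (b.odd 0) w)) hay)
      (congrArg (fun w => Gr.c1 (a.fn (b.odd 0) w)) hay)
      (congrArg (fun w => Gr.c2 (a.fn (b.odd 0) w)) hay)
    have hmap' := (congrArg (ExteriorAlgebra.map (a.lin b hy))
      (hT2 (Gr.cC (a.fn b.even w))).symm).trans hmap
    rw [hmap'] at m1 m2 m3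
    simp only [map_sub, map_smul, Gr.c01_mk, Gr.c02_mk, Gr.c12_mk, smul_eq_mul] at m1 m2 m3
    refine ⟨mul_left_cancel₀ hw0 ?_, mul_left_cancel₀ hw0 ?_, ?_⟩
    · linear_combination m1 - c2
    · linear_combination m2 - c3
    · linear_combination m3
  obtain ⟨d1, -, -, d4⟩ := h.coeffs hx
  have hT' : HolAt T (Gr.cC (a.fn b.even (a.base x))) := by rwa [hgx]
  have hg : HasDerivAt (fun w => Gr.cC (a.fn b.even w))
      (Gr.c0 (a.fn (b.odd 0) (a.base x)) ^ 2) (a.base x) := by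
    rw [← d1]
    exact (hY.differentiableAt _).hasDerivAt
  have fin := cubic_identity (t := fun w => Gr.c12 (S w)) (s₁ := fun w => Gr.c01 (S w))
    (s₂ := fun w => Gr.c02 (S w)) (Bt := fun w => Gr.c12 (T w)) (B₁ := fun w => Gr.c01 (T w))
    (B₂ := fun w => Gr.c02 (T w)) (ζ := fun w => Gr.c0 (a.fn (b.odd 0) w)) hg hζ
    (hS.differentiableAt _) (hS.differentiableAt _) (hS.differentiableAt _)
    (hT'.differentiableAt _) (hT'.differentiableAt _) (hT'.differentiableAt _) hζ0
    (key.mono fun _ hk => hk.1) (key.mono fun _ hk => hk.2.1) (key.mono fun _ hk => hk.2.2) d4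
  simp only [hgx] at fin
  simp only [cubicCoeff, map_hderiv hS, map_hderiv hT, map_hderiv hH]
  exact fin

end

end IsSuperconformalTransition

end Supermanifold.Chart

/-! ### Changes of coordinates -/

namespace Gr

/-- The value at a point of the change of coordinates with quadratic coefficients `n` in the even
coordinate and cubic coefficient `k` in the first odd coordinate, applied to a function with value
`l` and derivative `l'`. -/
def shift (n : Gr) (k : ℂ) (l l' : Gr) : Gr := l + n * l' + (k * c0 l) • mk 0 0 0 0 0 0 0 1

theorem mk_smul (k c a₀ a₁ a₂ p q r h : ℂ) : k • mk c a₀ a₁ a₂ p q r h =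
    mk (k * c) (k * a₀) (k * a₁) (k * a₂) (k * p) (k * q) (k * r) (k * h) := by
  simp only [mk]; module

/-- The correction to `l` is a derivation that raises the degree by two: `x` gains `n` and `θ` gains
a multiple of the top product. Products of two corrections have degree at least four, so the
identity plus this derivation is already multiplicative. -/
theorem shift_mul {n : Gr} (hn : deg2 n = n) (k : ℂ) (l m l' m' : Gr) :
    shift n k (l * m) (l' * m + l * m') = shift n k l l' * shift n k m m' := by
  obtain ⟨_, _, _, _, _, _, _, _, rfl⟩ := exists_eq_mk l
  obtain ⟨_, _, _, _, _, _, _, _, rfl⟩ := exists_eq_mk l'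
  obtain ⟨_, _, _, _, _, _, _, _, rfl⟩ := exists_eq_mk m
  obtain ⟨_, _, _, _, _, _, _, _, rfl⟩ := exists_eq_mk m'
  rw [← hn]
  simp only [deg2, shift, mk_mul, mk_add, mk_smul, c0_mk]
  congr 1 <;> ring

theorem shift_low {n : Gr} (hn : deg2 n = n) (k : ℂ) (l l' : Gr) :
    cC (shift n k l l') = cC l ∧ c0 (shift n k l l') = c0 l ∧ c1 (shift n k l l') = c1 l ∧
      c2 (shift n k l l') = c2 l := by
  rw [← hn]
  refine ⟨?_, ?_, ?_, ?_⟩ <;>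
    simp [shift, deg2, mul_eq_mk, cC_mk, c0_mk, c1_mk, c2_mk]

/-- The correction depends only on components of degree at most one, which a shift leaves unchanged.
Corrections therefore do not interact, and opposite coefficients give the inverse. -/
theorem shift_shift {n : Gr} (hn : deg2 n = n) (k : ℂ) {l l' m' : Gr} (hC : cC m' = cC l')
    (h0 : c0 m' = c0 l') (h1 : c1 m' = c1 l') (h2 : c2 m' = c2 l') :
    shift (-n) (-k) (shift n k l l') m' = l := by
  have e : n * m' = n * l' := by
    rw [← hn]
    simp only [deg2, mul_eq_mk, cC_mk, c0_mk, c1_mk, c2_mk, c01_mk, c02_mk, c12_mk, c012_mk, hC,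
      h0, h1, h2]
    congr 1 <;> ring
  rw [shift, (shift_low hn k l l').2.1, neg_mul, e, shift]
  module

theorem deg2_neg {n : Gr} (hn : deg2 n = n) : deg2 (-n) = -n := by
  rw [← neg_one_smul ℂ n, deg2_smul, hn]

end Gr

theorem HolAt.shift {N F : ℂ → Gr} {κ : ℂ → ℂ} {z : ℂ} (hN : HolAt N z) (hκ : HolAt κ z)
    (hF : HolAt F z) :
    HolAt (fun w => Gr.shift (N w) (κ w) (F w) (SuperGeom.hderiv F w)) z :=
  (hF.add (hN.mul hF.hderiv)).add (((hκ.mul (hF.map Gr.c0)).smul (HolAt.const _)))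

theorem shift_hderiv_shift {N F : ℂ → Gr} {κ : ℂ → ℂ} {z : ℂ} (hN : HolAt N z) (hκ : HolAt κ z)
    (hF : HolAt F z) (hN2 : ∀ w, Gr.deg2 (N w) = N w) :
    Gr.shift (-N z) (-κ z) (Gr.shift (N z) (κ z) (F z) (hderiv F z))
      (hderiv (fun w => Gr.shift (N w) (κ w) (F w) (hderiv F w)) z) = F z := by
  have hG := HolAt.shift hN hκ hF
  refine Gr.shift_shift (hN2 z) (κ z) ?_ ?_ ?_ ?_ <;> rw [map_hderiv hG, map_hderiv hF] <;>
    congr 1 <;> funext w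
  exacts [(Gr.shift_low (hN2 w) _ _ _).1, (Gr.shift_low (hN2 w) _ _ _).2.1,
    (Gr.shift_low (hN2 w) _ _ _).2.2.1, (Gr.shift_low (hN2 w) _ _ _).2.2.2]

namespace superAffine

/-- The coefficients of a change of coordinates over `V`. -/
structure ShiftData (V : Opens ℂ) where
  N : ℂ → Gr
  κ : ℂ → ℂ
  holAt_N : ∀ z ∈ V, HolAt N z
  holAt_κ : ∀ z ∈ V, HolAt κ z
  deg2_N : ∀ z, Gr.deg2 (N z) = N z

namespace ShiftData

variable {V V' V'' : Opens ℂ} (S : ShiftData V)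

/-- The opposite coefficients. -/
def neg : ShiftData V :=
  ⟨fun z => -S.N z, fun z => -S.κ z, fun z hz => (S.holAt_N z hz).neg,
    fun z hz => (S.holAt_κ z hz).neg, fun z => Gr.deg2_neg (S.deg2_N z)⟩

/-- A change of coordinates applied to functions. -/
def app (F : ℂ → Gr) (z : ℂ) : Gr := Gr.shift (S.N z) (S.κ z) (F z) (hderiv F z)

theorem holAt_app {F : ℂ → Gr} {z : ℂ} (hz : z ∈ V) (hF : HolAt F z) : HolAt (S.app F) z :=
  HolAt.shift (S.holAt_N z hz) (S.holAt_κ z hz) hF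

theorem app_congr {F G : ℂ → Gr} {z : ℂ} (h : F =ᶠ[nhds z] G) : S.app F z = S.app G z := by
  rw [app, app, hderiv_congr h, h.eq_of_nhds]

theorem neg_app_app {F : ℂ → Gr} {z : ℂ} (hz : z ∈ V) (hF : HolAt F z) :
    S.neg.app (S.app F) z = F z :=
  shift_hderiv_shift (S.holAt_N z hz) (S.holAt_κ z hz) hF S.deg2_N

theorem app_neg_app {F : ℂ → Gr} {z : ℂ} (hz : z ∈ V) (hF : HolAt F z) :
    S.app (S.neg.app F) z = F z := by
  have h := S.neg.neg_app_app hz hF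
  have e : S.neg.neg = S := by simp [neg]
  rwa [e] at h

theorem ev_eventuallyEq {F : (superAffine 3).sections V'} {f : ℂ → Gr} (h : ∀ z ∈ V', ev F z = f z)
    {z : ℂ} (hz : z ∈ V') : ev F =ᶠ[nhds z] f := by
  filter_upwards [V'.isOpen.mem_nhds hz] with w hw using h w hw

theorem app_const (k : ℂ) (z : ℂ) : S.app (fun _ => algebraMap ℂ Gr k) z = algebraMap ℂ Gr k := by
  rw [app, Gr.shift, hderiv_const, Gr.c0_algebraMap, mul_zero, mul_zero, zero_smul, add_zero,
    add_zero]

/-- A change of coordinates applied to superfunctions. -/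
def hom (hV : V' ≤ V) : (superAffine 3).sections V' →ₐ[ℂ] (superAffine 3).sections V' where
  toFun F := ofFun V' (S.app (ev F)) fun z hz => S.holAt_app (hV hz) (holAt_ev hz F)
  map_one' := ext fun z hz => by
    have h := S.app_congr (ev_eventuallyEq (F := 1) (f := fun _ => algebraMap ℂ Gr 1)
      (fun w hw => by rw [← evHom_apply hw, map_one, map_one]) hz)
    rw [ev_ofFun _ hz, h, app_const, ← evHom_apply hz, map_one, map_one]
  map_mul' F G := ext fun z hz => by
    have h := S.app_congr (ev_eventuallyEq (F := F * G) (f := fun w => ev F w * ev G w)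
      (fun w hw => by rw [← evHom_apply hw, map_mul]; rfl) hz)
    rw [ev_ofFun _ hz, h, ← evHom_apply hz (_ * _), map_mul, evHom_apply, evHom_apply,
      ev_ofFun _ hz, ev_ofFun _ hz, app, hderiv_mul (holAt_ev hz F) (holAt_ev hz G),
      Gr.shift_mul (S.deg2_N z)]
    rfl
  map_zero' := ext fun z hz => by
    have h := S.app_congr (ev_eventuallyEq (F := 0) (f := fun _ => algebraMap ℂ Gr 0)
      (fun w hw => by rw [← evHom_apply hw, map_zero, map_zero]) hz)
    rw [ev_ofFun _ hz, h, app_const, ← evHom_apply hz, map_zero, map_zero]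
  map_add' F G := ext fun z hz => by
    have h := S.app_congr (ev_eventuallyEq (F := F + G) (f := fun w => ev F w + ev G w)
      (fun w hw => by rw [← evHom_apply hw, map_add]; rfl) hz)
    rw [ev_ofFun _ hz, h, ← evHom_apply hz (_ + _), map_add, evHom_apply, evHom_apply,
      ev_ofFun _ hz, ev_ofFun _ hz, app, hderiv_add (holAt_ev hz F) (holAt_ev hz G), app, app,
      Gr.shift, Gr.shift, Gr.shift, map_add, mul_add, mul_add]
    module
  commutes' k := ext fun z hz => by
    have h := S.app_congr (ev_eventuallyEq (F := algebraMap ℂ _ k) (f := fun _ => algebraMap ℂ Gr k)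
      (fun w hw => by rw [← evHom_apply hw, AlgHom.commutes]) hz)
    rw [ev_ofFun _ hz, h, app_const, ← evHom_apply hz, AlgHom.commutes]

theorem ev_hom (hV : V' ≤ V) (F : (superAffine 3).sections V') {z : ℂ} (hz : z ∈ V') :
    ev (S.hom hV F) z = S.app (ev F) z :=
  ev_ofFun (fun _ hz => S.holAt_app (hV hz) (holAt_ev hz F)) hz

theorem neg_hom_hom (hV : V' ≤ V) (F : (superAffine 3).sections V') :
    S.neg.hom hV (S.hom hV F) = F := ext fun z hz => by
  rw [ev_hom _ hV _ hz, S.neg.app_congr (ev_eventuallyEq (fun w hw => S.ev_hom hV F hw) hz),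
    S.neg_app_app (hV hz) (holAt_ev hz F)]

theorem hom_neg_hom (hV : V' ≤ V) (F : (superAffine 3).sections V') :
    S.hom hV (S.neg.hom hV F) = F := ext fun z hz => by
  rw [ev_hom _ hV _ hz, S.app_congr (ev_eventuallyEq (fun w hw => S.neg.ev_hom hV F hw) hz),
    S.app_neg_app (hV hz) (holAt_ev hz F)]

theorem hom_res (hV : V' ≤ V) (h : V'' ≤ V') (F : (superAffine 3).sections V') :
    S.hom (h.trans hV) ((superAffine 3).res h F) = (superAffine 3).res h (S.hom hV F) :=
  ext fun z hz => by
    rw [ev_hom _ _ _ hz, ev_res h hz, ev_hom _ _ _ (h hz)]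
    exact S.app_congr (ev_eventuallyEq (fun w hw => ev_res h hw F) hz)

theorem hom_parity (hV : V' ≤ V) (F : (superAffine 3).sections V') :
    S.hom hV ((superAffine 3).parity V' F) = (superAffine 3).parity V' (S.hom hV F) :=
  ext fun z hz => by
    have hd : hderiv (fun w => Gr.par (ev F w)) z = Gr.par (hderiv (ev F) z) :=
      hderiv_map (holAt_ev hz F) Gr.par.toLinearMap
    rw [ev_hom _ _ _ hz, ev_parity hz, ev_hom _ _ _ hz,
      S.app_congr (ev_eventuallyEq (fun w hw => ev_parity hw F) hz), app, app, hd]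
    -- The change of coordinates preserves parity because `N` is purely quadratic, hence even, and
    -- `vol` is odd like `θ`.
    have hN := (Gr.even_iff (S.N z)).2 (by
      rw [← S.deg2_N z, Gr.deg2]
      exact ⟨Gr.c0_mk _ _ _ _ _ _ _ _, Gr.c1_mk _ _ _ _ _ _ _ _, Gr.c2_mk _ _ _ _ _ _ _ _,
        Gr.c012_mk _ _ _ _ _ _ _ _⟩)
    have h0 : ∀ l, Gr.c0 (Gr.par l) = -Gr.c0 l := fun l => by
      obtain ⟨_, _, _, _, _, _, _, _, rfl⟩ := Gr.exists_eq_mk l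
      rw [Gr.par_mk, Gr.c0_mk, Gr.c0_mk]
    have hv : Gr.par (Gr.mk 0 0 0 0 0 0 0 1) = -Gr.mk 0 0 0 0 0 0 0 1 := by
      rw [Gr.par_mk]; simp [Gr.mk]
    change Gr.shift (S.N z) (S.κ z) (Gr.par (ev F z)) (Gr.par (hderiv (ev F) z)) =
      Gr.par (Gr.shift (S.N z) (S.κ z) (ev F z) (hderiv (ev F) z))
    rw [Gr.shift, Gr.shift, h0, map_add, map_add, map_mul, hN, map_smul, hv]
    module

theorem body_hom (hV : V' ≤ V) (F : (superAffine 3).sections V') (z : V') :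
    (superAffine 3).body V' (S.hom hV F) z = (superAffine 3).body V' F z := by
  have h1 := body_eq z.2 (S.hom hV F)
  have h2 := body_eq z.2 F
  rw [← Gr.cC_eq] at h1 h2
  refine h1.trans (Eq.trans ?_ h2.symm)
  rw [ev_hom _ _ _ z.2]
  exact (Gr.shift_low (S.deg2_N _) _ _ _).1

/-- A change of coordinates as an isomorphism of an open part of `ℂ^{1|3}` with itself. -/
def iso : PartialIso (superAffine 3) (superAffine 3)
    (OpenPartialHomeomorph.ofSet (V : Set ℂ) V.isOpen) where
  pull V' hV := (AlgEquiv.ofAlgHom (S.hom hV) (S.neg.hom hV) (AlgHom.ext (S.hom_neg_hom hV))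
    (AlgHom.ext (S.neg_hom_hom hV))).trans ((superAffine 3).resEquiv
      (Opens.ext (Set.inter_eq_right.2 hV).symm))
  pull_res hV hV' h F := by
    simp only [AlgEquiv.trans_apply, SuperSpace.resEquiv_apply, AlgEquiv.ofAlgHom_apply]
    rw [S.hom_res hV h, SuperSpace.res_res, SuperSpace.res_res]
  pull_parity V' hV F := by
    have h : preimOpens (OpenPartialHomeomorph.ofSet (V : Set ℂ) V.isOpen) V' ≤ V' := fun _ h => h.2
    exact (congrArg ((superAffine 3).res h) (S.hom_parity hV F)).trans
      ((superAffine 3).parity_res h (S.hom hV F)).symm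
  body_pull V' hV F z := by
    have h : preimOpens (OpenPartialHomeomorph.ofSet (V : Set ℂ) V.isOpen) V' ≤ V' := fun _ h => h.2
    exact ((superAffine 3).body_res h (S.hom hV F) z).trans (S.body_hom hV F ⟨z.1, h z.2⟩)

theorem ev_iso_pull (hV : (V' : Set ℂ) ⊆ V) (F : (superAffine 3).sections V') {z : ℂ}
    (hz : z ∈ preimOpens (OpenPartialHomeomorph.ofSet (V : Set ℂ) V.isOpen) V') :
    ev (S.iso.pull V' hV F) z = S.app (ev F) z := by
  have h1 : preimOpens (OpenPartialHomeomorph.ofSet (V : Set ℂ) V.isOpen) V' ≤ V' := fun _ h => h.2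
  have h2 : S.iso.pull V' hV F = (superAffine 3).res h1 (S.hom hV F) := rfl
  rw [h2, ev_res h1 hz, ev_hom _ hV _ hz.2]

end ShiftData

end superAffine

/-! ### Superconformal atlases with trivial obstruction class -/

namespace Gr

/-- The product of the generators. -/
def vol : Gr := mk 0 0 0 0 0 0 0 1

theorem ιInv_vol : ExteriorAlgebra.ιInv vol = 0 := by
  rw [ιInv_eq, vol, c0_mk, c1_mk, c2_mk]
  ext i; fin_cases i <;> rfl

theorem mul_smul_vol {n : Gr} (hn : deg2 n = n) (k : ℂ) : n * (k • vol) = 0 := by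
  rw [← hn, vol, deg2, mk_smul, mk_mul]
  simp [mk]

theorem c012_shift {n : Gr} (hn : deg2 n = n) (k : ℂ) (l l' : Gr) :
    c012 (shift n k l l') =
      c012 l + (c12 n * c0 l' - c02 n * c1 l' + c01 n * c2 l') + k * c0 l := by
  obtain ⟨_, _, _, _, _, _, _, _, rfl⟩ := exists_eq_mk l
  obtain ⟨_, _, _, _, _, _, _, _, rfl⟩ := exists_eq_mk l'
  rw [← hn]
  simp only [deg2, shift, mk_mul, mk_add, mk_smul, c0_mk, c1_mk, c2_mk, c01_mk, c02_mk, c12_mk,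
    c012_mk]
  ring

end Gr

/-! ### Charts and transition maps after a change of coordinates -/

namespace Supermanifold.Chart

open superAffine

variable {C : Type u} [TopologicalSpace C] [ChartedSpace ℂ C] {E : C → Type u}
    [∀ x, AddCommGroup (E x)] [∀ x, Module ℂ (E x)] [∀ x, TopologicalSpace (E x)]
    [TopologicalSpace (Bundle.TotalSpace (Fin 3 → ℂ) E)] [FiberBundle (Fin 3 → ℂ) E]
    [VectorBundle ℂ (Fin 3 → ℂ) E] [ContMDiffVectorBundle ω (Fin 3 → ℂ) E 𝓘(ℂ)]
    [IsManifold 𝓘(ℂ) ω C] {X : Supermanifold 3 E}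

section

variable (a : X.Chart) {V : Opens ℂ} (S : ShiftData V) {W : Opens C} {x : C} {z : ℂ}

/-- A chart after a change of coordinates. -/
def shifted : X.Chart :=
  ⟨_, X.mem_maximalAtlas_of_partialIso (a.iso.trans S.iso), a.iso.trans S.iso⟩

theorem shifted_base : (a.shifted S).base x = a.base x := rfl

theorem shifted_base_symm : (a.shifted S).base.symm z = a.base.symm z := rfl

theorem mem_shifted_domain : x ∈ (a.shifted S).domain ↔ x ∈ a.domain ∧ a.base x ∈ V := by
  change x ∈ (a.base.trans (OpenPartialHomeomorph.ofSet (V : Set ℂ) V.isOpen)).source ↔ _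
  rw [OpenPartialHomeomorph.trans_source]
  rfl

theorem mem_of_mem_shifted_image (hz : z ∈ imageOpens (a.shifted S).base W) :
    z ∈ V ∧ z ∈ imageOpens a.base W := by
  have h1 : z ∈ (a.base.trans (OpenPartialHomeomorph.ofSet (V : Set ℂ) V.isOpen)).target := hz.1
  rw [OpenPartialHomeomorph.trans_target] at h1
  exact ⟨h1.1, h1.2, hz.2⟩

/-- The shifted chart pulls back through `S` first and then through `a`. Thus `S` turns expressions
in the new coordinates into expressions in the old ones, and `S.neg` goes the other way. -/
theorem fn_eq_app (hz : z ∈ imageOpens (a.shifted S).base W) (s : X.sections W) :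
    a.fn s z = S.app ((a.shifted S).fn s) z := by
  set U := imageOpens (a.shifted S).base W
  have hU : (U : Set ℂ) ⊆ (a.shifted S).base.target := image_subset_target _ _
  have e1 : (a.shifted S).iso.pull U hU ((a.shifted S).express s) =
      X.res (preim_image_le (a.shifted S).base W) s := AlgEquiv.apply_symm_apply _ _
  have hz1 := (a.mem_of_mem_shifted_image S hz)
  have hzs := symm_mem_preimOpens hU hz
  have hz2 : z ∈ imageOpens a.base (preimOpens (a.shifted S).base U) := ⟨hz1.2.1, hzs⟩
  have hz3 : z ∈ preimOpens (OpenPartialHomeomorph.ofSet (V : Set ℂ) V.isOpen) U := ⟨hz1.1, hz⟩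
  have e2 : (a.shifted S).iso.pull U hU ((a.shifted S).express s) =
      X.res (preimOpens_trans _ _ U).ge (a.iso.pull _ (preimOpens_subset_target hU)
        (S.iso.pull U (subset_target_of_trans hU) ((a.shifted S).express s))) := rfl
  rw [← a.fn_res (preim_image_le (a.shifted S).base W) hz2, ← e1, e2]
  refine (a.fn_res (preimOpens_trans _ _ U).ge hz2 _).trans ?_
  refine (a.fn_pull_of_mem (preimOpens_subset_target hU) hz3 _).trans ?_
  exact S.ev_iso_pull (subset_target_of_trans hU) _ hz3

theorem fn_shifted (hz : z ∈ imageOpens (a.shifted S).base W) (s : X.sections W) :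
    (a.shifted S).fn s z = S.neg.app (a.fn s) z := by
  have h : a.fn s =ᶠ[nhds z] S.app ((a.shifted S).fn s) := by
    filter_upwards [(imageOpens (a.shifted S).base W).isOpen.mem_nhds hz] with w hw
    exact a.fn_eq_app S hw s
  rw [S.neg.app_congr h, S.neg_app_app (a.mem_of_mem_shifted_image S hz).1
    ((a.shifted S).holAt_fn hz s)]

variable (hx : x ∈ (a.shifted S).domain)
include hx

theorem fn_shifted_even :
    a.fn (a.shifted S).even (a.base x) = algebraMap ℂ Gr (a.base x) + S.N (a.base x) := by
  have hz : a.base x ∈ imageOpens (a.shifted S).base (a.shifted S).domain :=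
    mem_image (a.shifted S).base hx hx
  have h : (a.shifted S).fn (a.shifted S).even =ᶠ[nhds (a.base x)]
      fun w => Algebra.linearMap ℂ Gr w := by
    filter_upwards [(imageOpens (a.shifted S).base (a.shifted S).domain).isOpen.mem_nhds hz]
      with w hw
    exact (a.shifted S).fn_even hw.1
  have hid : HolAt (fun w : ℂ => w) (a.base x) := holAt_iff.2 contMDiffAt_id
  have h1 : hderiv (fun w : ℂ => w) (a.base x) = 1 := by
    have h2 := map_hderiv hid LinearMap.id
    simpa using h2
  rw [a.fn_eq_app S hz, S.app_congr h, ShiftData.app, hderiv_map hid, h1, Gr.shift]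
  change algebraMap ℂ Gr (a.base x) + _ * algebraMap ℂ Gr 1 + _ = _
  rw [map_one, mul_one, Algebra.linearMap_apply, Gr.c0_algebraMap, mul_zero, zero_smul, add_zero]

theorem fn_shifted_oddLin (v : Fin 3 → ℂ) : a.fn ((a.shifted S).oddLin v) (a.base x) =
    ExteriorAlgebra.ι ℂ v + (S.κ (a.base x) * v 0) • Gr.vol := by
  have hz : a.base x ∈ imageOpens (a.shifted S).base (a.shifted S).domain :=
    mem_image (a.shifted S).base hx hx
  have h : (a.shifted S).fn ((a.shifted S).oddLin v) =ᶠ[nhds (a.base x)]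
      fun w => ExteriorAlgebra.ι ℂ v := by
    filter_upwards [(imageOpens (a.shifted S).base (a.shifted S).domain).isOpen.mem_nhds hz]
      with w hw
    exact (a.shifted S).fn_oddLin hw.1 v
  rw [a.fn_eq_app S hz, S.app_congr h, ShiftData.app, hderiv_const, Gr.shift, mul_zero, add_zero,
    Gr.c0_ι]
  rfl

theorem nil_shifted : a.nil (a.shifted S) x = S.N (a.base x) := by
  rw [nil, a.fn_shifted_even S hx, shifted_base, add_sub_cancel_left]

theorem lin_shifted (hx' : x ∈ a.domain ⊓ (a.shifted S).domain) :
    a.lin (a.shifted S) hx' = LinearMap.id := LinearMap.ext fun v => by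
  rw [lin_apply, a.fn_shifted_oddLin S hx, map_add, map_smul, Gr.ιInv_vol, smul_zero, add_zero]
  exact ExteriorAlgebra.ι_leftInverse v

end

theorem jac_self (a : X.Chart) {x : C} (hx : x ∈ a.domain) : a.jac a x = 1 := by
  have h := congrArg (dFun a.base x) (a.partialDeriv_eq a ⟨hx, hx⟩)
  rw [map_smul, a.dFun_partialDeriv hx, smul_eq_mul, mul_one] at h
  exact h.symm

section

variable {a b : X.Chart} {Va Vb : Opens ℂ} (S : ShiftData Va) (T : ShiftData Vb) {x : C}

/-- The even coordinate of the new target chart is expanded from `a` in two ways, through the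
shifted `a` and through `b`. A shift has identity linear part and Jacobian one, so the quadratic
terms change exactly by a coboundary. -/
theorem nil_shifted_shifted (hx : x ∈ (a.shifted S).domain) (hx' : x ∈ (b.shifted T).domain)
    (hab : x ∈ a.domain ⊓ b.domain) : (a.shifted S).nil (b.shifted T) x = a.nil b x +
      ExteriorAlgebra.map (a.lin b hab) (T.N (b.base x)) - a.jac b x • S.N (a.base x) := by
  have haa : x ∈ a.domain ⊓ (a.shifted S).domain := ⟨hab.1, hx⟩
  have h1 := a.nil_comp (a.shifted S) (b.shifted T) haa.1 haa.2 hx'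
  have h2 := a.nil_comp b (b.shifted T) hab.1 hab.2 hx'
  rw [a.nil_shifted S hx, a.lin_shifted S hx haa, ExteriorAlgebra.map_id, AlgHom.id_apply] at h1
  have h3 : (a.shifted S).jac (b.shifted T) x = a.jac b x := rfl
  have h4 : b.jac (b.shifted T) x = 1 := b.jac_self hab.2
  rw [b.nil_shifted T hx', h4, one_smul, h1, h3] at h2
  rw [eq_sub_iff_add_eq, h2, add_comm]

namespace IsSuperconformalTransition

variable (h : a.IsSuperconformalTransition b)
include h

/-- The cubic term added in the chart `b` is multiplied by the determinant `ζ` of the linear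
substitution; its Taylor correction vanishes for reasons of degree. -/
theorem fn_oddLin_shifted (hx : x ∈ a.domain ⊓ b.domain) (hx' : x ∈ (b.shifted T).domain)
    (v : Fin 3 → ℂ) : a.fn ((b.shifted T).oddLin v) (a.base x) = a.fn (b.oddLin v) (a.base x) +
      (T.κ (b.base x) * v 0 * Gr.c0 (a.fn (b.odd 0) (a.base x))) • Gr.vol := by
  have hvol : ∀ k : ℂ, a.sub b hx (k • Gr.vol) =
      (k * Gr.c0 (a.fn (b.odd 0) (a.base x))) • Gr.vol := fun k => by
    rw [map_smul, a.sub_eq b hx, Gr.ιInv_vol, map_zero, map_zero, map_zero, zero_smul, add_zero,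
      Gr.vol, h.map_lin hx 0 0 0 0 0 0 0 1 rfl rfl rfl, Gr.mk_smul, Gr.mk_smul]
    simp
  have hz := mem_image (b.shifted T).base hx' hx'
  have hκ : HolAt (fun w => T.κ w * v 0) (b.base x) :=
    (T.holAt_κ _ (b.mem_of_mem_shifted_image T hz).1).mul (HolAt.const _)
  have he : b.fn ((b.shifted T).oddLin v) =ᶠ[nhds (b.base x)]
      fun w => ExteriorAlgebra.ι ℂ v + LinearMap.toSpanSingleton ℂ Gr Gr.vol (T.κ w * v 0) := by
    filter_upwards [(imageOpens (b.shifted T).base (b.shifted T).domain).isOpen.mem_nhds hz]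
      with w hw
    have h1 := b.fn_shifted_oddLin T hw.2 v
    rwa [shifted_base_symm, b.base.right_inv (b.mem_of_mem_shifted_image T hw).2.1] at h1
  rw [a.taylor b hx hx', b.fn_shifted_oddLin T hx', map_add, a.sub_ι b hx, hvol, hderiv_congr he,
    hderiv_add (HolAt.const _) (hκ.map _), hderiv_const, zero_add, hderiv_map hκ,
    LinearMap.toSpanSingleton_apply, hvol, Gr.mul_smul_vol (a.nil_eq b hx).symm, add_zero]

theorem fn_oddLin_eq (hx : x ∈ a.domain ⊓ b.domain) (v : Fin 3 → ℂ) :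
    a.fn (b.oddLin v) (a.base x) =
      v 0 • a.fn (b.odd 0) (a.base x) + (v 1 • Gr.gen 1 + v 2 • Gr.gen 2) := by
  have e : v = v 0 • Pi.single 0 1 + v 1 • Pi.single 1 1 + v 2 • Pi.single 2 1 := by
    ext i; fin_cases i <;> simp
  have h1 : a.fn (b.oddLin (Pi.single 1 1)) (a.base x) = Gr.gen 1 := h.fn_odd_succ hx 0
  have h2 : a.fn (b.oddLin (Pi.single 2 1)) (a.base x) = Gr.gen 2 := h.fn_odd_succ hx 1
  have h0 : a.fn (b.oddLin (Pi.single 0 1)) (a.base x) = a.fn (b.odd 0) (a.base x) := rfl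
  rw [← h0, ← h1, ← h2, ← a.sub_ι b hx, ← a.sub_ι b hx, ← a.sub_ι b hx, ← a.sub_ι b hx]
  conv_lhs => rw [e]
  simp only [map_add, map_smul, add_assoc]

/-- The changes of coordinates given by a trivialisation of the obstruction cocycle make the
transition map linear. -/
theorem isLinearTransition {Sa Sb : ℂ → Gr} (hSa : ∀ z, S.N z = -Sa z) (hSb : ∀ z, T.N z = -Sb z)
    (hSκ : ∀ z, S.κ z = cubicCoeff Sa z) (hTκ : ∀ z, T.κ z = cubicCoeff Sb z)
    (hST : ∀ y, y ∈ (a.shifted S).domain → y ∈ (b.shifted T).domain →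
      ∀ hy : y ∈ a.domain ⊓ b.domain, a.nil b y =
        ExteriorAlgebra.map (a.lin b hy) (Sb (b.base y)) - a.jac b y • Sa (a.base y)) :
    (a.shifted S).IsLinearTransition (b.shifted T) := by
  intro x hx
  have hxa := (a.mem_shifted_domain S).1 hx.1
  have hxb := (b.mem_shifted_domain T).1 hx.2
  have hab : x ∈ a.domain ⊓ b.domain := ⟨hxa.1, hxb.1⟩
  have hz : a.base x ∈ imageOpens (a.shifted S).base (b.shifted T).domain :=
    mem_image (a.shifted S).base hx.2 hx.1
  refine ⟨?_, fun v => ?_⟩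
  -- The even coordinate: the quadratic data were chosen to cancel the cocycle.
  · rw [nil_shifted_shifted S T hx.1 hx.2 hab, hST x hx.1 hx.2 hab, hSa, hSb, map_neg, smul_neg]
    abel
  · have hSa' : ∀ z, Sa z = -S.N z := fun z => by rw [hSa, neg_neg]
    have hSb' : ∀ z, Sb z = -T.N z := fun z => by rw [hSb, neg_neg]
    have hol : HolAt Sa (a.base x) :=
      (S.holAt_N _ hxa.2).neg.congr (Filter.Eventually.of_forall hSa')
    have hol' : HolAt Sb (b.base x) :=
      (T.holAt_N _ hxb.2).neg.congr (Filter.Eventually.of_forall hSb')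
    have key := h.cubic hab hol hol' (fun z => by rw [hSb', Gr.deg2_neg (T.deg2_N z)]) (by
      filter_upwards [(a.shifted S).domain.isOpen.mem_nhds hx.1,
        (b.shifted T).domain.isOpen.mem_nhds hx.2] with y hy hy' using hST y hy hy')
    have hF := a.holAt_fn (a.mem_of_mem_shifted_image S hz).2 ((b.shifted T).oddLin v)
    have hH := a.holAt_fn (mem_image a.base hab.2 hab.1) (b.odd 0)
    -- The shift in the source chart involves only the degree-one coefficients of this derivative.
    -- They do not see the added multiple of `vol`, and `ξ₁, ξ₂` are constant, so only `v 0`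
    -- contributes.
    have hd : ∀ ℓ : Gr →ₗ[ℂ] ℂ, ℓ Gr.vol = 0 →
        ℓ (hderiv (a.fn ((b.shifted T).oddLin v)) (a.base x)) =
          v 0 * ℓ (hderiv (a.fn (b.odd 0)) (a.base x)) := fun ℓ hℓ => by
      rw [map_hderiv hF, map_hderiv hH]
      have he : (fun w => ℓ (a.fn ((b.shifted T).oddLin v) w)) =ᶠ[nhds (a.base x)]
          fun w => v 0 * ℓ (a.fn (b.odd 0) w) + ℓ (v 1 • Gr.gen 1 + v 2 • Gr.gen 2) := by
        filter_upwards [(imageOpens (a.shifted S).base (b.shifted T).domain).isOpen.mem_nhds hz]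
          with w hw
        have hw' := (a.mem_of_mem_shifted_image S hw).2.1
        have hy : a.base.symm w ∈ a.domain ⊓ b.domain :=
          ⟨a.base.map_target hw', ((b.mem_shifted_domain T).1 hw.2).1⟩
        have h1 := h.fn_oddLin_shifted T hy hw.2 v
        rw [h.fn_oddLin_eq hy, a.base.right_inv hw'] at h1
        rw [h1, map_add, map_add, map_smul, map_smul, hℓ, smul_zero, add_zero, smul_eq_mul]
      rw [he.deriv_eq, deriv_add_const, deriv_const_mul _ (hH.differentiableAt ℓ)]
    have hv : ∀ ℓ : Gr →ₗ[ℂ] ℂ, ℓ (a.fn ((b.shifted T).oddLin v) (a.base x)) =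
        v 0 * ℓ (a.fn (b.odd 0) (a.base x)) + (v 1 * ℓ (Gr.gen 1) + v 2 * ℓ (Gr.gen 2)) +
        (T.κ (b.base x) * v 0 * Gr.c0 (a.fn (b.odd 0) (a.base x))) * ℓ Gr.vol := fun ℓ => by
      rw [h.fn_oddLin_shifted T hab hx.2 v, h.fn_oddLin_eq hab]
      simp only [map_add, map_smul, smul_eq_mul]
    have hg : ∀ i, Gr.c0 (Gr.gen i) = (Pi.single i 1 : Fin 3 → ℂ) 0 ∧ Gr.c012 (Gr.gen i) = 0 :=
      fun i => ⟨Gr.c0_ι _, Gr.c012_ι _⟩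
    have e0 : Gr.c0 Gr.vol = 0 := Gr.c0_mk _ _ _ _ _ _ _ _
    have e1 : Gr.c1 Gr.vol = 0 := Gr.c1_mk _ _ _ _ _ _ _ _
    have e2 : Gr.c2 Gr.vol = 0 := Gr.c2_mk _ _ _ _ _ _ _ _
    have e3 : Gr.c012 Gr.vol = 1 := Gr.c012_mk _ _ _ _ _ _ _ _
    -- Passing to the new source coordinates applies the opposite shift, with quadratic part `Sa`
    -- and cubic coefficient `-cubicCoeff Sa`. The total cubic coefficient is then `v 0` times the
    -- left side of `cubic`.
    rw [shifted_base, a.fn_shifted S hz, ShiftData.app, Gr.c012_shift (S.neg.deg2_N _), hd _ e0,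
      hd _ e1, hd _ e2, hv, hv, (hg 1).1, (hg 1).2, (hg 2).1, (hg 2).2, e0, e3]
    change _ + (Gr.c12 (-S.N (a.base x)) * _ - Gr.c02 (-S.N (a.base x)) * _ +
      Gr.c01 (-S.N (a.base x)) * _) + -S.κ (a.base x) * _ = 0
    rw [← hSa', hSκ, hTκ]
    simp only [Pi.single_apply, Fin.reduceEq, if_false, mul_zero, add_zero]
    linear_combination v 0 * key

end IsSuperconformalTransition

end

end Supermanifold.Chart

variable {C : Type u} [TopologicalSpace C] [ChartedSpace ℂ C] {E : C → Type u}
    [∀ x, AddCommGroup (E x)] [∀ x, Module ℂ (E x)] [∀ x, TopologicalSpace (E x)]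
    [TopologicalSpace (Bundle.TotalSpace (Fin 3 → ℂ) E)] [FiberBundle (Fin 3 → ℂ) E]
    [VectorBundle ℂ (Fin 3 → ℂ) E] [ContMDiffVectorBundle ω (Fin 3 → ℂ) E 𝓘(ℂ)]
    [IsManifold 𝓘(ℂ) ω C] {X : Supermanifold 3 E}

theorem holAt_cubicCoeff {S : ℂ → Gr} {z : ℂ} (hS : HolAt S z) : HolAt (cubicCoeff S) z := by
  have h := ((((hS.hderiv.map Gr.c12).add ((hS.map Gr.c01).mul (hS.hderiv.map Gr.c02))).sub
    ((hS.map Gr.c02).mul (hS.hderiv.map Gr.c01))).neg.mul (HolAt.const (2 : ℂ)⁻¹))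
  exact h.congr (Filter.Eventually.of_forall fun w => div_eq_mul_inv _ _)

open scoped Classical in
/-- A superconformal atlas whose obstruction class vanishes defines a split supermanifold. -/
theorem SuperconformalAtlas.isSplit (𝔄 : SuperconformalAtlas (n := 2) X)
    (h : (obstructionSheaf 3 E).classOf 𝔄.toAtlas.cocycle = 0) : X.IsSplit := by
  obtain ⟨𝔙, hle, σ, hσ, hc⟩ := (obstructionSheaf 3 E).exists_of_classOf_eq_zero _ h
  let t : C → C → Gr := fun a y =>
    -- The cochain exists only over the refined covering. The value zero outside makes the
    -- coefficients total and keeps them purely quadratic everywhere.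
    if hy : y ∈ 𝔙.set a then (𝔄.chart a).cof y (σ a ⟨y, hy⟩) else 0
  let S : C → ℂ → Gr := fun a z => t a ((𝔄.chart a).base.symm z)
  have hS : ∀ a, ∀ z ∈ imageOpens (𝔄.chart a).base (𝔙.set a), HolAt (S a) z := fun a z hz =>
    HolAt.comp ((𝔄.chart a).holAt_cof (hσ a) hz.2 (hle a hz.2))
      (contMDiffAt_symm_of_mem_maximalAtlas (𝔄.chart a).base_mem hz.1)
  have hS2 : ∀ a z, Gr.deg2 (S a z) = S a z := fun a z => by
    simp only [S, t]
    split_ifs with hy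
    · exact (𝔄.chart a).deg2_cof _
    · simp [Gr.deg2, Gr.mk]
  have hSx : ∀ a y (hy : y ∈ 𝔙.set a), S a ((𝔄.chart a).base y) =
      (𝔄.chart a).cof y (σ a ⟨y, hy⟩) := fun a y hy => by
    have e : (𝔄.chart a).base.symm ((𝔄.chart a).base y) = y := (𝔄.chart a).base.left_inv (hle a hy)
    exact (congrArg (t a) e).trans (dif_pos hy)
  -- The even coordinate is changed by minus the cochain, and `θ` by the cubic coefficient forced by
  -- it. Restricting the data to the image of `𝔙.set a` also shrinks the charts to the refined
  -- covering.
  let D : ∀ a, superAffine.ShiftData (imageOpens (𝔄.chart a).base (𝔙.set a)) := fun a =>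
    ⟨fun z => -S a z, cubicCoeff (S a), fun z hz => (hS a z hz).neg,
      fun z hz => holAt_cubicCoeff (hS a z hz), fun z => Gr.deg2_neg (hS2 a z)⟩
  have hD : ∀ a y, y ∈ ((𝔄.chart a).shifted (D a)).domain → y ∈ 𝔙.set a := fun a y hy => by
    have h1 := ((𝔄.chart a).mem_shifted_domain (D a)).1 hy
    exact ((𝔄.chart a).mem_image_iff h1.1).1 h1.2
  let 𝔅 : X.Atlas := ⟨fun a => (𝔄.chart a).shifted (D a), fun x =>
    ((𝔄.chart x).mem_shifted_domain (D x)).2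
      ⟨𝔄.mem_domain x, mem_image _ (𝔙.mem x) (𝔄.mem_domain x)⟩⟩
  refine Supermanifold.Atlas.isSplit (𝔄 := 𝔅) fun a b =>
    (𝔄.isSuperconformalTransition a b).isLinearTransition (D a) (D b) (Sa := S a) (Sb := S b)
      (fun _ => rfl) (fun _ => rfl) (fun _ => rfl) (fun _ => rfl) fun y hya hyb hy => ?_
  -- The coboundary relation on the refined covering, available because the new charts lie over its
  -- members.
  have h1 : (𝔄.chart a).obs (𝔄.chart b) y = σ b ⟨y, hD b y hyb⟩ - σ a ⟨y, hD a y hya⟩ :=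
    hc a b y (hD a y hya) (hD b y hyb)
  rw [hSx a y (hD a y hya), hSx b y (hD b y hyb)]
  exact (𝔄.chart a).nil_eq_of_obs_eq (𝔄.chart b) hy h1

end SuperGeom

end

theorem mainTheorem1 {C : Type u} [TopologicalSpace C] [T2Space C] [CompactSpace C]
    [ConnectedSpace C] [ChartedSpace ℂ C] [IsManifold 𝓘(ℂ) ω C]
    {L : C → Type u} [∀ x, AddCommGroup (L x)] [∀ x, Module ℂ (L x)]
    [∀ x, TopologicalSpace (L x)] [TopologicalSpace (Bundle.TotalSpace (Fin 1 → ℂ) L)]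
    [FiberBundle (Fin 1 → ℂ) L] [VectorBundle ℂ (Fin 1 → ℂ) L]
    [ContMDiffVectorBundle ω (Fin 1 → ℂ) L 𝓘(ℂ)]
    {E : C → Type u} [∀ x, AddCommGroup (E x)] [∀ x, Module ℂ (E x)]
    [∀ x, TopologicalSpace (E x)] [TopologicalSpace (Bundle.TotalSpace (Fin 3 → ℂ) E)]
    [FiberBundle (Fin 3 → ℂ) E] [VectorBundle ℂ (Fin 3 → ℂ) E]
    [ContMDiffVectorBundle ω (Fin 3 → ℂ) E 𝓘(ℂ)]
    (S : SuperRiemannSurface L) (hgenus : 1 < genus C)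
    (X : Supermanifold 3 E) (hX : IsOddDeformation (n := 2) S X) :
    ∃ o : (obstructionSheaf 3 E).H1,
      X.IsPrimaryObstructionClass o ∧ (X.IsSplit ↔ o = 0) := by
  obtain ⟨𝔄, -⟩ := hX
  exact ⟨_, Supermanifold.isPrimaryObstructionClass 𝔄.toAtlas,
    fun h => h.classOf_cocycle_eq_zero 𝔄.toAtlas, fun h => 𝔄.isSplit h⟩
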